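/- Let $\mathfrak g$ be a finite-dimensional simple complex Lie algebra, $\mathfrak h\subset\mathfrak g$ a Cartan subalgebra, $(\cdot,\cdot)$ the Killing form, $I:\mathfrak g^*\to\mathfrak g$ the isomorphism it induces and $\Omega\in\mathfrak g\otimes\mathfrak g$ its Casimir element. Let $r:\mathfrak h^*\times\mathbb C\to\mathfrak g\otimes\mathfrak g$ be a classical dynamical $r$-matrix with spectral parameter, i.e. a meromorphic function such that $[h\otimes1+1\otimes h,\,r(q,z)]=0$ for $h\in\mathfrak h$; $r(q,z)+r^{21}(q,-z)=0$; $\operatorname{Res}_{z=0}r(q,z)=\Omega$; and, with $z_{i,j}=z_i-z_j$, $$\mathrm{Alt}(d_{\mathfrak h}r)+[r^{12}(q,z_{1,2}),r^{13}(q,z_{1,3})]+[r^{12}(q,z_{1,2}),r^{23}(q,z_{2,3})]+[r^{13}(q,z_{1,3}),r^{23}(q,z_{2,3})]=0,$$ where $\mathrm{Alt}(d_{\mathfrak h}r)=\sum_i\big(x_i^{(1)}\partial_i r^{23}(q,z_{2,3})+x_i^{(2)}\partial_i r^{31}(q,z_{3,1})+x_i^{(3)}\partial_i r^{12}(q,z_{1,2})\big)$,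 $(x_i)$ is a basis of $\mathfrak h$ and $\partial_i$ is the derivative along the $i$-th vector of the dual basis of $\mathfrak h^*$. Let $L\mathfrak g$ (resp. $L\mathfrak g^*$) be the space of Laurent series $\sum_{n\ge -N}\xi_nz^n$ with coefficients in $\mathfrak g$ (resp. $\mathfrak g^*$) that converge in some punctured disc around $0$, paired by $(X,\eta)=\operatorname{Res}_{z=0}\langle\eta(z),X(z)\rangle\,dz$; the bracket of $L\mathfrak g$ and the map $I:L\mathfrak g^*\to L\mathfrak g$ are pointwise, and $i^*:L\mathfrak g^*\to\mathfrak h^*$ is the transpose of the inclusion $i$ of $\mathfrak h$ in $L\mathfrak g$ as constant series. Let $D\subset\mathfrak h^*$ be the open set of those $q_0$ for which there are $r_0>0$ and a neighbourhood $U$ of $q_0$ such that $r$ is holomorphic at every point of $U\times\{0<|z|<r_0\}$. Then there is a map $R$ assigning to each $q\in D$ a linear map $R_q:L\mathfrak g^*\to L\mathfrak g$ (necessarily unique) such that, whenever $r$ is holomorphic at $(q,z)$ for all $0<|z|<r_0$, and $\xi\in L\mathfrak g^*$ converges for $0<|z|<\rho$, the series $R_q\xi$ converges for $0<|z|<\min(\frac12r_0,\rho)$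 and there $$(R_q\xi)(z)=\mathrm{p.v.}\,\frac1{2\pi i}\oint_{|w|=|z|}\big(r(q,w-z),\,\xi(w)\otimes1\big)\,dw .$$ For every $q\in D$, the map $R_q$ is equivariant under the Cartan subgroup $H=\exp\mathfrak h$ (acting pointwise by the adjoint action on $L\mathfrak g$ and the coadjoint action on $L\mathfrak g^*$), and $R$ satisfies at $q$ the modified dynamical Yang–Baxter equation with $c=-\frac14$: for all $\xi,\eta\in L\mathfrak g^*$ the derivatives below exist and $$[R\xi,R\eta]-R\big(I^{-1}[R\xi,I\eta]+I^{-1}[I\xi,R\eta]\big)+\mathcal X_{i^*\xi}(R\eta)-\mathcal X_{i^*\eta}(R\xi)+d(R\xi,\eta)=-\tfrac14[I\xi,I\eta],$$ where $\mathcal X_a$ is the derivative in $q$ along the constant vector field $a\in\mathfrak h^*$, taken pointwise in $z$, and $d(R\xi,\eta)\in T_q^*\mathfrak h^*=\mathfrak h\subset L\mathfrak g$ is the differential of the function $q\mapsto(R_q\xi,\eta)$. -/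

import Mathlib

open scoped TensorProduct Topology

noncomputable section

namespace SpinCM

/-! ### Finite-dimensional complex vector spaces

A finite-dimensional complex vector space carries exactly one Hausdorff vector space topology.
Convergence, analyticity and integration of maps *into* such a space are expressed by applying
linear functionals, or coordinates in a basis, which does not depend on any choice. -/

section VectorValued

variable {V W : Type*} [AddCommGroup V] [Module ℂ V] [AddCommGroup W] [Module ℂ W]

/-- Derivative of a curve in a finite-dimensional vector space, computed in coordinates. -/
def vderiv [FiniteDimensional ℂ V] (F : ℂ → V) (t : ℂ) : V :=
  ∑ i, deriv (fun s => (Module.finBasis ℂ V).coord i (F s)) t • Module.finBasis ℂ V i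

/-! ### Convergent Laurent series -/

/-- The Laurent series `∑ f n z ^ n` converges for `0 < |z| < ρ`. -/
def ConvergesOn (f : ℤ → V) (ρ : ℝ) : Prop :=
  ∀ φ : Module.Dual ℂ V, ∀ z : ℂ, 0 < ‖z‖ → ‖z‖ < ρ → Summable fun n : ℤ => φ (f n) * z ^ n

variable (V) in
/-- Laurent series `∑_{n ≥ -N} f n z ^ n` with coefficients in `V`, convergent in some punctured
disc `0 < |z| < ρ` (which may depend on the series). -/
def Loop : Submodule ℂ (ℤ → V) where
  carrier := {f | (∃ N : ℤ, ∀ n < N, f n = 0) ∧ ∃ ρ > 0, ConvergesOn f ρ}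
  zero_mem' := ⟨⟨0, fun _ _ => rfl⟩, 1, one_pos, fun φ z _ _ => by simp⟩
  add_mem' := by
    rintro f g ⟨⟨N, hN⟩, ρ, hρ, hf⟩ ⟨⟨M, hM⟩, σ, hσ, hg⟩
    refine ⟨⟨min N M, fun n hn => ?_⟩, min ρ σ, lt_min hρ hσ, fun φ z h0 hz => ?_⟩
    · simp [hN n (lt_of_lt_of_le hn (min_le_left _ _)),
        hM n (lt_of_lt_of_le hn (min_le_right _ _))]
    · have := (hf φ z h0 (lt_of_lt_of_le hz (min_le_left _ _))).add
        (hg φ z h0 (lt_of_lt_of_le hz (min_le_right _ _)))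
      refine this.congr fun n => ?_
      simp [add_mul]
  smul_mem' := by
    rintro c f ⟨⟨N, hN⟩, ρ, hρ, hf⟩
    refine ⟨⟨N, fun n hn => by simp [hN n hn]⟩, ρ, hρ, fun φ z h0 hz => ?_⟩
    refine ((hf φ z h0 hz).mul_left c).congr fun n => ?_
    simp [mul_assoc]

/-- The value at `z` of the sum of a Laurent series. -/
def val [FiniteDimensional ℂ V] (f : ℤ → V) (z : ℂ) : V :=
  ∑ i, (∑' n : ℤ, (Module.finBasis ℂ V).coord i (f n) * z ^ n) • Module.finBasis ℂ V i

/-- Coefficientwise action of a linear map on Laurent series. -/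
def Loop.map (T : V →ₗ[ℂ] W) : Loop V →ₗ[ℂ] Loop W where
  toFun f := ⟨fun n => T (f.1 n), by
    obtain ⟨⟨N, hN⟩, ρ, hρ, hf⟩ := f.2
    exact ⟨⟨N, fun n hn => by simp [hN n hn]⟩, ρ, hρ, fun φ z h0 hz => hf (φ ∘ₗ T) z h0 hz⟩⟩
  map_add' f g := by ext n; simp
  map_smul' c f := by ext n; simp

/-- A vector of `V`, as a constant Laurent series. -/
def Loop.const (x : V) : Loop V :=
  ⟨Pi.single 0 x, ⟨0, fun n hn => by simp [hn.ne]⟩, 1, one_pos, fun φ z _ _ => by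
    refine summable_of_ne_finset_zero (s := {0}) fun n hn => ?_
    have : n ≠ 0 := by simpa using hn
    simp [this]⟩

/-- The residue pairing `⟨η, X⟩ = Res_{z = 0} ⟨η(z), X(z)⟩ dz` of `V*`-valued with `V`-valued
Laurent series. -/
def Loop.pairing (η : Loop (Module.Dual ℂ V)) (X : Loop V) : ℂ :=
  ∑ᶠ k : ℤ, η.1 k (X.1 (-1 - k))

theorem Loop.pairing_const (η : Loop (Module.Dual ℂ V)) (x : V) :
    Loop.pairing η (Loop.const x) = η.1 (-1) x := by
  unfold Loop.pairing Loop.const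
  rw [finsum_eq_single _ (-1)]
  · simp
  · intro k hk
    have : (-1 - k) ≠ 0 := by omega
    simp [this]

end VectorValued

section LieAlgebra

variable {g : Type*} [LieRing g] [LieAlgebra ℂ g]

/-! ### The loop algebra `Lg` -/

/-- Coefficients of the bracket of two Laurent series: a Cauchy product. -/
def bracketCoeff (X Y : ℤ → g) (n : ℤ) : g := ∑ᶠ k : ℤ, ⁅X k, Y (n - k)⁆

theorem lie_coord [FiniteDimensional ℂ g] (φ : Module.Dual ℂ g) (x y : g) :
    φ ⁅x, y⁆ = ∑ i, ∑ j, φ ⁅Module.finBasis ℂ g i, Module.finBasis ℂ g j⁆ *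
      ((Module.finBasis ℂ g).coord i x * (Module.finBasis ℂ g).coord j y) := by
  conv_lhs => rw [← (Module.finBasis ℂ g).sum_repr x, ← (Module.finBasis ℂ g).sum_repr y]
  simp only [sum_lie, lie_sum, smul_lie, lie_smul, map_sum,
    map_smul, smul_eq_mul, Module.Basis.coord_apply, Finset.mul_sum]
  refine Finset.sum_comm.trans ?_
  refine Finset.sum_congr rfl fun i _ => ?_
  refine Finset.sum_congr rfl fun j _ => ?_
  ring

theorem bracketCoeff_mem [FiniteDimensional ℂ g] (X Y : Loop g) :
    bracketCoeff X.1 Y.1 ∈ Loop g := by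
  obtain ⟨⟨N, hN⟩, ρ, hρ, hX⟩ := X.2
  obtain ⟨⟨M, hM⟩, σ, hσ, hY⟩ := Y.2
  have hzero : ∀ n k : ℤ, k ∉ Finset.Icc N (n - M) → ⁅X.1 k, Y.1 (n - k)⁆ = 0 := by
    intro n k hk
    rw [Finset.mem_Icc, not_and_or] at hk
    rcases hk with hk | hk
    · simp [hN k (by omega)]
    · simp [hM (n - k) (by omega)]
  have hsum : ∀ n : ℤ, bracketCoeff X.1 Y.1 n =
      ∑ k ∈ Finset.Icc N (n - M), ⁅X.1 k, Y.1 (n - k)⁆ := by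
    intro n
    refine finsum_eq_sum_of_support_subset _ fun k hk => ?_
    by_contra h
    exact hk (hzero n k h)
  refine ⟨⟨N + M, fun n hn => ?_⟩, min ρ σ, lt_min hρ hσ, fun φ z h0 hz => ?_⟩
  · rw [hsum, Finset.Icc_eq_empty (by omega), Finset.sum_empty]
  have hz0 : z ≠ 0 := norm_pos_iff.mp h0
  let b := Module.finBasis ℂ g
  have hF : Summable fun p : ℤ × ℤ => φ ⁅X.1 p.1, Y.1 p.2⁆ * (z ^ p.1 * z ^ p.2) := by
    have h1 : ∀ i j, Summable fun p : ℤ × ℤ =>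
        (b.coord i (X.1 p.1) * z ^ p.1) * (b.coord j (Y.1 p.2) * z ^ p.2) := fun i j =>
      summable_mul_of_summable_norm (f := fun k : ℤ => b.coord i (X.1 k) * z ^ k)
        (g := fun k : ℤ => b.coord j (Y.1 k) * z ^ k)
        (Summable.norm (hX (b.coord i) z h0 (lt_of_lt_of_le hz (min_le_left _ _))))
        (Summable.norm (hY (b.coord j) z h0 (lt_of_lt_of_le hz (min_le_right _ _))))
    have h2 : Summable fun p : ℤ × ℤ => ∑ i, ∑ j, φ ⁅b i, b j⁆ *
        ((b.coord i (X.1 p.1) * z ^ p.1) * (b.coord j (Y.1 p.2) * z ^ p.2)) :=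
      summable_sum fun i _ => summable_sum fun j _ => (h1 i j).mul_left _
    refine h2.congr fun p => ?_
    rw [lie_coord φ (X.1 p.1) (Y.1 p.2), Finset.sum_mul]
    refine Finset.sum_congr rfl fun i _ => ?_
    rw [Finset.sum_mul]
    refine Finset.sum_congr rfl fun j _ => ?_
    ring
  let e : ℤ × ℤ ≃ ℤ × ℤ :=
    { toFun := fun p => (p.2, p.1 - p.2)
      invFun := fun p => (p.1 + p.2, p.1)
      left_inv := fun p => by ext <;> simp
      right_inv := fun p => by ext <;> simp }
  refine ((e.summable_iff.mpr hF).prod).congr fun n => ?_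
  rw [tsum_eq_sum (s := Finset.Icc N (n - M)), hsum, map_sum, Finset.sum_mul]
  · refine Finset.sum_congr rfl fun k _ => ?_
    simp only [e, Function.comp, Equiv.coe_fn_mk]
    rw [← zpow_add₀ hz0, add_sub_cancel]
  · intro k hk
    simp [e, hzero n k hk]

/-- The bracket of `Lg`, that is, the pointwise bracket of `g`-valued Laurent series. -/
def Loop.bracket [FiniteDimensional ℂ g] (X Y : Loop g) : Loop g :=
  ⟨bracketCoeff X.1 Y.1, bracketCoeff_mem X Y⟩

/-! ### The Killing form: the isomorphism `I` and the Casimir element `Ω` -/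

/-- The isomorphism `I : g* ≃ g` induced by the Killing form. -/
def killingIso (g : Type*) [LieRing g] [LieAlgebra ℂ g] [FiniteDimensional ℂ g]
    [LieAlgebra.IsSimple ℂ g] : Module.Dual ℂ g ≃ₗ[ℂ] g :=
  (LinearMap.BilinForm.toDual (killingForm ℂ g)
    (LieAlgebra.IsKilling.killingForm_nondegenerate ℂ g)).symm

/-- The Casimir element `Ω = ∑ eᵢ ⊗ eⁱ`, where `(eᵢ)`, `(eⁱ)` are bases dual to each other with
respect to the Killing form. -/
def casimir (g : Type*) [LieRing g] [LieAlgebra ℂ g] [FiniteDimensional ℂ g]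
    [LieAlgebra.IsSimple ℂ g] : g ⊗[ℂ] g :=
  ∑ i, Module.finBasis ℂ g i ⊗ₜ[ℂ] killingIso g ((Module.finBasis ℂ g).coord i)

/-! ### Triple tensors -/

/-- The bracket as a linear map `g ⊗ g → g`. -/
def lieLin : g ⊗[ℂ] g →ₗ[ℂ] g := 
  (LieModule.toModuleHom ℂ g g : g ⊗[ℂ] g →ₗ[ℂ] g)

/-- `[s¹², t¹³]` -/
def br1213 (s t : g ⊗[ℂ] g) : g ⊗[ℂ] (g ⊗[ℂ] g) :=
  TensorProduct.map lieLin LinearMap.id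
    (TensorProduct.tensorTensorTensorComm ℂ g g g g (s ⊗ₜ[ℂ] t))

/-- `[s¹², t²³]` -/
def br1223 (s t : g ⊗[ℂ] g) : g ⊗[ℂ] (g ⊗[ℂ] g) :=
  TensorProduct.map LinearMap.id
    (TensorProduct.map lieLin LinearMap.id ∘ₗ (TensorProduct.assoc ℂ g g g).symm.toLinearMap)
    (TensorProduct.assoc ℂ g g (g ⊗[ℂ] g) (s ⊗ₜ[ℂ] t))

/-- `[s¹³, t²³]` -/
def br1323 (s t : g ⊗[ℂ] g) : g ⊗[ℂ] (g ⊗[ℂ] g) :=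
  TensorProduct.assoc ℂ g g g (TensorProduct.map LinearMap.id lieLin
    (TensorProduct.tensorTensorTensorComm ℂ g g g g (s ⊗ₜ[ℂ] t)))

/-- `x⁽¹⁾ s²³` -/
def ins1 (x : g) (s : g ⊗[ℂ] g) : g ⊗[ℂ] (g ⊗[ℂ] g) := x ⊗ₜ[ℂ] s

/-- `x⁽²⁾ s³¹` -/
def ins2 (x : g) (s : g ⊗[ℂ] g) : g ⊗[ℂ] (g ⊗[ℂ] g) :=
  TensorProduct.leftComm ℂ g g g (x ⊗ₜ[ℂ] TensorProduct.comm ℂ g g s)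

/-- `x⁽³⁾ s¹²` -/
def ins3 (x : g) (s : g ⊗[ℂ] g) : g ⊗[ℂ] (g ⊗[ℂ] g) :=
  TensorProduct.assoc ℂ g g g (s ⊗ₜ[ℂ] x)

theorem br1213_tmul (a b c d : g) :
    br1213 (a ⊗ₜ[ℂ] b) (c ⊗ₜ[ℂ] d) = ⁅a, c⁆ ⊗ₜ[ℂ] (b ⊗ₜ[ℂ] d) := rfl

theorem br1223_tmul (a b c d : g) :
    br1223 (a ⊗ₜ[ℂ] b) (c ⊗ₜ[ℂ] d) = a ⊗ₜ[ℂ] (⁅b, c⁆ ⊗ₜ[ℂ] d) := rfl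

theorem br1323_tmul (a b c d : g) :
    br1323 (a ⊗ₜ[ℂ] b) (c ⊗ₜ[ℂ] d) = a ⊗ₜ[ℂ] (c ⊗ₜ[ℂ] ⁅b, d⁆) := rfl

theorem ins2_tmul (x a b : g) : ins2 x (a ⊗ₜ[ℂ] b) = b ⊗ₜ[ℂ] (x ⊗ₜ[ℂ] a) := rfl

theorem ins3_tmul (x a b : g) : ins3 x (a ⊗ₜ[ℂ] b) = a ⊗ₜ[ℂ] (b ⊗ₜ[ℂ] x) := rfl

/-- Contraction of the first tensor factor with a functional:
`(a ⊗ b, φ ⊗ 1) = φ(a) b`. -/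
def contract (φ : Module.Dual ℂ g) : g ⊗[ℂ] g →ₗ[ℂ] g :=
  (TensorProduct.lid ℂ g).toLinearMap ∘ₗ TensorProduct.map φ LinearMap.id

/-- `i* : Lg* → h*`, the transpose of the inclusion of `h` in `Lg` as constant series, with
respect to the residue pairing. -/
def iStar (H : LieSubalgebra ℂ g) (ξ : Loop (Module.Dual ℂ g)) : Module.Dual ℂ H := (ξ.1 (-1)).comp H.subtype

theorem iStar_apply (H : LieSubalgebra ℂ g) (ξ : Loop (Module.Dual ℂ g)) (h : H) :
    iStar H ξ h = Loop.pairing ξ (Loop.const (h : g)) :=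
  (Loop.pairing_const ξ (h : g)).symm

/-! ### Dynamical r-matrices -/

section Cartan

variable [FiniteDimensional ℂ g] (H : LieSubalgebra ℂ g)

/-- The dual `h*` with the maximum norm of the coordinates in a basis; only the topology
matters, and it does not depend on the basis. -/
instance cartanDualNormedAddCommGroup : NormedAddCommGroup (Module.Dual ℂ H) :=
  NormedAddCommGroup.induced (Module.Dual ℂ H) (Fin (Module.finrank ℂ H) → ℂ)
    (Module.finBasis ℂ H).dualBasis.equivFun.toLinearMap
    (Module.finBasis ℂ H).dualBasis.equivFun.injective

instance cartanDualNormedSpace : NormedSpace ℂ (Module.Dual ℂ H) :=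
  NormedSpace.induced ℂ (Module.Dual ℂ H) (Fin (Module.finrank ℂ H) → ℂ)
    (Module.finBasis ℂ H).dualBasis.equivFun.toLinearMap

variable {H}

/-- `r : h* × ℂ → g ⊗ g` is holomorphic at `(q, z)`, jointly in both variables. -/
def RegularAt (r : Module.Dual ℂ H → ℂ → g ⊗[ℂ] g) (q : Module.Dual ℂ H) (z : ℂ) : Prop :=
  ∀ φ : Module.Dual ℂ (g ⊗[ℂ] g),
    AnalyticAt ℂ (fun p : Module.Dual ℂ H × ℂ => φ (r p.1 p.2)) (q, z)

/-- `r` is meromorphic on `h* × ℂ`: near every point it is a quotient `f / d` of holomorphic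
functions with `d` not identically zero. (Its values at the zeros of `d` are irrelevant.) -/
def IsMeromorphic (r : Module.Dual ℂ H → ℂ → g ⊗[ℂ] g) : Prop :=
  ∀ p₀ : Module.Dual ℂ H × ℂ,
    ∃ (f : Module.Dual ℂ H × ℂ → g ⊗[ℂ] g) (d : Module.Dual ℂ H × ℂ → ℂ),
      (∀ φ : Module.Dual ℂ (g ⊗[ℂ] g), AnalyticAt ℂ (fun p => φ (f p)) p₀) ∧
      AnalyticAt ℂ d p₀ ∧ (∃ᶠ p in 𝓝 p₀, d p ≠ 0) ∧
      ∀ᶠ p in 𝓝 p₀, d p ≠ 0 → r p.1 p.2 = (d p)⁻¹ • f p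

/-- `r(q, ·)` has no pole in `|z| < r₀` other than `0`. -/
def NoPole (r : Module.Dual ℂ H → ℂ → g ⊗[ℂ] g) (q : Module.Dual ℂ H) (r₀ : ℝ) : Prop :=
  0 < r₀ ∧ ∀ z : ℂ, 0 < ‖z‖ → ‖z‖ < r₀ → RegularAt r q z

/-- The open set of those `q` near which `r` has no pole in some fixed punctured disc around
`z = 0`. -/
def regularSet (r : Module.Dual ℂ H → ℂ → g ⊗[ℂ] g) : Set (Module.Dual ℂ H) :=
  {q | ∃ r₀ : ℝ, ∀ᶠ q' in 𝓝 q, NoPole r q' r₀}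

/-- Partial derivative of `r(·, z)` at `q` in the direction `a ∈ h*`. -/
def partialDeriv (r : Module.Dual ℂ H → ℂ → g ⊗[ℂ] g) (a q : Module.Dual ℂ H) (z : ℂ) :
    g ⊗[ℂ] g :=
  vderiv (fun t : ℂ => r (q + t • a) z) 0

/-- `Alt(d_h r) = ∑ᵢ xᵢ⁽¹⁾ ∂ᵢ r²³(q, z₂₃) + xᵢ⁽²⁾ ∂ᵢ r³¹(q, z₃₁) + xᵢ⁽³⁾ ∂ᵢ r¹²(q, z₁₂)` for a basis
`xᵢ` of `h`, where `∂ᵢ` is the derivative along the `i`-th vector of the dual basis of `h*`. -/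
def altD (r : Module.Dual ℂ H → ℂ → g ⊗[ℂ] g) (q : Module.Dual ℂ H) (z₁ z₂ z₃ : ℂ) :
    g ⊗[ℂ] (g ⊗[ℂ] g) :=
  ∑ i, (ins1 (Module.finBasis ℂ H i : g)
          (partialDeriv r ((Module.finBasis ℂ H).coord i) q (z₂ - z₃)) +
        ins2 (Module.finBasis ℂ H i : g)
          (partialDeriv r ((Module.finBasis ℂ H).coord i) q (z₃ - z₁)) +
        ins3 (Module.finBasis ℂ H i : g)
          (partialDeriv r ((Module.finBasis ℂ H).coord i) q (z₁ - z₂)))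

/-- Classical dynamical r-matrices with spectral parameter associated with `h ⊂ g`. The
identities are between meromorphic functions: they are required where all terms are regular. -/
structure IsDynamicalRMatrix [LieAlgebra.IsSimple ℂ g]
    (r : Module.Dual ℂ H → ℂ → g ⊗[ℂ] g) : Prop where
  meromorphic : IsMeromorphic r
  /-- `[h ⊗ 1 + 1 ⊗ h, r(q, z)] = 0` for `h ∈ h` -/
  zero_weight : ∀ q z, RegularAt r q z → ∀ h ∈ H, ⁅h, r q z⁆ = 0
  /-- `r(q, z) + r²¹(q, -z) = 0` -/
  unitarity : ∀ q z, RegularAt r q z → RegularAt r q (-z) →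
    r q z + TensorProduct.comm ℂ g g (r q (-z)) = 0
  /-- `Res_{z = 0} r(q, z) = Ω` -/
  residue : ∀ q ∈ regularSet r, ∀ φ : Module.Dual ℂ (g ⊗[ℂ] g), ∀ᶠ ε : ℝ in 𝓝[>] 0,
    (2 * Real.pi * Complex.I)⁻¹ * (∮ z in C(0, ε), φ (r q z)) = φ (casimir g)
  /-- the classical dynamical Yang–Baxter equation -/
  cdybe : ∀ q z₁ z₂ z₃,
    RegularAt r q (z₁ - z₂) → RegularAt r q (z₁ - z₃) → RegularAt r q (z₂ - z₃) →
    RegularAt r q (z₃ - z₁) →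
    altD r q z₁ z₂ z₃ + br1213 (r q (z₁ - z₂)) (r q (z₁ - z₃)) +
      br1223 (r q (z₁ - z₂)) (r q (z₂ - z₃)) + br1323 (r q (z₁ - z₃)) (r q (z₂ - z₃)) = 0

/-! ### The operator `R` -/

/-- `X` is the principal value of `(1 / 2πi) ∮_C F(w) dw`, where `C` is the positively oriented
circle of radius `|z|` around `0` and `F` is singular at `w = z`. -/
def IsCirclePV (F : ℂ → g) (z : ℂ) (X : g) : Prop :=
  ∀ φ : Module.Dual ℂ g,
    (∀ ε > 0, CircleIntegrable (Set.indicator {w | ε < ‖w - z‖} fun w => φ (F w)) 0 ‖z‖) ∧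
    Filter.Tendsto (fun ε : ℝ => (2 * Real.pi * Complex.I)⁻¹ *
        ∮ w in C(0, ‖z‖), Set.indicator {w | ε < ‖w - z‖} (fun w => φ (F w)) w)
      (𝓝[>] 0) (𝓝 (φ X))

/-- `R` is the operator of `r`: at every point `q` of the regular set, and for `r(q, ·)` without
poles in `0 < |z| < r₀` and `ξ ∈ Lg*` convergent in `0 < |z| < ρ`, the Laurent series `R_q ξ`
converges for `0 < |z| < min (r₀ / 2) ρ`, and there
`(R_q ξ)(z) = p.v. (1 / 2πi) ∮_C (r(q, w - z), ξ(w) ⊗ 1) dw`. -/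
def IsROperator (r : Module.Dual ℂ H → ℂ → g ⊗[ℂ] g)
    (R : Module.Dual ℂ H → Loop (Module.Dual ℂ g) →ₗ[ℂ] Loop g) : Prop :=
  ∀ q ∈ regularSet r, ∀ r₀ ρ : ℝ, NoPole r q r₀ →
    ∀ ξ : Loop (Module.Dual ℂ g), ConvergesOn ξ.1 ρ →
      ConvergesOn (R q ξ).1 (min (r₀ / 2) ρ) ∧
      ∀ z : ℂ, 0 < ‖z‖ → ‖z‖ < min (r₀ / 2) ρ →
        IsCirclePV (fun w => contract (val ξ.1 w) (r q (w - z))) z (val (R q ξ).1 z)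

/-- The exponential of a linear endomorphism of `g`. -/
def expEnd (T : Module.End ℂ g) : Module.End ℂ g :=
  Matrix.toLin (Module.finBasis ℂ g) (Module.finBasis ℂ g)
    (NormedSpace.exp (LinearMap.toMatrix (Module.finBasis ℂ g) (Module.finBasis ℂ g) T))

/-- `Ad_h : g → g` for the element `h = exp x` of the group. -/
def Ad (x : g) : g →ₗ[ℂ] g := expEnd (LieAlgebra.ad ℂ g x)

/-- The coadjoint action of `h = exp x` on `g*`: `ξ ↦ ξ ∘ Ad_{h⁻¹}`. -/
def coAd (x : g) : Module.Dual ℂ g →ₗ[ℂ] Module.Dual ℂ g := (Ad (-x)).dualMap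

variable (H) in
/-- `A : Lg* → Lg` is equivariant under the Cartan subgroup `H = exp h`. -/
def IsHEquivariant (A : Loop (Module.Dual ℂ g) →ₗ[ℂ] Loop g) : Prop :=
  ∀ x ∈ H, ∀ ξ, A (Loop.map (coAd x) ξ) = Loop.map (Ad x) (A ξ)

/-- `D ∈ Lg` is the derivative at `q`, along `a ∈ h*`, of the `Lg`-valued function `F` of
`q ∈ h*`: on a common punctured disc the values `F(q + t a)(z)` have derivative `D(z)` in `t`
at `t = 0`. -/
def HasLoopDeriv (F : Module.Dual ℂ H → Loop g) (a q : Module.Dual ℂ H) (D : Loop g) : Prop :=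
  ∃ ρ > 0, (∀ᶠ t : ℂ in 𝓝 0, ConvergesOn (F (q + t • a)).1 ρ) ∧ ConvergesOn D.1 ρ ∧
    ∀ z : ℂ, 0 < ‖z‖ → ‖z‖ < ρ → ∀ φ : Module.Dual ℂ g,
      HasDerivAt (fun t : ℂ => φ (val (F (q + t • a)).1 z)) (φ (val D.1 z)) 0

/-- The modified dynamical Yang–Baxter equation at `q` with constant `c`:
`[Rξ, Rη] - R(I⁻¹[Rξ, Iη] + I⁻¹[Iξ, Rη]) + X_{i*ξ}(Rη) - X_{i*η}(Rξ) + d(Rξ, η) = c [Iξ, Iη]`,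
including the existence of the derivatives. Here `d(Rξ, η)`, an element of `T*_q h* = h`, is viewed
as a constant element of `Lg`. -/
def SatisfiesMDYBE [LieAlgebra.IsSimple ℂ g]
    (R : Module.Dual ℂ H → Loop (Module.Dual ℂ g) →ₗ[ℂ] Loop g) (c : ℂ)
    (q : Module.Dual ℂ H) : Prop :=
  let I : Loop (Module.Dual ℂ g) →ₗ[ℂ] Loop g := Loop.map (killingIso g).toLinearMap
  let Iinv : Loop g →ₗ[ℂ] Loop (Module.Dual ℂ g) := Loop.map (killingIso g).symm.toLinearMap
  ∀ ξ η : Loop (Module.Dual ℂ g), ∃ (D₁ D₂ : Loop g) (v : H),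
    HasLoopDeriv (fun p => R p η) (iStar H ξ) q D₁ ∧
    HasLoopDeriv (fun p => R p ξ) (iStar H η) q D₂ ∧
    HasFDerivAt (fun p => Loop.pairing η (R p ξ))
      (LinearMap.toContinuousLinearMap (Module.Dual.eval ℂ H v)) q ∧
    Loop.bracket (R q ξ) (R q η)
        - R q (Iinv (Loop.bracket (R q ξ) (I η)) + Iinv (Loop.bracket (I ξ) (R q η)))
        + D₁ - D₂ + Loop.const (v : g)
      = c • Loop.bracket (I ξ) (I η)

end Cartan

end LieAlgebra

end SpinCM

end

open scoped TensorProduct Topology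

noncomputable section

namespace SpinCM

/-! ### Scalar power series and Laurent series -/

/-! At a regular point `q` the r-matrix is r(q, x) = Ω/x + h(q, x) with h holomorphic near x = 0. By
the Plemelj formula the principal value is then R = S + I/2, where Sξ(z) = Res_{w=0} (r(q, w - z),
ξ(w) ⊗ 1) dw with 1/(w - z) expanded in |w| < |z| (`innerOp`, `pvOp`, `isScalarPV_pvOp`). This gives
existence of R, and limits being unique, every other operator agrees with it on the regular set.
Equivariance holds because Ω and h are both invariant under the Cartan subalgebra.

That the pole is simple is not part of the definition and has to be extracted from the Yang–Baxter
equation. Suppose the pole has order at least two, with leading coefficient A. Expanding the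
equation as z₁ - z₂ → 0 gives [A¹², Ω¹³ + Ω²³] = 0 at lowest order and [A¹², A¹³] = 0 at the next
one. So A is invariant, the contractions of A form an ideal, and simplicity of g forces A = 0
(`eq_zero_of_invariant_of_commuting`, `IsDynamicalRMatrix.leading_coeff_eq_zero`). Joint meromorphy
provides a pole of finite order only for points arbitrarily close to `q`; a Cauchy integral over a
fixed circle, continuous in the parameter, carries the splitting to `q` itself
(`IsDynamicalRMatrix.exists_isRegularPart`). The Taylor coefficients of h are Cauchy integrals as
well, hence differentiable in q (`hasFDerivAt_taylorCoeff`), and only they contribute to the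
derivatives of R, since Ω/x and I do not depend on q.

Substituting R = S + I/2, the modified equation with constant -1/4 becomes [Sξ, Sη] - S I⁻¹([Sξ, Iη]
+ [Iξ, Sη] + [Iξ, Iη]) + derivative terms = 0. S kills power series and S + I takes values in power
series, so the bilinear left side (`mdybeDefect`) vanishes as soon as ξ or η is a power series.
There remain ξ = αw^(-1-m) and η = βw^(-1-n). For these, the value at z paired with γ is the
coefficient of x^m y^n in the Yang–Baxter equation at (x, y, z), paired with α ⊗ β ⊗ γ and expanded
at x = y = 0 (`IsDynamicalRMatrix.taylorCoeff_cdybe`). The pole Ω/(x - y) of r¹² enters only through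
a divided difference, whose coefficients are those of the term with [Iξ, Iη]. -/

theorem hasSum_congr {ι : Type*} {f g : ι → ℂ} {a : ℂ} (h : ∀ i, f i = g i) :
    HasSum f a ↔ HasSum g a := by
  rw [funext h]

/-- `f w = ∑ c n w ^ n` for `‖w‖ < δ`. -/
def HasTaylor (f : ℂ → ℂ) (c : ℕ → ℂ) (δ : ℝ) : Prop :=
  ∀ w : ℂ, ‖w‖ < δ → HasSum (fun n => c n * w ^ n) (f w)

namespace HasTaylor

variable {f g : ℂ → ℂ} {c d : ℕ → ℂ} {δ δ' : ℝ}

theorem mono (h : HasTaylor f c δ) (hδ : δ' ≤ δ) : HasTaylor f c δ' :=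
  fun w hw => h w (hw.trans_le hδ)

theorem congr (h : HasTaylor f c δ) (hfg : ∀ w, ‖w‖ < δ → f w = g w) : HasTaylor g c δ :=
  fun w hw => hfg w hw ▸ h w hw

theorem add (hf : HasTaylor f c δ) (hg : HasTaylor g d δ) :
    HasTaylor (fun w => f w + g w) (fun n => c n + d n) δ := fun w hw => by
  simpa only [add_mul] using (hf w hw).add (hg w hw)

theorem const_mul (a : ℂ) (hf : HasTaylor f c δ) :
    HasTaylor (fun w => a * f w) (fun n => a * c n) δ := fun w hw => by
  simpa only [mul_assoc] using (hf w hw).mul_left a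

theorem sum {ι : Type*} {s : Finset ι} {f : ι → ℂ → ℂ} {c : ι → ℕ → ℂ}
    (h : ∀ i ∈ s, HasTaylor (f i) (c i) δ) :
    HasTaylor (fun w => ∑ i ∈ s, f i w) (fun n => ∑ i ∈ s, c i n) δ := fun w hw => by
  simpa only [Finset.sum_mul] using hasSum_sum fun i hi => h i hi w hw

theorem zero : HasTaylor (fun _ => 0) (fun _ => 0) δ := fun w _ => by simp

/-- Summability at each real point s < δ makes c n s^n tend to 0, which bounds the radius of
convergence from below. -/
theorem hasFPowerSeriesOnBall (h : HasTaylor f c δ) (hδ : 0 < δ) :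
    HasFPowerSeriesOnBall f (FormalMultilinearSeries.ofScalars ℂ c) 0 (ENNReal.ofReal δ) := by
  refine ⟨?_, by simpa using hδ, fun {y} hy => ?_⟩
  · refine ENNReal.le_of_forall_nnreal_lt fun s hs => ?_
    have hs' : (s : ℝ) < δ := by
      rw [← ENNReal.ofReal_coe_nnreal, ENNReal.ofReal_lt_ofReal_iff hδ] at hs
      exact hs
    refine FormalMultilinearSeries.le_radius_of_tendsto _ (l := 0) ?_
    have := (h (s : ℂ) (by simpa using hs')).summable.tendsto_atTop_zero.norm
    simpa [FormalMultilinearSeries.ofScalars_norm_eq_mul] using this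
  · have hy' : ‖y‖ < δ := by
      rw [Metric.eball_ofReal] at hy
      simpa using hy
    simpa [FormalMultilinearSeries.ofScalars_apply_eq, zero_add, smul_eq_mul, mul_comm] using h y hy'

theorem analyticAt (h : HasTaylor f c δ) {w : ℂ} (hw : ‖w‖ < δ) : AnalyticAt ℂ f w := by
  have hδ : 0 < δ := (norm_nonneg w).trans_lt hw
  refine (h.hasFPowerSeriesOnBall hδ).analyticAt_of_mem ?_
  rw [Metric.eball_ofReal]
  simpa using hw

theorem differentiableOn (h : HasTaylor f c δ) : DifferentiableOn ℂ f (Metric.ball 0 δ) :=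
  fun w hw => (h.analyticAt (by simpa using hw)).differentiableAt.differentiableWithinAt

theorem of_differentiableOn (h : DifferentiableOn ℂ f (Metric.ball 0 δ)) :
    ∃ c, HasTaylor f c δ := by
  refine ⟨fun n => ((n.factorial : ℂ))⁻¹ * iteratedDeriv n f 0, fun w hw => ?_⟩
  have := Complex.hasSum_taylorSeries_on_ball h (z := w) (by simpa using hw)
  simp only [sub_zero, smul_eq_mul] at this
  exact (hasSum_congr fun n => by ring).mp this

theorem of_analyticAt (h : AnalyticAt ℂ f 0) : ∃ c, ∃ ε > 0, HasTaylor f c ε := by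
  obtain ⟨ε, hε, hb⟩ := Metric.eventually_nhds_iff_ball.mp h.eventually_analyticAt
  obtain ⟨c, hc⟩ := of_differentiableOn (f := f) (δ := ε)
    fun w hw => (hb w hw).differentiableAt.differentiableWithinAt
  exact ⟨c, ε, hε, hc⟩

theorem unique (hf : HasTaylor f c δ) (hδ : 0 < δ) (hg : HasTaylor g d δ') (hδ' : 0 < δ')
    (h : ∀ᶠ w in 𝓝 0, f w = g w) : c = d := by
  have := HasFPowerSeriesAt.eq_formalMultilinearSeries_of_eventually
    (hf.hasFPowerSeriesOnBall hδ).hasFPowerSeriesAt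
    (hg.hasFPowerSeriesOnBall hδ').hasFPowerSeriesAt h
  exact FormalMultilinearSeries.ofScalars_series_injective ℂ ℂ this

/-- By the identity theorem the value at 0 is irrelevant. This matters for functions such as r(q, x)
- Ω/x, whose value at 0 carries no information. -/
theorem unique_punctured (hf : HasTaylor f c δ) (hδ : 0 < δ) (hg : HasTaylor g d δ')
    (hδ' : 0 < δ') (h : ∀ᶠ w in 𝓝[≠] 0, f w = g w) : c = d := by
  refine hf.unique hδ hg hδ' ?_
  have h0 : AnalyticAt ℂ f 0 := hf.analyticAt (by simpa using hδ)
  have h1 : AnalyticAt ℂ g 0 := hg.analyticAt (by simpa using hδ')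
  exact (h0.frequently_eq_iff_eventually_eq h1).mp h.frequently

theorem apply_zero (hf : HasTaylor f c δ) (hδ : 0 < δ) : f 0 = c 0 := by
  have := hf 0 (by simpa using hδ)
  refine this.unique ?_
  simpa using hasSum_single (f := fun n => c n * (0 : ℂ) ^ n) 0 (by intro n hn; simp [hn])

theorem mul_self (hf : HasTaylor f c δ) :
    HasTaylor (fun w => w * f w) (fun n => if n = 0 then 0 else c (n - 1)) δ := fun w hw => by
  rw [← hasSum_nat_add_iff' 1]
  simp only [Finset.range_one, Finset.sum_singleton, ↓reduceIte, zero_mul, sub_zero,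
    Nat.add_eq_zero_iff, one_ne_zero, and_false, add_tsub_cancel_right]
  exact (hasSum_congr fun n => by rw [pow_succ]; ring).mp ((hf w hw).mul_left w)

theorem mul (hf : HasTaylor f c δ) (hg : HasTaylor g d δ) :
    HasTaylor (fun w => f w * g w)
      (fun n => ∑ p ∈ Finset.HasAntidiagonal.antidiagonal n, c p.1 * d p.2) δ := fun w hw => by
  have h1 := (hf w hw).summable.norm
  have h2 := (hg w hw).summable.norm
  have h3 := summable_norm_sum_mul_antidiagonal_of_summable_norm h1 h2
  have h4 := tsum_mul_tsum_eq_tsum_sum_antidiagonal_of_summable_norm h1 h2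
  rw [(hf w hw).tsum_eq, (hg w hw).tsum_eq] at h4
  show HasSum _ (f w * g w)
  rw [h4]
  refine (hasSum_congr fun n => ?_).mp h3.of_norm.hasSum
  rw [Finset.sum_mul]
  refine Finset.sum_congr rfl fun p hp => ?_
  rw [← Finset.HasAntidiagonal.mem_antidiagonal.mp hp, pow_add]; ring

/-- The expansion of `f (x + y)` in two variables. -/
theorem add_arg (hf : HasTaylor f c δ) {x y : ℂ} (h : ‖x‖ + ‖y‖ < δ) :
    HasSum (fun p : ℕ × ℕ => c (p.1 + p.2) * ((p.1 + p.2).choose p.1 : ℂ) * x ^ p.1 * y ^ p.2)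
      (f (x + y)) := by
  set u : ℕ × ℕ → ℂ :=
    fun p => c (p.1 + p.2) * ((p.1 + p.2).choose p.1 : ℂ) * x ^ p.1 * y ^ p.2 with hu
  let e := Finset.HasAntidiagonal.sigmaAntidiagonalEquivProd (A := ℕ)
  have key : ∀ a b : ℂ, ∀ n, ∑ p ∈ Finset.HasAntidiagonal.antidiagonal n,
      ((n.choose p.1 : ℂ) * a ^ p.1 * b ^ p.2) = (a + b) ^ n := fun a b n => by
    rw [(Commute.all a b).add_pow']
    refine Finset.sum_congr rfl fun p _ => ?_
    simp [nsmul_eq_mul, mul_assoc]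
  -- Absolute convergence: the norms on the n-th antidiagonal add up to |c n| (‖x‖ + ‖y‖)^n, which
  -- is a term of the series of f at a point of the disc.
  have hs : Summable (u ∘ e) := by
    refine Summable.of_norm ?_
    rw [summable_sigma_of_nonneg fun _ => norm_nonneg _]
    refine ⟨fun n => Summable.of_finite, ?_⟩
    have h1 := (hf ((‖x‖ + ‖y‖ : ℝ) : ℂ) (by
      rw [Complex.norm_real, Real.norm_of_nonneg (by positivity)]; exact h)).summable.norm
    refine h1.congr fun n => ?_
    rw [tsum_fintype, norm_mul, norm_pow, Complex.norm_real, Real.norm_of_nonneg (by positivity)]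
    have h2 := key (‖x‖ : ℂ) (‖y‖ : ℂ) n
    have h3 : ∑ p ∈ Finset.HasAntidiagonal.antidiagonal n, ((n.choose p.1 : ℝ) * ‖x‖ ^ p.1 * ‖y‖ ^ p.2)
        = (‖x‖ + ‖y‖) ^ n := by exact_mod_cast h2
    rw [← h3, Finset.mul_sum, ← Finset.sum_coe_sort]
    refine Finset.sum_congr rfl fun p _ => ?_
    have hp := Finset.HasAntidiagonal.mem_antidiagonal.mp p.2
    simp [hu, e, Finset.HasAntidiagonal.sigmaAntidiagonalEquivProd, hp, mul_assoc]
  have hs' : Summable u := e.summable_iff.mp hs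
  have h4 : HasSum (u ∘ e) (∑' p, u p) := e.hasSum_iff.mpr hs'.hasSum
  have h5 := h4.sigma (fun n => hasSum_fintype _)
  have h6 : f (x + y) = ∑' p, u p := by
    refine (hf (x + y) ((norm_add_le x y).trans_lt h)).unique ?_
    convert h5 using 2 with n
    rw [← key x y n, Finset.mul_sum, ← Finset.sum_coe_sort]
    refine Finset.sum_congr rfl fun p _ => ?_
    have hp := Finset.HasAntidiagonal.mem_antidiagonal.mp p.2
    simp [hu, e, Finset.HasAntidiagonal.sigmaAntidiagonalEquivProd, hp, mul_assoc]
  rw [h6]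
  exact hs'.hasSum

end HasTaylor

/-- The `n`-th Taylor coefficient at `y` of the power series with coefficients `c`. -/
def shiftCoeff (c : ℕ → ℂ) (y : ℂ) (n : ℕ) : ℂ :=
  ∑' l, c (n + l) * ((n + l).choose n : ℂ) * y ^ l

theorem HasTaylor.hasSum_shiftCoeff {f : ℂ → ℂ} {c : ℕ → ℂ} {δ : ℝ} (hf : HasTaylor f c δ)
    {y : ℂ} (hy : ‖y‖ < δ) (n : ℕ) :
    HasSum (fun l => c (n + l) * ((n + l).choose n : ℂ) * y ^ l) (shiftCoeff c y n) := by
  -- The sum over l is a row of the double series of f(x + y); any auxiliary x > 0 with x + ‖y‖ < δ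
  -- will do, and x^n is divided out afterwards.
  set x : ℝ := (δ - ‖y‖) / 2 with hx
  have hx0 : 0 < x := by rw [hx]; linarith
  have h := (hf.add_arg (x := (x : ℂ)) (y := y) (by
    rw [Complex.norm_real, Real.norm_of_nonneg hx0.le]; linarith)).summable.prod_factor n
  refine Summable.hasSum ?_
  have h2 := h.mul_left (((x : ℂ) ^ n)⁻¹)
  refine h2.congr fun l => ?_
  have : (x : ℂ) ^ n ≠ 0 := pow_ne_zero _ (by exact_mod_cast hx0.ne')
  field_simp

theorem HasTaylor.shift {f : ℂ → ℂ} {c : ℕ → ℂ} {δ : ℝ} (hf : HasTaylor f c δ) {y : ℂ}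
    (hy : ‖y‖ < δ) : HasTaylor (fun w => f (w + y)) (shiftCoeff c y) (δ - ‖y‖) := fun w hw => by
  refine (hf.add_arg (x := w) (y := y) (by linarith)).prod_fiberwise fun n => ?_
  exact (hasSum_congr fun l => by ring).mp ((hf.hasSum_shiftCoeff hy n).mul_right (w ^ n))

/-! ### Scalar Laurent series -/

/-- `F z = ∑ f n z ^ n` for `0 < ‖z‖ < ρ`, with finitely many negative powers. -/
def HasLaurent (F : ℂ → ℂ) (f : ℤ → ℂ) (ρ : ℝ) : Prop :=
  (∃ N : ℤ, ∀ n < N, f n = 0) ∧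
    ∀ z : ℂ, 0 < ‖z‖ → ‖z‖ < ρ → HasSum (fun n : ℤ => f n * z ^ n) (F z)

theorem exists_nat_bound {V : Type*} [Zero V] {f : ℤ → V} (h : ∃ N : ℤ, ∀ n < N, f n = 0) :
    ∃ M : ℕ, ∀ n < -(M : ℤ), f n = 0 := by
  obtain ⟨N, hN⟩ := h
  exact ⟨N.natAbs, fun n hn => hN n (by omega)⟩

namespace HasLaurent

variable {F G : ℂ → ℂ} {f g : ℤ → ℂ} {ρ : ℝ}

/-- Splitting off the principal part. -/
theorem split (h : HasLaurent F f ρ) {M : ℕ} (hM : ∀ n < -(M : ℤ), f n = 0) :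
    ∃ P : ℂ → ℂ, HasTaylor P (fun n => f n) ρ ∧ ∀ z, 0 < ‖z‖ → ‖z‖ < ρ →
      F z = (∑ m ∈ Finset.range M, f (-(m : ℤ) - 1) * z ^ (-(m : ℤ) - 1)) + P z := by
  refine ⟨fun z => ∑' n : ℕ, f n * z ^ n, fun w hw => ?_, fun z hz0 hz => ?_⟩
  · refine Summable.hasSum ?_
    obtain rfl | hw0 := eq_or_ne w 0
    · refine summable_of_ne_finset_zero (s := {0}) fun n hn => ?_
      have : n ≠ 0 := by simpa using hn
      simp [this]
    · have := (h.2 w (by simpa using hw0) hw).summable.comp_injective Nat.cast_injective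
      refine this.congr fun n => ?_
      simp
  · have h1 := (h.2 z hz0 hz)
    have h2 : Summable fun n : ℕ => f n * z ^ (n : ℤ) :=
      h1.summable.comp_injective Nat.cast_injective
    have h3 : HasSum (fun m : ℕ => f (-((m : ℤ) + 1)) * z ^ (-((m : ℤ) + 1)))
        (∑ m ∈ Finset.range M, f (-(m : ℤ) - 1) * z ^ (-(m : ℤ) - 1)) := by
      simp only [neg_add']
      refine hasSum_sum_of_ne_finset_zero fun m hm => ?_
      rw [hM _ (by have := Finset.mem_range.not.mp hm; omega), zero_mul]
    have h4 := HasSum.of_nat_of_neg_add_one (f := fun n : ℤ => f n * z ^ n) h2.hasSum h3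
    rw [h1.unique h4, add_comm]
    simp

/-- Multiplication by a power of `z` turns a Laurent series into a power series. -/
theorem toTaylor (h : HasLaurent F f ρ) {M : ℕ} (hM : ∀ n < -(M : ℤ), f n = 0) :
    ∃ P : ℂ → ℂ, HasTaylor P (fun n => f (n - M)) ρ ∧ ∀ z, 0 < ‖z‖ → ‖z‖ < ρ →
      z ^ M * F z = P z := by
  have key : ∀ z, 0 < ‖z‖ → ‖z‖ < ρ →
      HasSum (fun n : ℕ => f (n - M) * z ^ n) (z ^ M * F z) := fun z hz0 hz => by
    have hz' : z ≠ 0 := norm_pos_iff.mp hz0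
    have h1 := (h.2 z hz0 hz).mul_left (z ^ M)
    have hinj : Function.Injective fun n : ℕ => (n : ℤ) - M := fun a b hab => by
      simpa using hab
    rw [← hinj.hasSum_iff] at h1
    · refine (hasSum_congr fun n => ?_).mp h1
      simp only [Function.comp]
      rw [zpow_sub₀ hz', zpow_natCast, zpow_natCast]
      field_simp
    · intro n hn
      rw [hM n, zero_mul, mul_zero]
      by_contra hlt
      exact hn ⟨(n + M).toNat, by show ((n + M).toNat : ℤ) - M = n; omega⟩
  refine ⟨fun z => ∑' n : ℕ, f (n - M) * z ^ n, fun w hw => ?_, fun z hz0 hz =>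
    (key z hz0 hz).tsum_eq.symm⟩
  refine Summable.hasSum ?_
  obtain rfl | hw0 := eq_or_ne w 0
  · refine summable_of_ne_finset_zero (s := {0}) fun n hn => ?_
    have : n ≠ 0 := by simpa using hn
    simp [this]
  · exact (key w (by simpa using hw0) hw).summable

theorem of_taylor {P : ℂ → ℂ} {M : ℕ} (hM : ∀ n < -(M : ℤ), f n = 0)
    (hP : HasTaylor P (fun n => f (n - M)) ρ)
    (h : ∀ z, 0 < ‖z‖ → ‖z‖ < ρ → z ^ M * F z = P z) : HasLaurent F f ρ := by
  refine ⟨⟨_, hM⟩, fun z hz0 hz => ?_⟩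
  have hz' : z ≠ 0 := norm_pos_iff.mp hz0
  have hinj : Function.Injective fun n : ℕ => (n : ℤ) - M := fun a b hab => by
    simpa using hab
  rw [← hinj.hasSum_iff]
  · have h1 := (hP z hz).mul_left ((z ^ M)⁻¹)
    rw [← h z hz0 hz, inv_mul_cancel_left₀ (pow_ne_zero _ hz')] at h1
    refine (hasSum_congr fun n => ?_).mp h1
    simp only [Function.comp]
    rw [zpow_sub₀ hz', zpow_natCast, zpow_natCast]
    field_simp
  · intro n hn
    rw [hM n, zero_mul]
    by_contra hlt
    exact hn ⟨(n + M).toNat, by show ((n + M).toNat : ℤ) - M = n; omega⟩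

theorem unique {ρ' : ℝ} (hF : HasLaurent F f ρ) (hρ : 0 < ρ) (hG : HasLaurent G g ρ')
    (hρ' : 0 < ρ') (h : ∀ᶠ w in 𝓝[≠] 0, F w = G w) : f = g := by
  obtain ⟨M₁, hM₁⟩ := exists_nat_bound hF.1
  obtain ⟨M₂, hM₂⟩ := exists_nat_bound hG.1
  have hM1 : ∀ n < -((max M₁ M₂ : ℕ) : ℤ), f n = 0 := fun n hn => hM₁ n (by omega)
  have hM2 : ∀ n < -((max M₁ M₂ : ℕ) : ℤ), g n = 0 := fun n hn => hM₂ n (by omega)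
  set M := max M₁ M₂
  obtain ⟨P, hP, hPF⟩ := hF.toTaylor hM1
  obtain ⟨Q, hQ, hQG⟩ := hG.toTaylor hM2
  have hball : ∀ᶠ w : ℂ in 𝓝[≠] 0, ‖w‖ < ρ ∧ ‖w‖ < ρ' ∧ 0 < ‖w‖ := by
    have h1 : ∀ᶠ w : ℂ in 𝓝 0, ‖w‖ < ρ := by
      filter_upwards [Metric.ball_mem_nhds (0 : ℂ) hρ] with w hw using by simpa using hw
    have h2 : ∀ᶠ w : ℂ in 𝓝 0, ‖w‖ < ρ' := by
      filter_upwards [Metric.ball_mem_nhds (0 : ℂ) hρ'] with w hw using by simpa using hw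
    filter_upwards [h1.filter_mono nhdsWithin_le_nhds, h2.filter_mono nhdsWithin_le_nhds,
      self_mem_nhdsWithin] with w h1 h2 h3
    exact ⟨h1, h2, norm_pos_iff.mpr h3⟩
  have hPQ := hP.unique_punctured hρ hQ hρ' (by
    filter_upwards [h, hball] with w hw ⟨h1, h2, h3⟩
    rw [← hPF w h3 h1, ← hQG w h3 h2, hw])
  ext n
  by_cases hn : n < -(M : ℤ)
  · rw [hM1 n hn, hM2 n hn]
  · have := congrFun hPQ (n + M).toNat
    rwa [show (((n + M).toNat : ℕ) : ℤ) - M = n by omega] at this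

/-- The power series part integrates to 0 by Cauchy, and so do all negative powers other than z⁻¹.
-/
theorem circleIntegral_eq (h : HasLaurent F f ρ) {s : ℝ} (hs : 0 < s) (hsρ : s < ρ) :
    (∮ z in C(0, s), F z) = 2 * Real.pi * Complex.I * f (-1) := by
  obtain ⟨M, hM⟩ := exists_nat_bound h.1
  -- With M + 1 instead of M the principal part has at least one summand, so that the z⁻¹ term can
  -- be split off even when M = 0.
  have hM' : ∀ n < -((M + 1 : ℕ) : ℤ), f n = 0 := fun n hn => hM n (by push_cast at hn; omega)
  obtain ⟨P, hP, hPF⟩ := h.split hM'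
  have hsphere : ∀ z ∈ Metric.sphere (0 : ℂ) s, ‖z‖ = s := fun z hz => by simpa using hz
  rw [circleIntegral.integral_congr hs.le (fun z hz => hPF z (by rw [hsphere z hz]; exact hs)
    (by rw [hsphere z hz]; exact hsρ))]
  have hne : ∀ z ∈ Metric.sphere (0 : ℂ) s, z ≠ 0 := fun z hz => by
    have := hsphere z hz
    rintro rfl
    simp at this; linarith
  have hi : ∀ m : ℕ, CircleIntegrable (fun z => f (-(m : ℤ) - 1) * z ^ (-(m : ℤ) - 1)) 0 s :=
    fun m => ContinuousOn.circleIntegrable hs.le fun z hz =>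
      (continuousAt_const.mul (continuousAt_zpow₀ z _ (Or.inl (hne z hz)))).continuousWithinAt
  have hPc : ContinuousOn P (Metric.closedBall 0 s) := hP.differentiableOn.continuousOn.mono
    (Metric.closedBall_subset_ball hsρ)
  rw [circleIntegral.integral_add (CircleIntegrable.fun_sum _ fun m _ => hi m)
    ((hPc.mono Metric.sphere_subset_closedBall).circleIntegrable hs.le),
    circleIntegral.integral_fun_sum fun m _ => hi m,
    Complex.circleIntegral_eq_zero_of_differentiable_on_off_countable hs.le
      Set.countable_empty hPc (fun z hz => (hP.analyticAt (by
        have : ‖z‖ < s := by simpa using hz.1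
        linarith)).differentiableAt), add_zero, Finset.sum_range_succ']
  have h0 : ∑ m ∈ Finset.range M, (∮ z in C(0, s), f (-((m + 1 : ℕ) : ℤ) - 1) *
      z ^ (-((m + 1 : ℕ) : ℤ) - 1)) = 0 := Finset.sum_eq_zero fun m _ => by
    have := circleIntegral.integral_sub_zpow_of_ne (n := -((m + 1 : ℕ) : ℤ) - 1)
      (by push_cast; omega) 0 0 s
    simp only [sub_zero] at this
    rw [circleIntegral.integral_const_mul, this, mul_zero]
  rw [h0, zero_add, circleIntegral.integral_const_mul]
  have := circleIntegral.integral_sub_center_inv (0 : ℂ) hs.ne'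
  simp only [sub_zero] at this
  simp only [Nat.cast_zero, neg_zero, zero_sub, zpow_neg_one, this]
  ring

end HasLaurent

/-- Clearing the poles reduces this to the Cauchy product of power series; the `finsum` is finite
because both factors vanish far to the left. -/
theorem HasLaurent.mul {F G : ℂ → ℂ} {f g : ℤ → ℂ} {ρ : ℝ} (hF : HasLaurent F f ρ)
    (hG : HasLaurent G g ρ) :
    HasLaurent (fun z => F z * G z) (fun n => ∑ᶠ k, f k * g (n - k)) ρ := by
  obtain ⟨M₁, hM₁⟩ := exists_nat_bound hF.1
  obtain ⟨M₂, hM₂⟩ := exists_nat_bound hG.1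
  obtain ⟨P, hP, hPF⟩ := hF.toTaylor hM₁
  obtain ⟨Q, hQ, hQG⟩ := hG.toTaylor hM₂
  have hsupp : ∀ (n : ℕ) (k : ℤ), f k * g ((n : ℤ) - (M₁ + M₂ : ℕ) - k) ≠ 0 →
      -(M₁ : ℤ) ≤ k ∧ k ≤ n - M₁ := fun n k hk => by
    refine ⟨not_lt.mp fun h => hk (by rw [hM₁ k h, zero_mul]), not_lt.mp fun h => hk ?_⟩
    rw [hM₂ _ (by push_cast; omega), mul_zero]
  refine HasLaurent.of_taylor (P := fun z => P z * Q z) (M := M₁ + M₂) (fun n hn => ?_) ?_ ?_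
  · refine finsum_eq_zero_of_forall_eq_zero fun k => ?_
    by_cases hk : k < -(M₁ : ℤ)
    · rw [hM₁ k hk, zero_mul]
    · rw [hM₂ (n - k) (by push_cast at hn; omega), mul_zero]
  · have hPQ := hP.mul hQ
    intro w hw
    refine (hasSum_congr fun n => ?_).mp (hPQ w hw)
    simp only
    congr 1
    rw [finsum_eq_sum_of_support_subset (s := (Finset.range (n + 1)).image
      (fun i : ℕ => (i : ℤ) - M₁))]
    · rw [Finset.sum_image (fun a _ b _ hab => by simpa using hab),
        Finset.Nat.sum_antidiagonal_eq_sum_range_succ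
          (fun i j : ℕ => f (i - M₁) * g (j - M₂)) n]
      refine Finset.sum_congr rfl fun i hi => ?_
      have : i ≤ n := Nat.lt_succ_iff.mp (Finset.mem_range.mp hi)
      congr 2
      push_cast [Nat.cast_sub this]
      ring
    · intro k hk
      have := hsupp n k hk
      simp only [Finset.coe_image, Set.mem_image, Finset.mem_coe, Finset.mem_range]
      exact ⟨(k + M₁).toNat, by omega, by omega⟩
  · intro z h0 hz
    rw [← hPF z h0 hz, ← hQG z h0 hz, pow_add]
    ring

/-! ### Power series in two variables -/

/-- `T x y = ∑ c m n x ^ m y ^ n` as an iterated sum, for `‖x‖, ‖y‖ < δ`. -/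
def HasTaylor₂ (T : ℂ → ℂ → ℂ) (c : ℕ → ℕ → ℂ) (δ : ℝ) : Prop :=
  ∃ C : ℕ → ℂ → ℂ, (∀ x, ‖x‖ < δ → HasTaylor (T x) (fun n => C n x) δ) ∧
    ∀ n, HasTaylor (C n) (fun m => c m n) δ

namespace HasTaylor₂

variable {T S : ℂ → ℂ → ℂ} {c d : ℕ → ℕ → ℂ} {f : ℂ → ℂ} {a : ℕ → ℂ} {δ δ' : ℝ}

theorem add (hT : HasTaylor₂ T c δ) (hS : HasTaylor₂ S d δ) :
    HasTaylor₂ (fun x y => T x y + S x y) (fun m n => c m n + d m n) δ := by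
  obtain ⟨C, h1, h2⟩ := hT
  obtain ⟨D, h3, h4⟩ := hS
  exact ⟨fun n x => C n x + D n x, fun x hx => (h1 x hx).add (h3 x hx), fun n => (h2 n).add (h4 n)⟩

theorem const_mul (k : ℂ) (hT : HasTaylor₂ T c δ) :
    HasTaylor₂ (fun x y => k * T x y) (fun m n => k * c m n) δ := by
  obtain ⟨C, h1, h2⟩ := hT
  exact ⟨fun n x => k * C n x, fun x hx => (h1 x hx).const_mul k, fun n => (h2 n).const_mul k⟩

theorem sum {ι : Type*} {s : Finset ι} {T : ι → ℂ → ℂ → ℂ} {c : ι → ℕ → ℕ → ℂ}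
    (h : ∀ i ∈ s, HasTaylor₂ (T i) (c i) δ) :
    HasTaylor₂ (fun x y => ∑ i ∈ s, T i x y) (fun m n => ∑ i ∈ s, c i m n) δ := by
  choose! C h1 h2 using h
  exact ⟨fun n x => ∑ i ∈ s, C i n x, fun x hx => HasTaylor.sum fun i hi => h1 i hi x hx,
    fun n => HasTaylor.sum fun i hi => h2 i hi n⟩

theorem congr (hT : HasTaylor₂ T c δ) (h : ∀ x y, ‖x‖ < δ → ‖y‖ < δ → T x y = S x y) :
    HasTaylor₂ S c δ := by
  obtain ⟨C, h1, h2⟩ := hT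
  exact ⟨C, fun x hx => (h1 x hx).congr (h x · hx), h2⟩

theorem fst (hf : HasTaylor f a δ) :
    HasTaylor₂ (fun x _ => f x) (fun m n => if n = 0 then a m else 0) δ := by
  refine ⟨fun n x => if n = 0 then f x else 0, fun x _ y _ => ?_, fun n => ?_⟩
  · convert hasSum_single (f := fun n : ℕ => (if n = 0 then f x else 0) * y ^ n) 0 ?_ using 1
    · simp
    · intro n hn; simp [hn]
  · by_cases hn : n = 0
    · simpa [hn] using hf
    · simpa [hn] using HasTaylor.zero

theorem snd (hf : HasTaylor f a δ) :
    HasTaylor₂ (fun _ y => f y) (fun m n => if m = 0 then a n else 0) δ := by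
  refine ⟨fun n _ => a n, fun x _ => hf, fun n y _ => ?_⟩
  convert hasSum_single (f := fun m : ℕ => (if m = 0 then a n else 0) * y ^ m) 0 ?_ using 1
  · simp
  · intro m hm; simp [hm]

theorem fst_mul (hT : HasTaylor₂ T c δ) (hf : HasTaylor f a δ) :
    HasTaylor₂ (fun x y => f x * T x y)
      (fun m n => ∑ p ∈ Finset.HasAntidiagonal.antidiagonal m, a p.1 * c p.2 n) δ := by
  obtain ⟨C, h1, h2⟩ := hT
  refine ⟨fun n x => f x * C n x, fun x hx => (h1 x hx).const_mul (f x), fun n => ?_⟩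
  have := hf.mul (h2 n)
  exact this

theorem snd_mul (hT : HasTaylor₂ T c δ) (hf : HasTaylor f a δ) :
    HasTaylor₂ (fun x y => f y * T x y)
      (fun m n => ∑ p ∈ Finset.HasAntidiagonal.antidiagonal n, a p.1 * c m p.2) δ := by
  obtain ⟨C, h1, h2⟩ := hT
  refine ⟨fun n x => ∑ p ∈ Finset.HasAntidiagonal.antidiagonal n, a p.1 * C p.2 x,
    fun x hx => ?_, fun n => HasTaylor.sum fun p _ => (h2 p.2).const_mul (a p.1)⟩
  have := hf.mul (h1 x hx)
  exact this

theorem fst_mul_snd {g : ℂ → ℂ} {b : ℕ → ℂ} (hf : HasTaylor f a δ) (hg : HasTaylor g b δ) :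
    HasTaylor₂ (fun x y => f x * g y) (fun m n => a m * b n) δ :=
  ⟨fun n x => f x * b n, fun x _ => hg.const_mul (f x), fun n => by
    simpa only [mul_comm] using hf.const_mul (b n)⟩

theorem mul_x (hT : HasTaylor₂ T c δ) :
    HasTaylor₂ (fun x y => x * T x y) (fun m n => if m = 0 then 0 else c (m - 1) n) δ := by
  obtain ⟨C, h1, h2⟩ := hT
  exact ⟨fun n x => x * C n x, fun x hx => (h1 x hx).const_mul x, fun n => (h2 n).mul_self⟩

theorem mul_y (hT : HasTaylor₂ T c δ) :
    HasTaylor₂ (fun x y => y * T x y) (fun m n => if n = 0 then 0 else c m (n - 1)) δ := by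
  obtain ⟨C, h1, h2⟩ := hT
  refine ⟨fun n x => if n = 0 then 0 else C (n - 1) x, fun x hx => (h1 x hx).mul_self,
    fun n => ?_⟩
  by_cases hn : n = 0
  · simpa [hn] using HasTaylor.zero
  · simpa [hn] using h2 (n - 1)

/-- The binomial expansion of f(-y + x) converges absolutely as ‖x‖ + ‖y‖ < 2δ ≤ δ', so it may be
summed over powers of x first; the inner sum is a shifted Taylor coefficient. -/
theorem sub_arg (hf : HasTaylor f a δ') (hδ : 2 * δ ≤ δ') :
    HasTaylor₂ (fun x y => f (x - y))
      (fun m n => a (m + n) * ((m + n).choose n : ℂ) * (-1) ^ n) δ := by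
  have key : ∀ x, ‖x‖ < δ → ∀ y, ‖y‖ < δ → HasSum (fun p : ℕ × ℕ => a (p.1 + p.2) *
      ((p.1 + p.2).choose p.1 : ℂ) * (-y) ^ p.1 * x ^ p.2) (f (x - y)) := fun x hx y hy => by
    rw [sub_eq_neg_add]
    exact hf.add_arg (by rw [norm_neg]; linarith)
  have h1 : ∀ n, ∀ x, ‖x‖ < δ → HasSum (fun m => a (m + n) * ((m + n).choose n : ℂ) * x ^ m)
      (shiftCoeff a x n) := fun n x hx => by
    refine (hasSum_congr fun m => ?_).mp
      (hf.hasSum_shiftCoeff (y := x) (by have := norm_nonneg x; linarith) n)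
    rw [add_comm]
  refine ⟨fun n x => (-1) ^ n * shiftCoeff a x n, fun x hx y hy => ?_, fun n x hx => ?_⟩
  · refine (key x hx y hy).prod_fiberwise fun n => ?_
    rw [mul_right_comm]
    refine (hasSum_congr fun l => ?_).mp ((h1 n x hx).mul_left ((-1) ^ n * y ^ n))
    rw [add_comm l n, ← mul_pow, neg_one_mul]; ring
  · refine (hasSum_congr fun m => ?_).mp ((h1 n x hx).mul_left ((-1) ^ n))
    ring

/-- One-variable uniqueness applied twice, in y for fixed x and then in x. Iterated sums are all
that is needed, without joint convergence. -/
theorem eq_zero (hT : HasTaylor₂ T c δ) (hδ : 0 < δ)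
    (h : ∀ x y, ‖x‖ < δ → ‖y‖ < δ → T x y = 0) (m n : ℕ) : c m n = 0 := by
  obtain ⟨C, h1, h2⟩ := hT
  have hball : ∀ᶠ x : ℂ in 𝓝 0, ‖x‖ < δ := by
    filter_upwards [Metric.ball_mem_nhds (0 : ℂ) hδ] with w hw using by simpa using hw
  have hC : ∀ x, ‖x‖ < δ → ∀ n, C n x = 0 := fun x hx n => by
    have := (h1 x hx).unique hδ (HasTaylor.zero (δ := δ)) hδ (hball.mono fun y hy => h x y hx hy)
    exact congrFun this n
  have := (h2 n).unique hδ (HasTaylor.zero (δ := δ)) hδ (hball.mono fun x hx => hC x hx n)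
  exact congrFun this m

/-- If `(x - y) T(x, y) + F(x) - F(y) = 0`, the coefficients of `T` are those of the divided
difference of `-F`. -/
theorem coeff_of_divided_difference (hT : HasTaylor₂ T c δ) (hδ : 0 < δ) (hf : HasTaylor f a δ)
    (h : ∀ x y, ‖x‖ < δ → ‖y‖ < δ → (x - y) * T x y + (f x - f y) = 0) (m n : ℕ) :
    c m n + a (m + n + 1) = 0 := by
  have h0 := fun m n => ((((hT.mul_x).add ((hT.mul_y).const_mul (-1))).add
    ((fst hf).add ((snd hf).const_mul (-1)))).congr
      (S := fun x y => (x - y) * T x y + (f x - f y)) (fun x y _ _ => by ring)).eq_zero hδ h m n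
  -- The coefficient of x^m y^(n+1) in the identity is used: for m = 0 it gives c 0 n, and for m + 1
  -- it says c (m+1) n = c m (n+1), since f(x) - f(y) has no mixed terms.
  induction m generalizing n with
  | zero =>
    have := h0 0 (n + 1)
    simp at this
    rw [zero_add]
    linear_combination -this
  | succ m ih =>
    have := h0 (m + 1) (n + 1)
    simp at this
    have h2 := ih (n + 1)
    rw [show m + 1 + n + 1 = m + (n + 1) + 1 by ring]
    linear_combination h2 - this

end HasTaylor₂

/-! ### Circle integrals depending on a parameter -/

/-- Compactness of the circle yields one neighbourhood of q on which F is analytic along the whole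
circle and its derivative is uniformly bounded; differentiation under the integral sign then
applies. -/
theorem hasFDerivAt_circleIntegral {E : Type*} [NormedAddCommGroup E] [NormedSpace ℂ E]
    {F : E × ℂ → ℂ} {g : ℂ → ℂ} {q : E} {c : ℂ} {s : ℝ} (hs : 0 ≤ s)
    (hF : ∀ w ∈ Metric.sphere c s, AnalyticAt ℂ F (q, w))
    (hg : ContinuousOn g (Metric.sphere c s)) :
    ∃ L : E →L[ℂ] ℂ, HasFDerivAt (fun p => ∮ w in C(c, s), F (p, w) * g w) L q ∧
      ∀ a, L a = ∮ w in C(c, s), fderiv ℂ F (q, w) (a, 0) * g w := by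
  have hK := isCompact_sphere c s
  have hcont : ContinuousOn (fun w => fderiv ℂ F (q, w)) (Metric.sphere c s) := fun w hw =>
    ((hF w hw).fderiv.continuousAt.comp (f := fun w : ℂ => (q, w))
      (by fun_prop)).continuousWithinAt
  obtain ⟨C, hC⟩ := hK.exists_bound_of_continuousOn hcont
  obtain ⟨D, hD⟩ := hK.exists_bound_of_continuousOn hg
  have hev : ∀ᶠ p in 𝓝 q, ∀ w ∈ Metric.sphere c s,
      AnalyticAt ℂ F (p, w) ∧ ‖fderiv ℂ F (p, w)‖ < C + 1 := by
    refine hK.eventually_forall_of_forall_eventually fun w hw => ?_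
    have h1 := (hF w hw).eventually_analyticAt
    have h2 := (hF w hw).fderiv.continuousAt.norm.eventually_lt (continuousAt_const (y := C + 1))
      (by linarith [hC w hw])
    exact h1.and h2
  obtain ⟨ε, hε, hball⟩ := Metric.eventually_nhds_iff_ball.mp hev
  have hmem : ∀ θ : ℝ, circleMap c s θ ∈ Metric.sphere c s := circleMap_mem_sphere c hs
  have hcF : ∀ p ∈ Metric.ball q ε, Continuous fun θ : ℝ => F (p, circleMap c s θ) := fun p hp =>
    continuous_iff_continuousAt.mpr fun θ =>
      ((hball p hp _ (hmem θ)).1.continuousAt.comp (f := fun θ : ℝ => (p, circleMap c s θ))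
        (by fun_prop))
  have hcg : Continuous fun θ : ℝ => g (circleMap c s θ) :=
    hg.comp_continuous (continuous_circleMap c s) hmem
  have hcF' : Continuous fun θ : ℝ => fderiv ℂ F (q, circleMap c s θ) :=
    hcont.comp_continuous (continuous_circleMap c s) hmem
  have hcd : Continuous fun θ : ℝ => circleMap 0 s θ * Complex.I := by fun_prop
  obtain ⟨F', hF'⟩ : ∃ F' : E → ℝ → E →L[ℂ] ℂ, ∀ p θ, F' p θ =
      (circleMap 0 s θ * Complex.I * g (circleMap c s θ)) •
      (fderiv ℂ F (p, circleMap c s θ)).comp (ContinuousLinearMap.inl ℂ E ℂ) := ⟨_, fun _ _ => rfl⟩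
  have hF'c : Continuous (F' q) := by
    rw [funext (hF' q)]
    exact (hcd.mul hcg).smul (hcF'.clm_comp continuous_const)
  have hbound : ∀ θ : ℝ, ∀ p ∈ Metric.ball q ε, ‖F' p θ‖ ≤ s * D * (C + 1) := fun θ p hp => by
    have h1 := (hball p hp _ (hmem θ)).2.le
    have h2 : ‖(fderiv ℂ F (p, circleMap c s θ)).comp (ContinuousLinearMap.inl ℂ E ℂ)‖
        ≤ (C + 1) * 1 := by
      refine (ContinuousLinearMap.opNorm_comp_le _ _).trans ?_
      have := ContinuousLinearMap.norm_inl_le_one ℂ E ℂ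
      gcongr
      exact (norm_nonneg _).trans h1
    have h3 : ‖circleMap 0 s θ * Complex.I * g (circleMap c s θ)‖ ≤ s * D := by
      rw [norm_mul, norm_mul, Complex.norm_I, mul_one, norm_circleMap_zero, abs_of_nonneg hs]
      have := hD _ (hmem θ)
      gcongr
    rw [hF', norm_smul]
    rw [mul_one] at h2
    have := (norm_nonneg _).trans h3
    gcongr
  have hderiv : ∀ θ : ℝ, ∀ p ∈ Metric.ball q ε, HasFDerivAt
      (fun p => circleMap 0 s θ * Complex.I * (F (p, circleMap c s θ) * g (circleMap c s θ)))
      (F' p θ) p := fun θ p hp => by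
    have h1 := (hball p hp _ (hmem θ)).1.differentiableAt.hasFDerivAt
    have h2 : HasFDerivAt (fun p => F (p, circleMap c s θ))
        ((fderiv ℂ F (p, circleMap c s θ)).comp (ContinuousLinearMap.inl ℂ E ℂ)) p :=
      h1.comp p (hasFDerivAt_prodMk_left p (circleMap c s θ))
    rw [hF']
    refine (h2.const_mul (circleMap 0 s θ * Complex.I * g (circleMap c s θ))).congr_of_eventuallyEq
      (Filter.Eventually.of_forall fun p => ?_)
    simp only
    ring
  have hcΦ : ∀ p ∈ Metric.ball q ε, Continuous fun θ : ℝ =>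
      circleMap 0 s θ * Complex.I * (F (p, circleMap c s θ) * g (circleMap c s θ)) :=
    fun p hp => hcd.mul ((hcF p hp).mul hcg)
  obtain ⟨Φ, hΦ⟩ : ∃ Φ : E → ℝ → ℂ, ∀ p θ, Φ p θ =
      circleMap 0 s θ * Complex.I * (F (p, circleMap c s θ) * g (circleMap c s θ)) :=
    ⟨_, fun _ _ => rfl⟩
  simp only [← hΦ] at hcΦ hderiv
  have key : HasFDerivAt (fun p => ∫ θ in (0)..2 * Real.pi, Φ p θ)
      (∫ θ in (0)..2 * Real.pi, F' q θ) q := by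
    refine intervalIntegral.hasFDerivAt_integral_of_dominated_of_fderiv_le (𝕜 := ℂ)
      (bound := fun _ => s * D * (C + 1)) (Metric.ball_mem_nhds q hε) ?_ ?_ ?_ ?_ ?_ ?_
    · filter_upwards [Metric.ball_mem_nhds q hε] with p hp
      exact (hcΦ p hp).aestronglyMeasurable
    · exact (hcΦ q (Metric.mem_ball_self hε)).intervalIntegrable _ _
    · exact hF'c.aestronglyMeasurable
    · exact Filter.Eventually.of_forall fun θ _ p hp => hbound θ p hp
    · exact intervalIntegrable_const
    · exact Filter.Eventually.of_forall fun θ _ p hp => hderiv θ p hp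
  refine ⟨∫ θ in (0)..2 * Real.pi, F' q θ, ?_, fun a => ?_⟩
  · have : (fun p => ∮ w in C(c, s), F (p, w) * g w) =
        fun p => ∫ θ in (0)..2 * Real.pi, Φ p θ := by
      ext p
      simp only [circleIntegral, deriv_circleMap, smul_eq_mul, hΦ]
    rw [this]
    exact key
  · rw [ContinuousLinearMap.intervalIntegral_apply (hF'c.intervalIntegrable _ _)]
    simp only [circleIntegral, deriv_circleMap, smul_eq_mul]
    refine intervalIntegral.integral_congr fun θ _ => ?_
    simp [hF', smul_eq_mul]
    ring

/-! ### Principal values on circles -/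

/-- Scalar version of `IsCirclePV`, for a circle of radius `s`. -/
def IsScalarPV (Φ : ℂ → ℂ) (z : ℂ) (X : ℂ) : Prop :=
  (∀ ε > 0, CircleIntegrable (Set.indicator {w | ε < ‖w - z‖} Φ) 0 ‖z‖) ∧
    Filter.Tendsto (fun ε : ℝ => (2 * Real.pi * Complex.I)⁻¹ *
        ∮ w in C(0, ‖z‖), Set.indicator {w | ε < ‖w - z‖} Φ w)
      (𝓝[>] 0) (𝓝 X)

/-- The cut-off removes a neighbourhood of the only singular point, leaving a function continuous on
a compact set of angles. -/
theorem circleIntegrable_indicator {Φ : ℂ → ℂ} {z : ℂ}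
    (hΦ : ContinuousOn Φ (Metric.sphere 0 ‖z‖ \ {z})) {ε : ℝ} (hε : 0 < ε) :
    CircleIntegrable (Set.indicator {w | ε < ‖w - z‖} Φ) 0 ‖z‖ := by
  have hc := continuous_circleMap 0 ‖z‖
  -- The weak inequality makes K compact; it contains every angle kept by the strict cut-off.
  set K : Set ℝ := Set.Icc 0 (2 * Real.pi) ∩ {θ | ε ≤ ‖circleMap 0 ‖z‖ θ - z‖} with hK
  have hKc : IsCompact K := isCompact_Icc.inter_right
    (isClosed_le continuous_const (by fun_prop))
  have hcont : ContinuousOn (fun θ => Φ (circleMap 0 ‖z‖ θ)) K := by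
    refine hΦ.comp hc.continuousOn fun θ hθ => ⟨circleMap_mem_sphere 0 (norm_nonneg z) θ, ?_⟩
    intro h
    have : circleMap 0 ‖z‖ θ = z := h
    have h2 := hθ.2
    simp only [Set.mem_ofPred_eq, this, sub_self, norm_zero] at h2
    linarith
  have hint := hcont.integrableOn_compact (μ := MeasureTheory.volume) hKc
  unfold CircleIntegrable
  rw [intervalIntegrable_iff_integrableOn_Ioc_of_le Real.two_pi_pos.le]
  have hset : MeasurableSet {θ : ℝ | ε < ‖circleMap 0 ‖z‖ θ - z‖} :=
    (isOpen_lt continuous_const (by fun_prop)).measurableSet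
  have heq : (fun θ => Set.indicator {w | ε < ‖w - z‖} Φ (circleMap 0 ‖z‖ θ)) =
      Set.indicator {θ : ℝ | ε < ‖circleMap 0 ‖z‖ θ - z‖} (fun θ => Φ (circleMap 0 ‖z‖ θ)) := by
    ext θ
    simp [Set.indicator]
  rw [heq, MeasureTheory.integrableOn_indicator_iff hset]
  exact hint.mono_set fun θ hθ => ⟨Set.Ioc_subset_Icc_self hθ.2, le_of_lt (show ε < _ from hθ.1)⟩

namespace IsScalarPV

variable {Φ Ψ : ℂ → ℂ} {z X Y : ℂ}

theorem add (h : IsScalarPV Φ z X) (h' : IsScalarPV Ψ z Y) :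
    IsScalarPV (fun w => Φ w + Ψ w) z (X + Y) := by
  have hind : ∀ ε : ℝ, Set.indicator {w | ε < ‖w - z‖} (fun w => Φ w + Ψ w) =
      fun w => Set.indicator {w | ε < ‖w - z‖} Φ w + Set.indicator {w | ε < ‖w - z‖} Ψ w :=
    fun ε => Set.indicator_add _ _ _
  refine ⟨fun ε hε => by rw [hind]; exact (h.1 ε hε).add (h'.1 ε hε), ?_⟩
  refine (h.2.add h'.2).congr' ?_
  filter_upwards [self_mem_nhdsWithin] with ε hε
  rw [hind, circleIntegral.integral_add (h.1 ε hε) (h'.1 ε hε), mul_add]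

theorem const_mul (k : ℂ) (h : IsScalarPV Φ z X) : IsScalarPV (fun w => k * Φ w) z (k * X) := by
  have hind : ∀ ε : ℝ, Set.indicator {w | ε < ‖w - z‖} (fun w => k * Φ w) =
      fun w => k * Set.indicator {w | ε < ‖w - z‖} Φ w := fun ε => by
    ext w
    by_cases hw : ε < ‖w - z‖ <;> simp [Set.indicator, hw]
  refine ⟨fun ε hε => by rw [hind]; exact (h.1 ε hε).const_smul (a := k), ?_⟩
  refine (h.2.const_mul k).congr fun ε => ?_
  rw [hind, circleIntegral.integral_const_mul]
  ring

theorem congr (h : IsScalarPV Φ z X) (heq : ∀ w, ‖w‖ = ‖z‖ → w ≠ z → Φ w = Ψ w) :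
    IsScalarPV Ψ z X := by
  have hE : ∀ ε > 0, Set.EqOn (Set.indicator {w | ε < ‖w - z‖} Φ)
      (Set.indicator {w | ε < ‖w - z‖} Ψ) (Metric.sphere 0 |‖z‖|) := fun ε hε w hw => by
    by_cases hw' : ε < ‖w - z‖
    · simp only [Set.indicator, Set.mem_ofPred_eq, hw', ↓reduceIte]
      refine heq w (by simpa using hw) ?_
      rintro rfl
      simp at hw'
      linarith
    · simp [Set.indicator, hw']
  refine ⟨fun ε hε => (circleIntegrable_congr (hE ε hε)).mp (h.1 ε hε), h.2.congr' ?_⟩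
  filter_upwards [self_mem_nhdsWithin] with ε hε
  rw [circleIntegral.integral_congr (norm_nonneg z) (by simpa using hE ε hε)]

/-- For an integrand without singularity the principal value is the ordinary integral, by dominated
convergence: the cut-offs converge except at the angles of z, a countable set. -/
theorem of_continuousOn (hz : z ≠ 0) (hΦ : ContinuousOn Φ (Metric.sphere 0 ‖z‖)) :
    IsScalarPV Φ z ((2 * Real.pi * Complex.I)⁻¹ * ∮ w in C(0, ‖z‖), Φ w) := by
  refine ⟨fun ε hε => circleIntegrable_indicator (hΦ.mono Set.sdiff_subset) hε, ?_⟩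
  refine Filter.Tendsto.const_mul _ ?_
  obtain ⟨C, hC⟩ := (isCompact_sphere (0 : ℂ) ‖z‖).exists_bound_of_continuousOn hΦ
  have hmem := circleMap_mem_sphere (0 : ℂ) (norm_nonneg z)
  have hcomp : Continuous fun θ : ℝ => Φ (circleMap 0 ‖z‖ θ) :=
    hΦ.comp_continuous (continuous_circleMap 0 ‖z‖) hmem
  have hset : ∀ ε : ℝ, MeasurableSet {θ : ℝ | ε < ‖circleMap 0 ‖z‖ θ - z‖} := fun ε =>
    (isOpen_lt continuous_const (by fun_prop)).measurableSet
  have heq : ∀ ε : ℝ, (fun θ => Set.indicator {w | ε < ‖w - z‖} Φ (circleMap 0 ‖z‖ θ)) =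
      Set.indicator {θ : ℝ | ε < ‖circleMap 0 ‖z‖ θ - z‖} (fun θ => Φ (circleMap 0 ‖z‖ θ)) := by
    intro ε
    ext θ
    simp [Set.indicator]
  unfold circleIntegral
  simp only [deriv_circleMap, smul_eq_mul]
  refine intervalIntegral.tendsto_integral_filter_of_dominated_convergence
    (fun _ => ‖z‖ * C) ?_ ?_ intervalIntegrable_const ?_
  · refine Filter.Eventually.of_forall fun ε => ?_
    have h1 : MeasureTheory.AEStronglyMeasurable
        (fun θ => Set.indicator {w | ε < ‖w - z‖} Φ (circleMap 0 ‖z‖ θ))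
        (MeasureTheory.volume.restrict (Set.uIoc 0 (2 * Real.pi))) := by
      rw [heq ε]
      exact hcomp.aestronglyMeasurable.indicator (hset ε)
    exact (Continuous.aestronglyMeasurable (by fun_prop)).mul h1
  · refine Filter.Eventually.of_forall fun ε => Filter.Eventually.of_forall fun θ _ => ?_
    rw [norm_mul, norm_mul, Complex.norm_I, mul_one, norm_circleMap_zero, abs_norm]
    refine mul_le_mul_of_nonneg_left ?_ (norm_nonneg z)
    exact (norm_indicator_le_norm_self _ _).trans (hC _ (hmem θ))
  · have hcount : Set.Countable (circleMap 0 ‖z‖ ⁻¹' {z}) :=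
      Set.Countable.preimage_circleMap (Set.countable_singleton z) 0 (norm_ne_zero_iff.mpr hz)
    have hae : ∀ᵐ θ : ℝ, θ ∉ circleMap 0 ‖z‖ ⁻¹' {z} :=
      hcount.ae_notMem MeasureTheory.volume
    filter_upwards [hae] with θ hθ _
    have hpos : 0 < ‖circleMap 0 ‖z‖ θ - z‖ := norm_pos_iff.mpr (sub_ne_zero.mpr hθ)
    refine tendsto_const_nhds.congr' ?_
    filter_upwards [nhdsWithin_le_nhds (Iio_mem_nhds hpos)] with ε hε
    have hε' : ε < ‖circleMap 0 ‖z‖ θ - z‖ := hε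
    simp only [Set.indicator, Set.mem_ofPred_eq, hε', ↓reduceIte]

/-- The principal value of the Cauchy kernel is half of its residue. -/
theorem cauchy_kernel (hz : z ≠ 0) : IsScalarPV (fun w => (w - z)⁻¹) z (1 / 2) := by
  have hz' : ‖z‖ ≠ 0 := norm_ne_zero_iff.mpr hz
  have hinv : ContinuousOn (fun w : ℂ => w⁻¹) (Metric.sphere 0 ‖z‖) :=
    continuousOn_inv₀.mono fun w hw h => by
      have h1 : ‖w‖ = ‖z‖ := by simpa using hw
      have h2 : w = 0 := h
      rw [h2, norm_zero] at h1
      exact hz' h1.symm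
  have hcont : ContinuousOn (fun w : ℂ => (w - z)⁻¹) (Metric.sphere 0 ‖z‖ \ {z}) :=
    ContinuousOn.inv₀ (by fun_prop) fun w hw => sub_ne_zero.mpr hw.2
  refine ⟨fun ε hε => circleIntegrable_indicator hcont hε, ?_⟩
  -- The comparison function 1/(2w) has normalized integral 1/2; the task is to show that its
  -- truncations have the same integral as those of 1/(w - z).
  have hlim := (of_continuousOn hz hinv).const_mul (1 / 2)
  have hres := circleIntegral.integral_sub_center_inv (0 : ℂ) hz'
  simp only [sub_zero] at hres
  have h2pi : (2 * Real.pi * Complex.I : ℂ) ≠ 0 := Complex.two_pi_I_ne_zero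
  rw [hres, inv_mul_cancel₀ h2pi, mul_one] at hlim
  refine hlim.2.congr' ?_
  filter_upwards [self_mem_nhdsWithin] with ε hε
  have hε : 0 < ε := hε
  congr 1
  -- the difference of the integrands is odd under the reflection `θ ↦ 2 arg z - θ`
  have hind1 : CircleIntegrable (Set.indicator {w | ε < ‖w - z‖} (fun w => (w - z)⁻¹)) 0 ‖z‖ :=
    circleIntegrable_indicator hcont hε
  rw [← sub_eq_zero, ← circleIntegral.integral_sub (hlim.1 ε hε) hind1]
  set ψ : ℝ := Complex.arg z with hψ
  set K : ℝ → ℂ := fun θ => deriv (circleMap 0 ‖z‖) θ •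
    (Set.indicator {w | ε < ‖w - z‖} (fun w => 1 / 2 * w⁻¹) (circleMap 0 ‖z‖ θ) -
      Set.indicator {w | ε < ‖w - z‖} (fun w => (w - z)⁻¹) (circleMap 0 ‖z‖ θ)) with hKdef
  have hper : Function.Periodic K (2 * Real.pi) := fun θ => by
    simp only [hKdef, deriv_circleMap, periodic_circleMap 0 ‖z‖ θ]
  -- The reflection is w ↦ z²/w, which preserves ‖w - z‖ and therefore the cut-off. It changes the
  -- sign of w(1/(2w) - 1/(w - z)) = -(w + z)/(2(w - z)).
  have hodd : ∀ θ, K (2 * ψ - θ) = -K θ := fun θ => by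
    set w := circleMap 0 ‖z‖ θ with hw
    have hw0 : w ≠ 0 := by
      rw [← norm_ne_zero_iff, hw, norm_circleMap_zero, abs_norm]; exact hz'
    have hwz : ‖w‖ = ‖z‖ := by rw [hw, norm_circleMap_zero, abs_norm]
    have hz2 : (‖z‖ : ℂ) * Complex.exp (ψ * Complex.I) = z := Complex.norm_mul_exp_arg_mul_I z
    have hw' : circleMap 0 ‖z‖ (2 * ψ - θ) = z ^ 2 / w := by
      rw [eq_div_iff hw0, hw]
      nth_rewrite 3 [← hz2]
      simp only [circleMap, zero_add, mul_pow]
      rw [mul_mul_mul_comm, ← Complex.exp_add, ← Complex.exp_nat_mul, ← sq]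
      congr 2
      push_cast
      ring
    have hnorm : ‖z ^ 2 / w - z‖ = ‖w - z‖ := by
      have : z ^ 2 / w - z = -(z / w) * (w - z) := by field_simp; ring
      rw [this, norm_mul, norm_neg, norm_div, hwz, div_self hz', one_mul]
    simp only [hKdef, deriv_circleMap, hw', ← hw, smul_eq_mul]
    by_cases hc : ε < ‖w - z‖
    · have hne : w - z ≠ 0 := by
        intro h; rw [h, norm_zero] at hc; linarith
      have hne' : z ^ 2 / w - z ≠ 0 := by
        rw [← norm_ne_zero_iff, hnorm]; exact norm_ne_zero_iff.mpr hne
      simp only [Set.indicator, Set.mem_ofPred_eq, hnorm, hc, ↓reduceIte]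
      have h4 : z ^ 2 / w - z = -z * (w - z) / w := by field_simp; ring
      rw [h4]
      field_simp
      ring
    · simp [Set.indicator, hnorm, hc]
  show ∫ θ in (0)..2 * Real.pi, K θ = 0
  have h1 : ∫ θ in (0)..2 * Real.pi, K (2 * ψ - θ) = ∫ θ in (0)..2 * Real.pi, K θ := by
    rw [intervalIntegral.integral_comp_sub_left, sub_zero]
    have := hper.intervalIntegral_add_eq (2 * ψ - 2 * Real.pi) 0
    rw [sub_add_cancel, zero_add] at this
    exact this
  simp only [hodd] at h1
  rw [intervalIntegral.integral_neg] at h1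
  exact self_eq_neg.mp h1.symm

/-- Plemelj: the principal value of `G(w) / (w - z)` for a Laurent series `G`. -/
theorem of_laurent {G : ℂ → ℂ} {g : ℤ → ℂ} {ρ : ℝ} (hG : HasLaurent G g ρ) {M : ℕ}
    (hM : ∀ n < -(M : ℤ), g n = 0) (hz : 0 < ‖z‖) (hzρ : ‖z‖ < ρ) :
    IsScalarPV (fun w => (w - z)⁻¹ * G w) z
      (1 / 2 * G z - ∑ m ∈ Finset.range M, g (-(m : ℤ) - 1) * z ^ (-(m : ℤ) - 1)) := by
  obtain ⟨P, hP, hGP⟩ := hG.split hM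
  have hz' : z ≠ 0 := norm_pos_iff.mp hz
  have h2pi : (2 * Real.pi * Complex.I : ℂ) ≠ 0 := Complex.two_pi_I_ne_zero
  have hsph : ∀ w ∈ Metric.sphere (0 : ℂ) ‖z‖, ‖w‖ = ‖z‖ := fun w hw => by simpa using hw
  have hsph0 : ∀ w ∈ Metric.sphere (0 : ℂ) ‖z‖, w ≠ 0 := fun w hw => by
    rw [← norm_pos_iff, hsph w hw]; exact hz
  have hPd := hP.differentiableOn
  have hdsl : DifferentiableOn ℂ (dslope P z) (Metric.ball 0 ρ) :=
    (Complex.differentiableOn_dslope (Metric.isOpen_ball.mem_nhds (by simpa using hzρ))).mpr hPd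
  -- G(w)/(w - z) is decomposed into G(z)/(w - z), the divided difference of the power series part
  -- P, and the divided differences of the negative powers. The second piece is holomorphic in the
  -- disc and contributes nothing.
  have h1 : IsScalarPV (dslope P z) z 0 := by
    have hc := hdsl.continuousOn.mono (Metric.closedBall_subset_ball hzρ)
    have := of_continuousOn hz' (hc.mono Metric.sphere_subset_closedBall)
    rwa [Complex.circleIntegral_eq_zero_of_differentiable_on_off_countable hz.le
      Set.countable_empty hc (fun w hw => hdsl.differentiableAt
        (Metric.isOpen_ball.mem_nhds (Metric.ball_subset_ball hzρ.le hw.1))), mul_zero] at this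
  -- The sum is the divided difference of w^(-m-1); only i = 0, the w⁻¹ term, has a residue.
  have h2 : ∀ m : ℕ, IsScalarPV
      (fun w => ∑ i ∈ Finset.range (m + 1), -(z⁻¹ ^ (m - i + 1)) * w⁻¹ ^ (i + 1)) z
      (-z ^ (-(m : ℤ) - 1)) := fun m => by
    have hi : ∀ i : ℕ, ContinuousOn (fun w : ℂ => -(z⁻¹ ^ (m - i + 1)) * w⁻¹ ^ (i + 1))
        (Metric.sphere 0 ‖z‖) := fun i =>
      continuousOn_const.mul ((continuousOn_inv₀.mono fun w hw => hsph0 w hw).pow _)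
    have := of_continuousOn hz' (continuousOn_finsetSum (Finset.range (m + 1)) fun i _ => hi i)
    rw [circleIntegral.integral_fun_sum fun i _ => (hi i).circleIntegrable hz.le,
      Finset.sum_range_succ', Finset.sum_eq_zero fun i _ => ?_] at this
    · have hres := circleIntegral.integral_sub_center_inv (0 : ℂ) hz.ne'
      simp only [sub_zero] at hres
      rw [zero_add, circleIntegral.integral_const_mul] at this
      simp only [zero_add, pow_one, hres, tsub_zero] at this
      convert this using 1
      rw [mul_comm, mul_assoc, mul_inv_cancel₀ h2pi, mul_one, inv_pow, ← zpow_natCast,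
        ← zpow_neg]
      congr 2
      push_cast; ring
    · have h3 := circleIntegral.integral_sub_zpow_of_ne (n := -((i : ℤ) + 1 + 1))
        (by omega) 0 0 ‖z‖
      simp only [sub_zero] at h3
      rw [circleIntegral.integral_const_mul]
      have h4 : ∀ w : ℂ, w⁻¹ ^ (i + 1 + 1) = w ^ (-((i : ℤ) + 1 + 1)) := fun w => by
        rw [inv_pow, zpow_neg]
        norm_cast
      simp only [h4, h3, mul_zero]
  have h3 : ∀ s : Finset ℕ, IsScalarPV (fun w => ∑ m ∈ s, g (-(m : ℤ) - 1) *
      ∑ i ∈ Finset.range (m + 1), -(z⁻¹ ^ (m - i + 1)) * w⁻¹ ^ (i + 1)) z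
      (∑ m ∈ s, g (-(m : ℤ) - 1) * (-z ^ (-(m : ℤ) - 1))) := fun s => by
    classical
    induction s using Finset.induction_on with
    | empty =>
      have := (of_continuousOn hz' (Φ := fun _ => 0) continuousOn_const).const_mul 0
      simpa using this
    | insert a s ha ih =>
      simp only [Finset.sum_insert ha]
      exact ((h2 a).const_mul (g (-(a : ℤ) - 1))).add ih
  have hfin := (((cauchy_kernel hz').const_mul (G z)).add (h3 (Finset.range M))).add h1
  convert hfin.congr (Ψ := fun w => (w - z)⁻¹ * G w) ?_ using 1
  · simp only [mul_neg, Finset.sum_neg_distrib]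
    ring
  · intro w hw hwz
    have hw0 : w ≠ 0 := by rw [← norm_pos_iff, hw]; exact hz
    have hne : w - z ≠ 0 := sub_ne_zero.mpr hwz
    rw [dslope_of_ne _ hwz, slope_def_field, hGP z hz hzρ, hGP w (hw ▸ hz) (hw ▸ hzρ)]
    have h5 : ∀ m : ℕ, ∑ i ∈ Finset.range (m + 1), -(z⁻¹ ^ (m - i + 1)) * w⁻¹ ^ (i + 1) =
        (w - z)⁻¹ * (w ^ (-(m : ℤ) - 1) - z ^ (-(m : ℤ) - 1)) := fun m => by
      have h6 := (Commute.all w⁻¹ z⁻¹).geom_sum₂_mul (m + 1)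
      have h7 : ∀ u : ℂ, u ^ (-(m : ℤ) - 1) = u⁻¹ ^ (m + 1) := fun u => by
        rw [inv_pow, ← zpow_natCast, ← zpow_neg]
        congr 1
        push_cast; ring
      rw [h7, h7, ← h6]
      have h8 : w⁻¹ - z⁻¹ = -(w - z) * (w⁻¹ * z⁻¹) := by field_simp; ring
      rw [h8, show ∀ S : ℂ, (w - z)⁻¹ * (S * (-(w - z) * (w⁻¹ * z⁻¹))) = S * (-(w⁻¹ * z⁻¹)) by
        intro S; field_simp, Finset.sum_mul]
      refine Finset.sum_congr rfl fun i hi => ?_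
      rw [show m + 1 - 1 - i = m - i by omega]
      ring
    simp only [h5]
    have h9 : ∑ m ∈ Finset.range M, g (-(m : ℤ) - 1) * ((w - z)⁻¹ * (w ^ (-(m : ℤ) - 1) -
        z ^ (-(m : ℤ) - 1))) = (w - z)⁻¹ * (∑ m ∈ Finset.range M, g (-(m : ℤ) - 1) *
        w ^ (-(m : ℤ) - 1) - ∑ m ∈ Finset.range M, g (-(m : ℤ) - 1) * z ^ (-(m : ℤ) - 1)) := by
      rw [← Finset.sum_sub_distrib, Finset.mul_sum]
      exact Finset.sum_congr rfl fun m _ => by ring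
    rw [h9]
    field_simp
    ring

end IsScalarPV

/-! ### Tensors -/

section Tensors

variable {g : Type*} [LieRing g] [LieAlgebra ℂ g]

theorem contract_tmul (φ : Module.Dual ℂ g) (a b : g) : contract φ (a ⊗ₜ[ℂ] b) = φ a • b := rfl

theorem contract_add_left (φ ψ : Module.Dual ℂ g) (s : g ⊗[ℂ] g) :
    contract (φ + ψ) s = contract φ s + contract ψ s := by
  induction s with
  | zero => simp
  | tmul a b => simp [contract_tmul, add_smul]
  | add s t hs ht => rw [map_add, map_add, map_add, hs, ht]; abel

theorem contract_smul_left (c : ℂ) (φ : Module.Dual ℂ g) (s : g ⊗[ℂ] g) :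
    contract (c • φ) s = c • contract φ s := by
  induction s with
  | zero => simp
  | tmul a b => simp [contract_tmul, mul_smul]
  | add s t hs ht => rw [map_add, map_add, smul_add, hs, ht]

/-- Contraction, as a linear map in both arguments. -/
def contractHom : Module.Dual ℂ g →ₗ[ℂ] g ⊗[ℂ] g →ₗ[ℂ] g where
  toFun := contract
  map_add' φ ψ := LinearMap.ext fun s => contract_add_left φ ψ s
  map_smul' c φ := LinearMap.ext fun s => contract_smul_left c φ s

@[simp] theorem contractHom_apply (φ : Module.Dual ℂ g) (s : g ⊗[ℂ] g) :
    contractHom φ s = contract φ s := rfl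

theorem contract_neg_left (φ : Module.Dual ℂ g) (s : g ⊗[ℂ] g) :
    contract (-φ) s = -contract φ s := by
  rw [← neg_one_smul ℂ φ, contract_smul_left, neg_one_smul]

/-- `ψ(contract φ s) = φ(contract ψ s²¹)`. -/
theorem apply_contract_comm (φ ψ : Module.Dual ℂ g) (s : g ⊗[ℂ] g) :
    φ (contract ψ (TensorProduct.comm ℂ g g s)) = ψ (contract φ s) := by
  induction s with
  | zero => simp
  | tmul a b => simp [contract_tmul, mul_comm]
  | add s t hs ht => simp only [map_add, hs, ht]

theorem eq_of_forall_dual {V : Type*} [AddCommGroup V] [Module ℂ V] {x y : V}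
    (h : ∀ φ : Module.Dual ℂ V, φ x = φ y) : x = y := by
  rw [← sub_eq_zero, ← Module.forall_dual_apply_eq_zero_iff ℂ]
  intro φ
  rw [map_sub, h, sub_self]

/-- Contracting with coordinate functionals and taking coordinates of the result recovers all
coordinates of a tensor. -/
theorem contract_ext [FiniteDimensional ℂ g] {s t : g ⊗[ℂ] g}
    (h : ∀ φ, contract φ s = contract φ t) : s = t := by
  let b := Module.finBasis ℂ g
  refine (b.tensorProduct b).ext_elem fun p => ?_
  have key : ∀ u : g ⊗[ℂ] g, (b.tensorProduct b).repr u p =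
      b.coord p.2 (contract (b.coord p.1) u) := fun u => by
    induction u with
    | zero => simp
    | tmul a c =>
      obtain ⟨i, j⟩ := p
      rw [Module.Basis.tensorProduct_repr_tmul_apply]
      simp [contract_tmul, mul_comm]
    | add s t hs ht => simp only [map_add, Finsupp.add_apply, hs, ht]
  rw [key, key, h]

theorem contract_lie (α : Module.Dual ℂ g) (x : g) (s : g ⊗[ℂ] g) :
    contract α ⁅x, s⁆ =
      contract (α.comp (LieAlgebra.ad ℂ g x : Module.End ℂ g)) s + ⁅x, contract α s⁆ := by
  induction s with
  | zero => simp
  | tmul a b => simp [contract_tmul, TensorProduct.LieModule.lie_tmul_right]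
  | add s t hs ht => rw [lie_add, map_add, hs, ht, map_add, map_add, lie_add]; abel

/-- The functional `α ⊗ β ⊗ γ` on triple tensors. -/
def tripleDual (α β γ : Module.Dual ℂ g) : Module.Dual ℂ (g ⊗[ℂ] (g ⊗[ℂ] g)) :=
  LinearMap.mul' ℂ ℂ ∘ₗ TensorProduct.map α (LinearMap.mul' ℂ ℂ ∘ₗ TensorProduct.map β γ)

theorem tripleDual_tmul (α β γ : Module.Dual ℂ g) (a b c : g) :
    tripleDual α β γ (a ⊗ₜ[ℂ] (b ⊗ₜ[ℂ] c)) = α a * (β b * γ c) := rfl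

section Additivity

variable (s s' t t' : g ⊗[ℂ] g)

theorem br1213_add_left : br1213 (s + s') t = br1213 s t + br1213 s' t := by
  simp [br1213, TensorProduct.add_tmul]

theorem br1213_add_right : br1213 s (t + t') = br1213 s t + br1213 s t' := by
  simp [br1213, TensorProduct.tmul_add]

theorem br1223_add_left : br1223 (s + s') t = br1223 s t + br1223 s' t := by
  simp [br1223, TensorProduct.add_tmul]

theorem br1223_add_right : br1223 s (t + t') = br1223 s t + br1223 s t' := by
  simp [br1223, TensorProduct.tmul_add]

theorem br1323_add_left : br1323 (s + s') t = br1323 s t + br1323 s' t := by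
  simp [br1323, TensorProduct.add_tmul]

theorem br1323_add_right : br1323 s (t + t') = br1323 s t + br1323 s t' := by
  simp [br1323, TensorProduct.tmul_add]

@[simp] theorem br1213_zero_left : br1213 (0 : g ⊗[ℂ] g) t = 0 := by simp [br1213]
@[simp] theorem br1213_zero_right : br1213 s (0 : g ⊗[ℂ] g) = 0 := by simp [br1213]
@[simp] theorem br1223_zero_left : br1223 (0 : g ⊗[ℂ] g) t = 0 := by simp [br1223]
@[simp] theorem br1223_zero_right : br1223 s (0 : g ⊗[ℂ] g) = 0 := by simp [br1223]
@[simp] theorem br1323_zero_left : br1323 (0 : g ⊗[ℂ] g) t = 0 := by simp [br1323]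
@[simp] theorem br1323_zero_right : br1323 s (0 : g ⊗[ℂ] g) = 0 := by simp [br1323]

end Additivity

theorem contract_zero_left (s : g ⊗[ℂ] g) : contract (0 : Module.Dual ℂ g) s = 0 := by
  rw [← contractHom_apply, map_zero, LinearMap.zero_apply]

theorem contract_ad_add (α : Module.Dual ℂ g) (x y : g) (t : g ⊗[ℂ] g) :
    contract (α.comp (LieAlgebra.ad ℂ g (x + y) : Module.End ℂ g)) t =
      contract (α.comp (LieAlgebra.ad ℂ g x : Module.End ℂ g)) t +
      contract (α.comp (LieAlgebra.ad ℂ g y : Module.End ℂ g)) t := by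
  rw [map_add, LinearMap.comp_add, contract_add_left]

variable (α β γ : Module.Dual ℂ g)

/-- This formula and its two companions rewrite the brackets of the Yang–Baxter equation, paired
with α ⊗ β ⊗ γ, in terms of contractions. These contractions are what the operator applied to α- and
β-valued loops produces. -/
theorem tripleDual_br1323 (s t : g ⊗[ℂ] g) :
    tripleDual α β γ (br1323 s t) = γ ⁅contract α s, contract β t⁆ := by
  induction s with
  | zero => simp
  | add s s' hs hs' => rw [br1323_add_left, map_add, hs, hs', map_add, add_lie, map_add]
  | tmul a b =>
    induction t with
    | zero => simp
    | add t t' ht ht' => rw [br1323_add_right, map_add, ht, ht', map_add, lie_add, map_add]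
    | tmul c d =>
      simp [br1323_tmul, tripleDual_tmul, contract_tmul]
      ring

theorem tripleDual_br1223 (s t : g ⊗[ℂ] g) :
    tripleDual α β γ (br1223 s t) =
      γ (contract (β.comp (LieAlgebra.ad ℂ g (contract α s) : Module.End ℂ g)) t) := by
  induction s with
  | zero => simp [contract_zero_left]
  | add s s' hs hs' =>
    rw [br1223_add_left, map_add, hs, hs', map_add, contract_ad_add, map_add]
  | tmul a b =>
    induction t with
    | zero => simp
    | add t t' ht ht' => rw [br1223_add_right, map_add, ht, ht', map_add, map_add]
    | tmul c d =>
      simp [br1223_tmul, tripleDual_tmul, contract_tmul, mul_assoc]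

/-- The flip of s occurs because β eats its second leg, leaving the first one to be bracketed inside
α. -/
theorem tripleDual_br1213 (s t : g ⊗[ℂ] g) :
    tripleDual α β γ (br1213 s t) = γ (contract (α.comp (LieAlgebra.ad ℂ g
      (contract β (TensorProduct.comm ℂ g g s)) : Module.End ℂ g)) t) := by
  induction s with
  | zero => simp [contract_zero_left]
  | add s s' hs hs' =>
    rw [br1213_add_left, map_add, hs, hs', map_add, map_add, contract_ad_add, map_add]
  | tmul a b =>
    induction t with
    | zero => simp
    | add t t' ht ht' => rw [br1213_add_right, map_add, ht, ht', map_add, map_add]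
    | tmul c d =>
      simp [br1213_tmul, tripleDual_tmul, contract_tmul]
      ring

theorem tripleDual_ins1 (x : g) (s : g ⊗[ℂ] g) :
    tripleDual α β γ (ins1 x s) = α x * γ (contract β s) := by
  induction s with
  | zero => simp [ins1]
  | add s t hs ht =>
    have : ins1 x (s + t) = ins1 x s + ins1 x t := by simp [ins1, TensorProduct.tmul_add]
    rw [this, map_add, hs, ht, map_add, map_add, mul_add]
  | tmul a b => simp [ins1, tripleDual_tmul, contract_tmul]

theorem tripleDual_ins2 (x : g) (s : g ⊗[ℂ] g) :
    tripleDual α β γ (ins2 x s) = β x * γ (contract α (TensorProduct.comm ℂ g g s)) := by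
  induction s with
  | zero => simp [ins2]
  | add s t hs ht =>
    have : ins2 x (s + t) = ins2 x s + ins2 x t := by simp [ins2, TensorProduct.tmul_add]
    rw [this, map_add, hs, ht, map_add, map_add, map_add, mul_add]
  | tmul a b => simp [ins2_tmul, tripleDual_tmul, contract_tmul]; ring

theorem tripleDual_ins3 (x : g) (s : g ⊗[ℂ] g) :
    tripleDual α β γ (ins3 x s) = γ x * β (contract α s) := by
  induction s with
  | zero => simp [ins3]
  | add s t hs ht =>
    have : ins3 x (s + t) = ins3 x s + ins3 x t := by simp [ins3, TensorProduct.add_tmul]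
    rw [this, map_add, hs, ht, map_add, map_add, mul_add]
  | tmul a b => simp [ins3_tmul, tripleDual_tmul, contract_tmul]; ring

end Tensors

/-! ### The Killing form, the Casimir element and invariant tensors -/

section Killing

theorem killingForm_comm {g : Type*} [LieRing g] [LieAlgebra ℂ g] (x y : g) : killingForm ℂ g x y = killingForm ℂ g y x :=
  LieModule.traceForm_comm ℂ g g x y

theorem killingForm_lie {g : Type*} [LieRing g] [LieAlgebra ℂ g] (x y z : g) :
    killingForm ℂ g ⁅x, y⁆ z = killingForm ℂ g x ⁅y, z⁆ :=
  LieModule.traceForm_apply_lie_apply ℂ g g x y z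

variable {g : Type*} [LieRing g] [LieAlgebra ℂ g] [FiniteDimensional ℂ g]

/-- A linear functional of the exponential of an endomorphism, as a series. -/
theorem hasSum_expEnd (T : Module.End ℂ g) (Λ : Module.End ℂ g →ₗ[ℂ] ℂ) :
    HasSum (fun n : ℕ => ((n.factorial : ℂ))⁻¹ * Λ (T ^ n)) (Λ (expEnd T)) := by
  let b := Module.finBasis ℂ g
  let M := LinearMap.toMatrix b b T
  have h1 : HasSum (fun n : ℕ => ((n.factorial : ℂ))⁻¹ • M ^ n) (NormedSpace.exp M) := by
    let _ : NormedRing (Matrix (Fin (Module.finrank ℂ g)) (Fin (Module.finrank ℂ g)) ℂ) :=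
      Matrix.linftyOpNormedRing
    let _ : NormedAlgebra ℂ (Matrix (Fin (Module.finrank ℂ g)) (Fin (Module.finrank ℂ g)) ℂ) :=
      Matrix.linftyOpNormedAlgebra
    exact NormedSpace.exp_series_hasSum_exp' M
  let Λ' : Matrix (Fin (Module.finrank ℂ g)) (Fin (Module.finrank ℂ g)) ℂ →ₗ[ℂ] ℂ :=
    Λ ∘ₗ (Matrix.toLin b b).toLinearMap
  have h2 : Continuous Λ' := LinearMap.continuous_of_finiteDimensional Λ'
  have h3 := h1.map Λ' h2
  refine (hasSum_congr fun n => ?_).mp h3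
  have : (Matrix.toLin b b) (M ^ n) = T ^ n := by
    rw [LinearMap.toMatrix_pow, Matrix.toLin_toMatrix]
  simp [Λ', this]

/-- For an invariant tensor, contraction intertwines precomposition with -ad x and ad x, hence also
all their powers; the exponential series are then compared term by term. -/
theorem contract_coAd {x : g} {s : g ⊗[ℂ] g} (h : ⁅x, s⁆ = 0) (α : Module.Dual ℂ g) :
    contract (coAd x α) s = Ad x (contract α s) := by
  refine eq_of_forall_dual fun φ => ?_
  let Λ₁ : Module.End ℂ g →ₗ[ℂ] ℂ :=
    { toFun := fun X => φ (contract (α.comp X) s)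
      map_add' := fun X Y => by rw [LinearMap.comp_add, contract_add_left, map_add]
      map_smul' := fun c X => by
        rw [LinearMap.comp_smul, contract_smul_left, map_smul]; rfl }
  let Λ₂ : Module.End ℂ g →ₗ[ℂ] ℂ :=
    { toFun := fun X => φ (X (contract α s))
      map_add' := fun X Y => by rw [LinearMap.add_apply, map_add]
      map_smul' := fun c X => by rw [LinearMap.smul_apply, map_smul]; rfl }
  have h1 := hasSum_expEnd (LieAlgebra.ad ℂ g (-x)) Λ₁
  have h2 := hasSum_expEnd (LieAlgebra.ad ℂ g x) Λ₂
  refine h1.unique ((hasSum_congr fun n => ?_).mp h2)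
  congr 1
  have key : ∀ n : ℕ, ∀ α : Module.Dual ℂ g,
      ((LieAlgebra.ad ℂ g x : Module.End ℂ g) ^ n) (contract α s) =
      contract (α.comp ((LieAlgebra.ad ℂ g (-x) : Module.End ℂ g) ^ n)) s := by
    intro n
    induction n with
    | zero => intro α; rfl
    | succ n ih =>
      intro α
      have h3 : (LieAlgebra.ad ℂ g x : Module.End ℂ g) (contract α s) =
          contract (α.comp (LieAlgebra.ad ℂ g (-x) : Module.End ℂ g)) s := by
        have h4 := contract_lie α x s
        rw [h, map_zero] at h4
        rw [map_neg, LinearMap.comp_neg, contract_neg_left, LieAlgebra.ad_apply]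
        exact (neg_eq_of_add_eq_zero_right h4.symm).symm
      rw [pow_succ, Module.End.mul_apply, h3, ih, pow_succ', Module.End.mul_eq_comp,
        LinearMap.comp_assoc]
  exact congrArg φ (key n α)

variable [LieAlgebra.IsSimple ℂ g]

@[simp] theorem killingForm_killingIso (α : Module.Dual ℂ g) (v : g) :
    killingForm ℂ g (killingIso g α) v = α v :=
  LinearMap.BilinForm.apply_toDual_symm_apply α v

theorem killingIso_symm_apply (x v : g) :
    (killingIso g).symm x v = killingForm ℂ g x v := by
  rw [← killingForm_killingIso ((killingIso g).symm x) v, LinearEquiv.apply_symm_apply]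

/-- `β ∘ ad y = -I⁻¹ [y, I β]` -/
theorem comp_ad_eq (β : Module.Dual ℂ g) (y : g) :
    β.comp (LieAlgebra.ad ℂ g y : Module.End ℂ g) =
      -(killingIso g).symm ⁅y, killingIso g β⁆ := by
  ext c
  rw [LinearMap.neg_apply, killingIso_symm_apply, ← lie_skew, map_neg, LinearMap.neg_apply,
    killingForm_lie, killingForm_killingIso, neg_neg]
  rfl

@[simp] theorem contract_casimir (α : Module.Dual ℂ g) :
    contract α (casimir g) = killingIso g α := by
  have : α = ∑ i, α (Module.finBasis ℂ g i) • (Module.finBasis ℂ g).coord i :=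
    (Module.Basis.sum_dual_apply_smul_coord _ _).symm
  conv_rhs => rw [this]
  simp only [casimir, map_sum, contract_tmul, map_smul]

@[simp] theorem comm_casimir :
    TensorProduct.comm ℂ g g (casimir g) = casimir g := by
  refine contract_ext fun α => eq_of_forall_dual fun φ => ?_
  rw [apply_contract_comm, contract_casimir, contract_casimir, ← killingForm_killingIso α,
    killingForm_comm, killingForm_killingIso]

theorem lie_casimir (x : g) : ⁅x, casimir g⁆ = 0 := by
  refine contract_ext fun α => ?_
  rw [contract_lie, map_zero, contract_casimir, contract_casimir, comp_ad_eq, map_neg,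
    LinearEquiv.apply_symm_apply, neg_add_cancel]

/-- I is contraction with the invariant tensor Ω. -/
theorem killingIso_coAd (x : g) (α : Module.Dual ℂ g) :
    killingIso g (coAd x α) = Ad x (killingIso g α) := by
  simpa using contract_coAd (lie_casimir x) α

/-- A tensor `A` with `[A¹², Ω¹³ + Ω²³] = 0` and `[A¹², A¹³] = 0` vanishes. -/
theorem eq_zero_of_invariant_of_commuting {A : g ⊗[ℂ] g}
    (h1 : ∀ α β γ : Module.Dual ℂ g, tripleDual α β γ (br1213 A (casimir g)) +
      tripleDual α β γ (br1223 A (casimir g)) = 0)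
    (h2 : ∀ α β γ : Module.Dual ℂ g, tripleDual α β γ (br1213 A A) = 0) : A = 0 := by
  -- The first hypothesis says that I kills a certain functional for every α, β. As I is injective,
  -- the functional is zero, and evaluating it at c gives invariance of A.
  have hinv : ∀ (α : Module.Dual ℂ g) (c : g),
      contract (α.comp (LieAlgebra.ad ℂ g c : Module.End ℂ g)) A = -⁅c, contract α A⁆ := by
    intro α c
    refine eq_of_forall_dual fun β => ?_
    have h3 : α.comp (LieAlgebra.ad ℂ g (contract β (TensorProduct.comm ℂ g g A)) :
          Module.End ℂ g) + β.comp (LieAlgebra.ad ℂ g (contract α A) : Module.End ℂ g) = 0 := by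
      rw [← (killingIso g).map_eq_zero_iff]
      refine eq_of_forall_dual fun γ => ?_
      have := h1 α β γ
      rw [tripleDual_br1213, tripleDual_br1223, contract_casimir, contract_casimir] at this
      rw [map_add, map_add, this, map_zero]
    have h4 := LinearMap.congr_fun h3 c
    simp only [LinearMap.add_apply, LinearMap.comp_apply, LinearMap.zero_apply,
      LieAlgebra.ad_apply] at h4
    have h5 : α ⁅contract β (TensorProduct.comm ℂ g g A), c⁆ =
        -β (contract (α.comp (LieAlgebra.ad ℂ g c : Module.End ℂ g)) A) := by
      rw [← apply_contract_comm, LinearMap.comp_apply, LieAlgebra.ad_apply, ← lie_skew, map_neg]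
    rw [h5, ← lie_skew, map_neg] at h4
    rw [map_neg]
    linear_combination -h4
  have hcomm : ∀ α β : Module.Dual ℂ g,
      ⁅contract β (TensorProduct.comm ℂ g g A), contract α A⁆ = 0 := fun α β => by
    refine eq_of_forall_dual fun γ => ?_
    have := h2 α β γ
    rw [tripleDual_br1213, hinv, map_neg, neg_eq_zero] at this
    rw [this, map_zero]
  -- By invariance, the contractions of A over its first leg form an ideal, so they are 0 or all of
  -- g.
  let J : LieIdeal ℂ g :=
    { LinearMap.range (contractHom.flip A) with
      lie_mem := by
        rintro x m ⟨α, rfl⟩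
        exact ⟨-α.comp (LieAlgebra.ad ℂ g x : Module.End ℂ g), by
          rw [LinearMap.flip_apply, LinearMap.flip_apply, contractHom_apply, contract_neg_left,
            hinv, neg_neg, contractHom_apply]⟩ }
  have hJ : ∀ x, x ∈ J ↔ ∃ α, contract α A = x := fun x => Iff.rfl
  rcases LieAlgebra.IsSimple.eq_bot_or_eq_top J with hb | ht
  · refine contract_ext fun α => ?_
    have : contract α A ∈ J := (hJ _).mpr ⟨α, rfl⟩
    rw [hb, LieSubmodule.mem_bot] at this
    rw [this, map_zero]
  -- If they fill g, then by `hcomm` the contractions over the other leg are central, and the centre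
  -- of g is zero.
  · have hA : TensorProduct.comm ℂ g g A = 0 := by
      refine contract_ext fun β => ?_
      rw [map_zero]
      have hc : contract β (TensorProduct.comm ℂ g g A) ∈ LieAlgebra.center ℂ g := by
        rw [LieModule.mem_maxTrivSubmodule]
        intro x
        obtain ⟨α, rfl⟩ := (hJ x).mp (by rw [ht]; trivial)
        rw [← lie_skew, hcomm, neg_zero]
      have hz : LieAlgebra.center ℂ g = ⊥ := LieAlgebra.center_eq_bot ℂ g
      rw [hz, LieSubmodule.mem_bot] at hc
      exact hc
    simpa using hA

end Killing

/-! ### Vector-valued functions, tested against functionals -/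

section VectorValued

variable {V W : Type*} [AddCommGroup V] [Module ℂ V] [FiniteDimensional ℂ V]
  [AddCommGroup W] [Module ℂ W] [FiniteDimensional ℂ W]

theorem dual_eq_sum (φ : Module.Dual ℂ V) (v : V) :
    φ v = ∑ i, φ (Module.finBasis ℂ V i) * (Module.finBasis ℂ V).coord i v := by
  conv_lhs => rw [← (Module.finBasis ℂ V).sum_repr v, map_sum]
  refine Finset.sum_congr rfl fun i _ => ?_
  rw [map_smul, smul_eq_mul, mul_comm, Module.Basis.coord_apply]

theorem bilin_eq_sum (B : V →ₗ[ℂ] W →ₗ[ℂ] ℂ) (v : V) (w : W) :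
    B v w = ∑ i, ∑ j, B (Module.finBasis ℂ V i) (Module.finBasis ℂ W j) *
      ((Module.finBasis ℂ V).coord i v * (Module.finBasis ℂ W).coord j w) := by
  conv_lhs => rw [← (Module.finBasis ℂ V).sum_repr v]
  rw [map_sum, LinearMap.sum_apply]
  refine Finset.sum_congr rfl fun i _ => ?_
  rw [map_smul, LinearMap.smul_apply, smul_eq_mul, dual_eq_sum (B _) w, Finset.mul_sum]
  refine Finset.sum_congr rfl fun j _ => ?_
  simp only [Module.Basis.coord_apply]
  ring

theorem tendsto_bilin {ι : Type*} {l : Filter ι} (B : V →ₗ[ℂ] W →ₗ[ℂ] ℂ) {F : ι → V} {G : ι → W}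
    {v : V} {w : W} (hF : ∀ φ : Module.Dual ℂ V, Filter.Tendsto (fun i => φ (F i)) l (𝓝 (φ v)))
    (hG : ∀ φ : Module.Dual ℂ W, Filter.Tendsto (fun i => φ (G i)) l (𝓝 (φ w))) :
    Filter.Tendsto (fun i => B (F i) (G i)) l (𝓝 (B v w)) := by
  rw [bilin_eq_sum B v w]
  simp only [fun i => bilin_eq_sum B (F i) (G i)]
  exact tendsto_finsetSum _ fun i _ => tendsto_finsetSum _ fun j _ =>
    ((hF _).mul (hG _)).const_mul _

theorem dual_vderiv (φ : Module.Dual ℂ V) {F : ℂ → V} {t : ℂ}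
    (hF : ∀ ψ : Module.Dual ℂ V, DifferentiableAt ℂ (fun s => ψ (F s)) t) :
    φ (vderiv F t) = deriv (fun s => φ (F s)) t := by
  have : (fun s => φ (F s)) = fun s => ∑ i, φ (Module.finBasis ℂ V i) *
      (Module.finBasis ℂ V).coord i (F s) := funext fun s => dual_eq_sum φ (F s)
  rw [this, deriv_fun_sum fun i _ => (hF _).const_mul _, vderiv, map_sum]
  refine Finset.sum_congr rfl fun i _ => ?_
  rw [map_smul, smul_eq_mul, deriv_const_mul _ (hF _), mul_comm]

/-- The coordinatewise divided difference at 0 is analytic; it peels off one power of z from a pole.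
-/
theorem exists_factor_zero {G : ℂ → V} (hG : ∀ φ : Module.Dual ℂ V,
    AnalyticAt ℂ (fun z => φ (G z)) 0) :
    ∃ K : ℂ → V, (∀ φ : Module.Dual ℂ V, AnalyticAt ℂ (fun z => φ (K z)) 0) ∧
      ∀ z, G z = G 0 + z • K z := by
  let b := Module.finBasis ℂ V
  have hd : ∀ i, AnalyticAt ℂ (dslope (fun z => b.coord i (G z)) 0) 0 := fun i => by
    obtain ⟨p, hp⟩ := hG (b.coord i)
    exact ⟨_, hp.has_fpower_series_dslope_fslope⟩
  refine ⟨fun z => ∑ i, dslope (fun z => b.coord i (G z)) 0 z • b i, fun φ => ?_, fun z => ?_⟩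
  · simp only [map_sum, map_smul, smul_eq_mul]
    exact Finset.analyticAt_fun_sum _ fun i _ => (hd i).mul analyticAt_const
  · rw [Finset.smul_sum]
    have h1 : ∀ i, z • dslope (fun z => b.coord i (G z)) 0 z • b i =
        b.coord i (G z) • b i - b.coord i (G 0) • b i := fun i => by
      have := sub_smul_dslope (fun z => b.coord i (G z)) 0 z
      rw [sub_zero, smul_eq_mul] at this
      rw [smul_smul, this, sub_smul]
    rw [Finset.sum_congr rfl fun i _ => h1 i, Finset.sum_sub_distrib]
    simp only [Module.Basis.coord_apply, b.sum_repr]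
    abel

end VectorValued

/-! ### Dynamical r-matrices have a simple pole at `z = 0` -/

section SimplePole

variable {g : Type*} [LieRing g] [LieAlgebra ℂ g] [FiniteDimensional ℂ g]
  {H : LieSubalgebra ℂ g} {r : Module.Dual ℂ H → ℂ → g ⊗[ℂ] g} {q : Module.Dual ℂ H}

/-- Regularity is an open condition because it need only be tested on finitely many coordinates. -/
theorem RegularAt.eventually {z : ℂ} (h : RegularAt r q z) :
    ∀ᶠ p : Module.Dual ℂ H × ℂ in 𝓝 (q, z), RegularAt r p.1 p.2 := by
  have h1 : ∀ᶠ p : Module.Dual ℂ H × ℂ in 𝓝 (q, z), ∀ i,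
      AnalyticAt ℂ (fun p : Module.Dual ℂ H × ℂ =>
        (Module.finBasis ℂ (g ⊗[ℂ] g)).coord i (r p.1 p.2)) p :=
    Filter.eventually_all.mpr fun i => (h _).eventually_analyticAt
  filter_upwards [h1] with p hp φ
  simp only [fun p : Module.Dual ℂ H × ℂ => dual_eq_sum φ (r p.1 p.2)]
  exact Finset.analyticAt_fun_sum _ fun i _ => analyticAt_const.mul (hp i)

theorem RegularAt.analyticAt {z : ℂ} (h : RegularAt r q z) (φ : Module.Dual ℂ (g ⊗[ℂ] g)) :
    AnalyticAt ℂ (fun z => φ (r q z)) z :=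
  (h φ).comp (f := fun z : ℂ => (q, z)) (analyticAt_const.prod analyticAt_id)

theorem RegularAt.dual_partialDeriv {z : ℂ} (h : RegularAt r q z) (a : Module.Dual ℂ H)
    (φ : Module.Dual ℂ (g ⊗[ℂ] g)) :
    φ (partialDeriv r a q z) =
      fderiv ℂ (fun p : Module.Dual ℂ H × ℂ => φ (r p.1 p.2)) (q, z) (a, 0) := by
  have key : ∀ ψ : Module.Dual ℂ (g ⊗[ℂ] g), HasDerivAt (fun t : ℂ => ψ (r (q + t • a) z))
      (fderiv ℂ (fun p : Module.Dual ℂ H × ℂ => ψ (r p.1 p.2)) (q, z) (a, 0)) 0 := fun ψ => by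
    have h1 := (h ψ).differentiableAt.hasFDerivAt
    have h2 : HasDerivAt (fun t : ℂ => (q + t • a, z)) (a, 0) 0 := by
      refine HasDerivAt.prodMk ?_ (hasDerivAt_const _ _)
      simpa using ((hasDerivAt_id (0 : ℂ)).smul_const a).const_add q
    have h3 : HasFDerivAt (fun p : Module.Dual ℂ H × ℂ => ψ (r p.1 p.2))
        (fderiv ℂ (fun p : Module.Dual ℂ H × ℂ => ψ (r p.1 p.2)) (q, z))
        ((fun t : ℂ => (q + t • a, z)) 0) := by simpa using h1
    exact h3.comp_hasDerivAt (0 : ℂ) h2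
  rw [partialDeriv, dual_vderiv φ fun ψ => (key ψ).differentiableAt]
  exact (key φ).deriv

theorem RegularAt.analyticAt_partialDeriv {z : ℂ} (h : RegularAt r q z) (a : Module.Dual ℂ H)
    (φ : Module.Dual ℂ (g ⊗[ℂ] g)) :
    AnalyticAt ℂ (fun z => φ (partialDeriv r a q z)) z := by
  have h1 : AnalyticAt ℂ (fun z : ℂ =>
      fderiv ℂ (fun p : Module.Dual ℂ H × ℂ => φ (r p.1 p.2)) (q, z) (a, 0)) z := by
    have h2 := (h φ).fderiv.comp (f := fun z : ℂ => (q, z)) (analyticAt_const.prod analyticAt_id)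
    exact ((ContinuousLinearMap.apply ℂ ℂ ((a, 0) : Module.Dual ℂ H × ℂ)).analyticAt _).comp h2
  refine h1.congr ?_
  have h3 : ∀ᶠ z' in 𝓝 z, RegularAt r q z' :=
    (Continuous.prodMk_right q).continuousAt.eventually (f := fun z' : ℂ => (q, z')) h.eventually
  filter_upwards [h3] with z' hz'
  exact (hz'.dual_partialDeriv a φ).symm

/-- The form `(α ⊗ β ⊗ γ)([s¹², t¹³])`, bilinear in `s` and `t`. -/
def bilin1213 (α β γ : Module.Dual ℂ g) : g ⊗[ℂ] g →ₗ[ℂ] g ⊗[ℂ] g →ₗ[ℂ] ℂ :=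
  (TensorProduct.mk ℂ _ _).compr₂ (tripleDual α β γ ∘ₗ TensorProduct.map lieLin LinearMap.id ∘ₗ
    (TensorProduct.tensorTensorTensorComm ℂ g g g g).toLinearMap)

/-- The form `(α ⊗ β ⊗ γ)([s¹², t²³])`, bilinear in `s` and `t`. -/
def bilin1223 (α β γ : Module.Dual ℂ g) : g ⊗[ℂ] g →ₗ[ℂ] g ⊗[ℂ] g →ₗ[ℂ] ℂ :=
  (TensorProduct.mk ℂ _ _).compr₂ (tripleDual α β γ ∘ₗ TensorProduct.map LinearMap.id
    (TensorProduct.map lieLin LinearMap.id ∘ₗ (TensorProduct.assoc ℂ g g g).symm.toLinearMap) ∘ₗ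
    (TensorProduct.assoc ℂ g g (g ⊗[ℂ] g)).toLinearMap)

/-- The form `(α ⊗ β ⊗ γ)([s¹³, t²³])`, bilinear in `s` and `t`. -/
def bilin1323 (α β γ : Module.Dual ℂ g) : g ⊗[ℂ] g →ₗ[ℂ] g ⊗[ℂ] g →ₗ[ℂ] ℂ :=
  (TensorProduct.mk ℂ _ _).compr₂ (tripleDual α β γ ∘ₗ
    (TensorProduct.assoc ℂ g g g).toLinearMap ∘ₗ TensorProduct.map LinearMap.id lieLin ∘ₗ
    (TensorProduct.tensorTensorTensorComm ℂ g g g g).toLinearMap)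

omit [FiniteDimensional ℂ g] in
theorem bilin1213_apply (α β γ : Module.Dual ℂ g) (s t : g ⊗[ℂ] g) :
    bilin1213 α β γ s t = tripleDual α β γ (br1213 s t) := rfl

omit [FiniteDimensional ℂ g] in
theorem bilin1223_apply (α β γ : Module.Dual ℂ g) (s t : g ⊗[ℂ] g) :
    bilin1223 α β γ s t = tripleDual α β γ (br1223 s t) := rfl

omit [FiniteDimensional ℂ g] in
theorem bilin1323_apply (α β γ : Module.Dual ℂ g) (s t : g ⊗[ℂ] g) :
    bilin1323 α β γ s t = tripleDual α β γ (br1323 s t) := rfl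

theorem tripleDual_altD (α β γ : Module.Dual ℂ g) (z₁ z₂ z₃ : ℂ) :
    tripleDual α β γ (altD r q z₁ z₂ z₃) =
      ∑ i, (α (Module.finBasis ℂ H i : g) * γ (contract β
          (partialDeriv r ((Module.finBasis ℂ H).coord i) q (z₂ - z₃))) +
        β (Module.finBasis ℂ H i : g) * γ (contract α (TensorProduct.comm ℂ g g
          (partialDeriv r ((Module.finBasis ℂ H).coord i) q (z₃ - z₁)))) +
        γ (Module.finBasis ℂ H i : g) * β (contract α
          (partialDeriv r ((Module.finBasis ℂ H).coord i) q (z₁ - z₂)))) := by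
  simp only [altD, map_sum, map_add, tripleDual_ins1, tripleDual_ins2, tripleDual_ins3]

theorem exists_noPole (hq : q ∈ regularSet r) : ∃ r₀ : ℝ, NoPole r q r₀ :=
  let ⟨r₀, h⟩ := hq
  ⟨r₀, h.self_of_nhds⟩

theorem eventually_punctured {ρ : ℝ} (hρ : 0 < ρ) :
    ∀ᶠ z : ℂ in 𝓝[≠] 0, 0 < ‖z‖ ∧ ‖z‖ < ρ := by
  filter_upwards [self_mem_nhdsWithin, nhdsWithin_le_nhds (Metric.ball_mem_nhds (0 : ℂ) hρ)]
    with z h1 h2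
  exact ⟨norm_pos_iff.mpr h1, by simpa using h2⟩

variable [LieAlgebra.IsSimple ℂ g]

/-- The leading coefficient of a pole of order at least two vanishes. -/
theorem IsDynamicalRMatrix.leading_coeff_eq_zero (hr : IsDynamicalRMatrix r)
    (hq : q ∈ regularSet r) {m : ℕ} {G : ℂ → g ⊗[ℂ] g}
    (hG : ∀ φ : Module.Dual ℂ (g ⊗[ℂ] g), AnalyticAt ℂ (fun z => φ (G z)) 0)
    (hrG : ∀ᶠ z in 𝓝[≠] 0, r q z = (z ^ (m + 2))⁻¹ • G z) : G 0 = 0 := by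
  obtain ⟨r₀, hr₀, hreg⟩ := exists_noPole hq
  obtain ⟨ε₁, hε₁, hrG⟩ : ∃ ε > 0, ∀ z : ℂ, 0 < ‖z‖ → ‖z‖ < ε → r q z = (z ^ (m + 2))⁻¹ • G z := by
    rw [eventually_nhdsWithin_iff, Metric.eventually_nhds_iff] at hrG
    obtain ⟨ε, hε, h⟩ := hrG
    exact ⟨ε, hε, fun z h0 hz => h (by simpa using hz) (norm_pos_iff.mp h0)⟩
  obtain ⟨G₁, hG₁, hGG₁⟩ := exists_factor_zero hG
  set A := G 0 with hA
  set δ := min r₀ ε₁ with hδ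
  have hδ0 : 0 < δ := lt_min hr₀ hε₁
  have hreg' : ∀ z : ℂ, 0 < ‖z‖ → ‖z‖ < δ → RegularAt r q z :=
    fun z h0 hz => hreg z h0 (hz.trans_le (min_le_left _ _))
  have hrG' : ∀ z : ℂ, 0 < ‖z‖ → ‖z‖ < δ → r q z = (z ^ (m + 2))⁻¹ • G z :=
    fun z h0 hz => hrG z h0 (hz.trans_le (min_le_right _ _))
  have hadd : ∀ v : ℂ, 0 < ‖v‖ → ‖v‖ < δ → ∀ᶠ u : ℂ in 𝓝 0, 0 < ‖u + v‖ ∧ ‖u + v‖ < δ := by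
    intro v h0 hv
    have hc : Filter.Tendsto (fun u : ℂ => ‖u + v‖) (𝓝 0) (𝓝 ‖v‖) := by
      have : Continuous fun u : ℂ => ‖u + v‖ := by fun_prop
      simpa using this.tendsto 0
    exact (hc.eventually_const_lt h0).and (hc.eventually_lt_const hv)
  have hshift : ∀ v : ℂ, 0 < ‖v‖ → ‖v‖ < δ → ∀ φ : Module.Dual ℂ (g ⊗[ℂ] g),
      Filter.Tendsto (fun u => φ (r q (u + v))) (𝓝[≠] 0) (𝓝 (φ (r q v))) := by
    intro v h0 hv φ
    have h1 := ((hreg' v h0 hv).analyticAt φ).continuousAt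
    have h2 : Filter.Tendsto (fun u : ℂ => u + v) (𝓝[≠] 0) (𝓝 v) := by
      have : Filter.Tendsto (fun u : ℂ => u + v) (𝓝 0) (𝓝 (0 + v)) :=
        (Continuous.tendsto (by fun_prop) 0)
      rw [zero_add] at this
      exact this.mono_left nhdsWithin_le_nhds
    exact h1.tendsto.comp h2
  have hGlim : ∀ φ : Module.Dual ℂ (g ⊗[ℂ] g),
      Filter.Tendsto (fun u => φ (G u)) (𝓝[≠] 0) (𝓝 (φ A)) := fun φ =>
    (hG φ).continuousAt.tendsto.mono_left nhdsWithin_le_nhds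
  have hG₁lim : ∀ φ : Module.Dual ℂ (g ⊗[ℂ] g),
      Filter.Tendsto (fun u => φ (G₁ u)) (𝓝[≠] 0) (𝓝 (φ (G₁ 0))) := fun φ =>
    (hG₁ φ).continuousAt.tendsto.mono_left nhdsWithin_le_nhds
  have main : ∀ α β γ : Module.Dual ℂ g,
      (tripleDual α β γ (br1213 A (casimir g)) + tripleDual α β γ (br1223 A (casimir g)) = 0) ∧
      tripleDual α β γ (br1213 A A) = 0 := by
    intro α β γ
    set B₁ := bilin1213 α β γ with hB₁
    set B₂ := bilin1223 α β γ with hB₂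
    -- The Yang–Baxter equation at (u + v, v, 0), multiplied by u^(m+2). Z collects the two brackets
    -- containing r¹²(u), its pole being absorbed in G. X is the derivative of r¹²(u), possibly
    -- singular in u but independent of v. Y is the rest, with a limit as u → 0.
    set Z : ℂ → ℂ → ℂ := fun v u => B₁ (G u) (r q (u + v)) + B₂ (G u) (r q v) with hZ
    set X : ℂ → ℂ := fun u => ∑ i, γ (Module.finBasis ℂ H i : g) * β (contract α
          (partialDeriv r ((Module.finBasis ℂ H).coord i) q u)) with hX
    set Y : ℂ → ℂ → ℂ := fun v u =>
      ∑ i, (α (Module.finBasis ℂ H i : g) * γ (contract β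
          (partialDeriv r ((Module.finBasis ℂ H).coord i) q v)) +
        β (Module.finBasis ℂ H i : g) * γ (contract α (TensorProduct.comm ℂ g g
          (partialDeriv r ((Module.finBasis ℂ H).coord i) q (0 - (u + v)))))) +
      bilin1323 α β γ (r q (u + v)) (r q v) with hY
    have heq : ∀ v : ℂ, 0 < ‖v‖ → ‖v‖ < δ → ∀ᶠ u in 𝓝[≠] 0,
        u ^ (m + 2) * (X u + Y v u) + Z v u = 0 := by
      intro v h0 hv
      filter_upwards [nhdsWithin_le_nhds (hadd v h0 hv), eventually_punctured hδ0]
        with u ⟨h1, h2⟩ ⟨h3, h4⟩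
      have hc := hr.cdybe q (u + v) v 0 (by rw [add_sub_cancel_right]; exact hreg' u h3 h4)
        (by rw [sub_zero]; exact hreg' _ h1 h2) (by rw [sub_zero]; exact hreg' v h0 hv)
        (by rw [zero_sub]; exact hreg' _ (by rwa [norm_neg]) (by rwa [norm_neg]))
      have hc' := congrArg (tripleDual α β γ) hc
      rw [map_add, map_add, map_add, tripleDual_altD, map_zero] at hc'
      simp only [add_sub_cancel_right, sub_zero] at hc'
      rw [← bilin1213_apply, ← bilin1223_apply, ← bilin1323_apply, ← hB₁, ← hB₂,
        Finset.sum_add_distrib] at hc'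
      have h5 : G u = u ^ (m + 2) • r q u := by
        rw [hrG' u h3 h4, smul_smul, mul_inv_cancel₀ (pow_ne_zero _ (norm_pos_iff.mp h3)),
          one_smul]
      simp only [hX, hY, hZ, h5, map_smul, LinearMap.smul_apply, smul_eq_mul]
      linear_combination u ^ (m + 2) * hc'
    have hYlim : ∀ v : ℂ, 0 < ‖v‖ → ‖v‖ < δ → ∃ y, Filter.Tendsto (Y v) (𝓝[≠] 0) (𝓝 y) := by
      intro v h0 hv
      have h1 := tendsto_bilin (bilin1323 α β γ) (hshift v h0 hv)
        (fun φ => tendsto_const_nhds (x := φ (r q v)) (f := 𝓝[≠] (0 : ℂ)))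
      have h2 : ∀ i, ∃ y, Filter.Tendsto (fun u => γ (contract α (TensorProduct.comm ℂ g g
          (partialDeriv r ((Module.finBasis ℂ H).coord i) q (0 - (u + v)))))) (𝓝[≠] 0) (𝓝 y) := by
        intro i
        have h3 := ((hreg' (-v) (by rwa [norm_neg]) (by rwa [norm_neg])).analyticAt_partialDeriv
          ((Module.finBasis ℂ H).coord i) (γ ∘ₗ contract α ∘ₗ
            (TensorProduct.comm ℂ g g).toLinearMap)).continuousAt
        have h4 : Filter.Tendsto (fun u : ℂ => 0 - (u + v)) (𝓝[≠] 0) (𝓝 (-v)) := by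
          have : Filter.Tendsto (fun u : ℂ => 0 - (u + v)) (𝓝 0) (𝓝 (0 - (0 + v))) :=
            (Continuous.tendsto (by fun_prop) 0)
          rw [zero_add, zero_sub] at this
          exact this.mono_left nhdsWithin_le_nhds
        exact ⟨_, h3.tendsto.comp h4⟩
      choose y hy using h2
      exact ⟨_, (tendsto_finsetSum _ fun i _ =>
        tendsto_const_nhds.add ((hy i).const_mul _)).add h1⟩
    -- X cancels between two values of v, so the difference is O(u^(m+2)). Since m + 2 ≥ 2 this is
    -- o(u): both the value at u = 0 and the first-order coefficient of Z do not depend on v.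
    have hdiff : ∀ v : ℂ, 0 < ‖v‖ → ‖v‖ < δ → ∀ v' : ℂ, 0 < ‖v'‖ → ‖v'‖ < δ →
        Filter.Tendsto (fun u => u⁻¹ * (Z v u - Z v' u)) (𝓝[≠] 0) (𝓝 0) := by
      intro v h0 hv v' h0' hv'
      obtain ⟨y, hy⟩ := hYlim v h0 hv
      obtain ⟨y', hy'⟩ := hYlim v' h0' hv'
      have h1 : Filter.Tendsto (fun u : ℂ => u ^ (m + 1) * (Y v' u - Y v u)) (𝓝[≠] 0) (𝓝 0) := by
        have h2 : Filter.Tendsto (fun u : ℂ => u ^ (m + 1)) (𝓝[≠] 0) (𝓝 0) := by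
          have : Filter.Tendsto (fun u : ℂ => u ^ (m + 1)) (𝓝 0) (𝓝 (0 ^ (m + 1))) :=
            (Continuous.tendsto (by fun_prop) 0)
          rw [zero_pow (Nat.succ_ne_zero m)] at this
          exact this.mono_left nhdsWithin_le_nhds
        simpa using h2.mul (hy'.sub hy)
      refine h1.congr' ?_
      filter_upwards [heq v h0 hv, heq v' h0' hv', self_mem_nhdsWithin] with u e1 e2 hu
      have hu' : u ≠ 0 := hu
      have : Z v u - Z v' u = u ^ (m + 2) * (Y v' u - Y v u) := by linear_combination e1 - e2
      rw [this, pow_succ u (m + 1)]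
      field_simp
    have hZlim : ∀ v : ℂ, 0 < ‖v‖ → ‖v‖ < δ → Filter.Tendsto (Z v) (𝓝[≠] 0)
        (𝓝 ((B₁ A + B₂ A) (r q v))) := fun v h0 hv =>
      (tendsto_bilin B₁ hGlim (hshift v h0 hv)).add
        (tendsto_bilin B₂ hGlim fun φ => tendsto_const_nhds)
    have hid0 : Filter.Tendsto (fun u : ℂ => u) (𝓝[≠] 0) (𝓝 0) :=
      Filter.tendsto_id.mono_left nhdsWithin_le_nhds
    have hconst : ∀ v : ℂ, 0 < ‖v‖ → ‖v‖ < δ → ∀ v' : ℂ, 0 < ‖v'‖ → ‖v'‖ < δ →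
        (B₁ A + B₂ A) (r q v) = (B₁ A + B₂ A) (r q v') := by
      intro v h0 hv v' h0' hv'
      have h1 := hid0.mul (hdiff v h0 hv v' h0' hv')
      rw [zero_mul] at h1
      have h2 := (hZlim v h0 hv).sub (hZlim v' h0' hv')
      rw [← sub_eq_zero]
      refine tendsto_nhds_unique h2 (h1.congr' ?_)
      filter_upwards [self_mem_nhdsWithin] with u hu
      have hu' : u ≠ 0 := hu
      field_simp
    set v₀ : ℂ := ((δ / 2 : ℝ) : ℂ) with hv₀
    have hv₀n : ‖v₀‖ = δ / 2 := by
      rw [hv₀, Complex.norm_real, Real.norm_of_nonneg (by positivity)]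
    have hv₀0 : 0 < ‖v₀‖ := by rw [hv₀n]; positivity
    have hv₀δ : ‖v₀‖ < δ := by rw [hv₀n]; linarith
    refine ⟨?_, ?_⟩
    -- A function constant in v has residue 0, while the residue of r is Ω.
    · have hres := hr.residue q hq (B₁ A + B₂ A)
      have hsmall : ∀ᶠ ε : ℝ in 𝓝[>] 0, 0 < ε ∧ ε < δ := by
        filter_upwards [self_mem_nhdsWithin, nhdsWithin_le_nhds (Iio_mem_nhds hδ0)] with ε h1 h2
        exact ⟨h1, h2⟩
      obtain ⟨ε, h1, hε0, hεδ⟩ := (hres.and hsmall).exists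
      have h2 : (∮ z in C(0, ε), (B₁ A + B₂ A) (r q z)) = 0 := by
        rw [circleIntegral.integral_congr (g := fun _ => (B₁ A + B₂ A) (r q v₀)) hε0.le]
        · exact Complex.circleIntegral_eq_zero_of_differentiable_on_off_countable hε0.le
            Set.countable_empty continuousOn_const (fun z _ => differentiableAt_const _)
        · intro z hz
          have hz' : ‖z‖ = ε := by simpa using hz
          exact hconst z (by rw [hz']; exact hε0) (by rw [hz']; exact hεδ) v₀ hv₀0 hv₀δ
      rw [h2, mul_zero] at h1
      exact h1.symm
    · -- the next order
      set θ := B₁ A with hθ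
      -- This is the first-order coefficient of Z v u in u, with G u = A + u G₁(u) and r(u + v)
      -- expanded at v.
      set e : ℂ → ℂ := fun v => deriv (fun w => θ (r q w)) v + (B₁ (G₁ 0) + B₂ (G₁ 0)) (r q v)
        with he
      have helim : ∀ v : ℂ, 0 < ‖v‖ → ‖v‖ < δ → Filter.Tendsto
          (fun u => u⁻¹ * (Z v u - (B₁ A + B₂ A) (r q v))) (𝓝[≠] 0) (𝓝 (e v)) := by
        intro v h0 hv
        have h1 := ((hreg' v h0 hv).analyticAt θ).differentiableAt.hasDerivAt
        rw [hasDerivAt_iff_tendsto_slope_zero] at h1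
        have h2 := h1.add ((tendsto_bilin B₁ hG₁lim (hshift v h0 hv)).add
          (tendsto_bilin B₂ hG₁lim fun φ => tendsto_const_nhds (x := φ (r q v))))
        refine h2.congr' ?_
        filter_upwards [self_mem_nhdsWithin] with u hu
        have hu' : u ≠ 0 := hu
        simp only [hZ, hGG₁ u, map_add, map_smul, LinearMap.add_apply, LinearMap.smul_apply,
          smul_eq_mul, add_comm v u, hθ]
        field_simp
        ring
      have heconst : ∀ v : ℂ, 0 < ‖v‖ → ‖v‖ < δ → e v = e v₀ := by
        intro v h0 hv
        have h1 := (helim v h0 hv).sub (helim v₀ hv₀0 hv₀δ)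
        rw [← sub_eq_zero]
        refine tendsto_nhds_unique h1 ((hdiff v h0 hv v₀ hv₀0 hv₀δ).congr fun u => ?_)
        rw [hconst v h0 hv v₀ hv₀0 hv₀δ]
        ring
      have hθG : AnalyticAt ℂ (fun z => θ (G z)) 0 := hG θ
      have hlim1 : Filter.Tendsto (fun v : ℂ => v ^ (m + 3) * e v) (𝓝[≠] 0) (𝓝 0) := by
        have h2 : Filter.Tendsto (fun v : ℂ => v ^ (m + 3) * e v₀) (𝓝[≠] 0) (𝓝 0) := by
          have : Filter.Tendsto (fun u : ℂ => u ^ (m + 3) * e v₀) (𝓝 0)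
            (𝓝 (0 ^ (m + 3) * e v₀)) := (Continuous.tendsto (by fun_prop) 0)
          rw [zero_pow (by omega), zero_mul] at this
          exact this.mono_left nhdsWithin_le_nhds
        refine h2.congr' ?_
        filter_upwards [eventually_punctured hδ0] with v ⟨h0, hv⟩
        rw [heconst v h0 hv]
      -- Only the derivative of θ(r) reaches pole order m + 3 in v, with coefficient -(m+2) θ(A).
      -- Since e is constant, that coefficient is zero, which is [A¹², A¹³] = 0.
      have hlim2 : Filter.Tendsto (fun v : ℂ => v ^ (m + 3) * e v) (𝓝[≠] 0)
          (𝓝 (-(m + 2 : ℕ) * θ A)) := by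
        have h3 : Filter.Tendsto (fun v : ℂ => -(m + 2 : ℕ) * θ (G v) +
            v * deriv (fun z => θ (G z)) v + v * (B₁ (G₁ 0) + B₂ (G₁ 0)) (G v)) (𝓝[≠] 0)
            (𝓝 (-(m + 2 : ℕ) * θ A + 0 * deriv (fun z => θ (G z)) 0 +
              0 * (B₁ (G₁ 0) + B₂ (G₁ 0)) A)) :=
          (((hGlim θ).const_mul _).add (hid0.mul (hθG.deriv.continuousAt.tendsto.mono_left
            nhdsWithin_le_nhds))).add (hid0.mul (hGlim _))
        rw [zero_mul, zero_mul, add_zero, add_zero] at h3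
        refine h3.congr' ?_
        filter_upwards [eventually_punctured hδ0,
          nhdsWithin_le_nhds hθG.eventually_analyticAt] with v ⟨h0, hv⟩ hGv
        have hv0 : v ≠ 0 := norm_pos_iff.mp h0
        have h4 : HasDerivAt (fun w => (w ^ (m + 2))⁻¹ * θ (G w))
            (-((m + 2 : ℕ) * v ^ (m + 1)) / (v ^ (m + 2)) ^ 2 * θ (G v) +
              (v ^ (m + 2))⁻¹ * deriv (fun z => θ (G z)) v) v :=
          ((hasDerivAt_pow (m + 2) v).fun_inv (pow_ne_zero _ hv0)).mul
            hGv.differentiableAt.hasDerivAt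
        have h5 : deriv (fun w => θ (r q w)) v = _ := (h4.congr_of_eventuallyEq (by
          have h6 : ∀ᶠ w : ℂ in 𝓝 v, 0 < ‖w‖ ∧ ‖w‖ < δ := by
            have hc : Filter.Tendsto (fun w : ℂ => ‖w‖) (𝓝 v) (𝓝 ‖v‖) := continuous_norm.tendsto v
            exact (hc.eventually_const_lt h0).and (hc.eventually_lt_const hv)
          filter_upwards [h6] with w ⟨hw0, hw⟩
          rw [hrG' w hw0 hw, map_smul, smul_eq_mul])).deriv
        simp only [he, h5, hrG' v h0 hv, map_smul, smul_eq_mul]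
        field_simp
        ring
      have := tendsto_nhds_unique hlim1 hlim2
      have h7 : θ A = 0 := by
        have h8 : (-((m + 2 : ℕ) : ℂ)) ≠ 0 := neg_ne_zero.mpr (Nat.cast_ne_zero.mpr (by omega))
        exact (mul_eq_zero.mp this.symm).resolve_left h8
      exact h7
  exact eq_zero_of_invariant_of_commuting (fun α β γ => (main α β γ).1) fun α β γ => (main α β γ).2

end SimplePole

/-! ### Taylor coefficients as Cauchy integrals depending on a parameter -/

theorem HasTaylor.coeff_eq_circleIntegral {f : ℂ → ℂ} {c : ℕ → ℂ} {δ s : ℝ} (hf : HasTaylor f c δ)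
    (hs : 0 < s) (hsδ : s < δ) (n : ℕ) :
    c n = (2 * Real.pi * Complex.I)⁻¹ * ∮ w in C(0, s), f w * (w ^ (n + 1))⁻¹ := by
  have h : HasLaurent (fun w => f w * (w ^ (n + 1))⁻¹)
      (fun k : ℤ => if k + (n + 1) < 0 then 0 else c (k + (n + 1)).toNat) δ := by
    refine HasLaurent.of_taylor (P := f) (M := n + 1) (fun k hk => ?_) ?_ ?_
    · rw [if_pos (by push_cast at hk; omega)]
    · convert hf using 2 with k
      rw [if_neg (by push_cast; omega)]
      congr 1
      push_cast; omega
    · intro z h0 _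
      have : z ≠ 0 := norm_pos_iff.mp h0
      field_simp
  rw [h.circleIntegral_eq hs hsδ, if_neg (by omega),
    inv_mul_cancel_left₀ Complex.two_pi_I_ne_zero]
  congr 1
  omega

/-- Taylor coefficients of an analytic family depend differentiably on the parameter, and their
derivatives are the Taylor coefficients of the derivative. -/
theorem hasFDerivAt_taylorCoeff {E : Type*} [NormedAddCommGroup E] [NormedSpace ℂ E]
    {F : E × ℂ → ℂ} {q : E} {a : E → ℕ → ℂ} {s s' : ℝ} {S : Set ℂ} (hs : 0 < s) (hs' : s < s')
    (hsphere : Metric.sphere 0 s ⊆ S) (hF : ∀ x ∈ S, ‖x‖ < s' → AnalyticAt ℂ F (q, x))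
    (ha : ∀ᶠ p in 𝓝 q, ∃ f, HasTaylor f (a p) s' ∧ ∀ x ∈ S, ‖x‖ < s' → F (p, x) = f x) :
    ∃ L : ℕ → E →L[ℂ] ℂ, (∀ n, HasFDerivAt (fun p => a p n) (L n) q) ∧
      ∀ x ∈ S, ‖x‖ < s → ∀ v, HasSum (fun n => L n v * x ^ n) (fderiv ℂ F (q, x) (v, 0)) := by
  have hsph : ∀ w ∈ Metric.sphere (0 : ℂ) s, ‖w‖ = s := fun w hw => by simpa using hw
  have hsph0 : ∀ w ∈ Metric.sphere (0 : ℂ) s, w ≠ 0 := fun w hw => by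
    rw [← norm_pos_iff, hsph w hw]; exact hs
  have hFs : ∀ w ∈ Metric.sphere (0 : ℂ) s, AnalyticAt ℂ F (q, w) := fun w hw =>
    hF w (hsphere hw) (by rw [hsph w hw]; exact hs')
  have hpow : ∀ n : ℕ, ContinuousOn (fun w : ℂ => (w ^ (n + 1))⁻¹) (Metric.sphere 0 s) := fun n =>
    ContinuousOn.inv₀ (by fun_prop) fun w hw => pow_ne_zero _ (hsph0 w hw)
  have hker : ∀ x : ℂ, ‖x‖ < s → ContinuousOn (fun w : ℂ => (w - x)⁻¹) (Metric.sphere 0 s) :=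
    fun x hx => ContinuousOn.inv₀ (by fun_prop) fun w hw h => by
      have h1 := hsph w hw
      rw [sub_eq_zero.mp h] at h1
      linarith
  choose L₀ hL₀ hL₀' using fun n => hasFDerivAt_circleIntegral hs.le hFs (hpow n)
  set κ : ℂ := (2 * Real.pi * Complex.I)⁻¹ with hκ
  refine ⟨fun n => κ • L₀ n, fun n => ?_, fun x hxS hx v => ?_⟩
  · refine ((hL₀ n).const_mul κ).congr_of_eventuallyEq ?_
    filter_upwards [ha] with p ⟨f, hf, hfF⟩
    rw [hf.coeff_eq_circleIntegral hs hs' n]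
    congr 1
    refine circleIntegral.integral_congr hs.le fun w hw => ?_
    rw [hfF w (hsphere hw) (by rw [hsph w hw]; exact hs')]
  · obtain ⟨M, hM, hM'⟩ := hasFDerivAt_circleIntegral hs.le hFs (hker x hx)
    have h1 : HasFDerivAt (fun p => F (p, x))
        ((fderiv ℂ F (q, x)).comp (ContinuousLinearMap.inl ℂ E ℂ)) q :=
      (hF x hxS (hx.trans hs')).differentiableAt.hasFDerivAt.comp q (hasFDerivAt_prodMk_left q x)
    -- Near q, F(p, x) equals its Cauchy integral over the circle of radius s, so its derivative in
    -- p is the Cauchy integral of the derivative.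
    have h2 : HasFDerivAt (fun p => F (p, x)) (κ • M) q := by
      refine (hM.const_mul κ).congr_of_eventuallyEq ?_
      filter_upwards [ha] with p ⟨f, hf, hfF⟩
      rw [hfF x hxS (hx.trans hs')]
      have hd : DifferentiableOn ℂ f (Metric.closedBall 0 s) :=
        hf.differentiableOn.mono (Metric.closedBall_subset_ball hs')
      have h3 := (hd.mono Metric.closure_ball_subset_closedBall).diffContOnCl
        |>.two_pi_i_inv_smul_circleIntegral_sub_inv_smul (w := x) (by simpa using hx)
      rw [← h3, smul_eq_mul]
      congr 1
      refine circleIntegral.integral_congr hs.le fun w hw => ?_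
      simp only [smul_eq_mul]
      rw [hfF w (hsphere hw) (by rw [hsph w hw]; exact hs'), mul_comm]
    have h3 : fderiv ℂ F (q, x) (v, 0) = κ * M v := by
      have := congrArg (fun T : E →L[ℂ] ℂ => T v) (h1.unique h2)
      simpa using this
    rw [h3, hM' v]
    have hcont : ContinuousOn (fun w => fderiv ℂ F (q, w) (v, 0)) (Metric.sphere 0 s) :=
      fun w hw => by
        have h4 : ContinuousAt (fun w => fderiv ℂ F (q, w)) w :=
          (hFs w hw).fderiv.continuousAt.comp (f := fun w : ℂ => (q, w)) (by fun_prop)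
        exact (h4.clm_apply continuousAt_const).continuousWithinAt
    -- Expanding the Cauchy kernel in powers of x shows that the coefficients are the derivatives of
    -- the Taylor coefficients.
    have h5 := hasSum_two_pi_I_cauchyPowerSeries_integral (w := x)
      (hcont.circleIntegrable hs.le) hx
    have h6 := h5.mul_left κ
    simp only [sub_zero, zero_add, smul_eq_mul] at h6
    have h7 : (∮ w in C(0, s), fderiv ℂ F (q, w) (v, 0) * (w - x)⁻¹) =
        ∮ w in C(0, s), (w - x)⁻¹ * fderiv ℂ F (q, w) (v, 0) := by simp only [mul_comm]
    rw [h7]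
    refine (hasSum_congr fun n => ?_).mp h6
    rw [smul_apply, hL₀', smul_eq_mul, mul_assoc]
    congr 1
    rw [mul_comm _ (x ^ n), ← circleIntegral.integral_const_mul]
    refine circleIntegral.integral_congr hs.le fun w hw => ?_
    have := hsph0 w hw
    rw [div_pow]
    field_simp
    ring

/-! ### The regular part r(q, x) - Ω/x and its dependence on q -/

section RegularPart

variable {g : Type*} [LieRing g] [LieAlgebra ℂ g] [FiniteDimensional ℂ g]
  {H : LieSubalgebra ℂ g} {r : Module.Dual ℂ H → ℂ → g ⊗[ℂ] g} {q : Module.Dual ℂ H}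

/-- If the denominator d is nonzero at some (q', z'), then d(q', ·) does not vanish identically and
factors as z^M times a unit. Such q' occur arbitrarily close to q, but q itself may be excluded, as
d may vanish on the whole line above it. -/
theorem IsMeromorphic.frequently_pole (hr : IsMeromorphic r) (q : Module.Dual ℂ H) :
    ∃ᶠ q' in 𝓝 q, ∃ (M : ℕ) (G : ℂ → g ⊗[ℂ] g),
      (∀ φ : Module.Dual ℂ (g ⊗[ℂ] g), AnalyticAt ℂ (fun z => φ (G z)) 0) ∧
      ∀ᶠ z in 𝓝[≠] 0, r q' z = (z ^ M)⁻¹ • G z := by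
  obtain ⟨f, d, hf, hd, hfreq, hev⟩ := hr (q, 0)
  have hf' : ∀ᶠ p in 𝓝 (q, (0 : ℂ)), ∀ φ : Module.Dual ℂ (g ⊗[ℂ] g),
      AnalyticAt ℂ (fun p => φ (f p)) p := by
    have h1 : ∀ᶠ p in 𝓝 (q, (0 : ℂ)), ∀ i, AnalyticAt ℂ (fun p =>
        (Module.finBasis ℂ (g ⊗[ℂ] g)).coord i (f p)) p :=
      Filter.eventually_all.mpr fun i => (hf _).eventually_analyticAt
    filter_upwards [h1] with p hp φ
    simp only [fun p => dual_eq_sum φ (f p)]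
    exact Finset.analyticAt_fun_sum _ fun i _ => analyticAt_const.mul (hp i)
  obtain ⟨ε, hε, hball⟩ := Metric.eventually_nhds_iff_ball.mp
    ((hf'.and hd.eventually_analyticAt).and hev)
  have hmem : ∀ (q' : Module.Dual ℂ H) (z : ℂ), dist q' q < ε → ‖z‖ < ε →
      (q', z) ∈ Metric.ball (q, (0 : ℂ)) ε := fun q' z h1 h2 => by
    rw [Metric.mem_ball, Prod.dist_eq]
    exact max_lt h1 (by simpa using h2)
  have hfreq' := (hfreq.and_eventually (Metric.ball_mem_nhds (q, (0 : ℂ)) hε))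
  refine (continuous_fst.tendsto (q, (0 : ℂ))).frequently (hfreq'.mono ?_)
  rintro ⟨q', z'⟩ ⟨hne, hp⟩
  rw [Prod.dist_eq, max_lt_iff] at hp
  have hq' : dist q' q < ε := hp.1
  have hz' : ‖z'‖ < ε := by simpa using hp.2
  have hline : ∀ z : ℂ, AnalyticAt ℂ (fun z : ℂ => (q', z)) z := fun z =>
    analyticAt_const.prod analyticAt_id
  have hD : AnalyticOnNhd ℂ (fun z => d (q', z)) (Metric.ball 0 ε) := fun z hz =>
    (hball _ (hmem q' z hq' (by simpa using hz))).1.2.comp (hline z)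
  have h0 : (0 : ℂ) ∈ Metric.ball (0 : ℂ) ε := Metric.mem_ball_self hε
  have hnz : ¬ ∀ᶠ z in 𝓝 (0 : ℂ), d (q', z) = 0 := fun hzero => by
    have := hD.eqOn_zero_of_preconnected_of_eventuallyEq_zero
      (convex_ball (0 : ℂ) ε).isPreconnected h0 hzero (by simpa using hz' : z' ∈ _)
    exact hne this
  obtain ⟨M, u, hu, hu0, hdu⟩ := (hD 0 h0).exists_eventuallyEq_pow_smul_nonzero_iff.mpr hnz
  refine ⟨M, fun z => (u z)⁻¹ • f (q', z), fun φ => ?_, ?_⟩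
  · simp only [map_smul, smul_eq_mul]
    exact (hu.inv hu0).mul (((hball _ (hmem q' 0 hq' (by simpa using hε))).1.1 φ).comp
      (f := fun z : ℂ => (q', z)) (hline 0))
  · filter_upwards [nhdsWithin_le_nhds hdu, nhdsWithin_le_nhds (hu.continuousAt.eventually_ne hu0),
      eventually_punctured hε] with z h1 h2 ⟨h3, h4⟩
    have hz0 : z ≠ 0 := norm_pos_iff.mp h3
    rw [sub_zero, smul_eq_mul] at h1
    have := (hball _ (hmem q' z hq' h4)).2 (by
      rw [h1]; exact mul_ne_zero (pow_ne_zero _ hz0) h2)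
    simp only at this
    rw [this, h1, smul_smul, mul_inv]

variable [LieAlgebra.IsSimple ℂ g]

/-- The order of the pole is lowered one step at a time, as leading coefficients of order at least
two vanish. At order one the residue condition identifies the coefficient with Ω. -/
theorem IsDynamicalRMatrix.simple_pole_of_pole (hr : IsDynamicalRMatrix r)
    (hq : q ∈ regularSet r) {M : ℕ} {G : ℂ → g ⊗[ℂ] g}
    (hG : ∀ φ : Module.Dual ℂ (g ⊗[ℂ] g), AnalyticAt ℂ (fun z => φ (G z)) 0)
    (hrG : ∀ᶠ z in 𝓝[≠] 0, r q z = (z ^ M)⁻¹ • G z) :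
    ∃ K : ℂ → g ⊗[ℂ] g, (∀ φ : Module.Dual ℂ (g ⊗[ℂ] g), AnalyticAt ℂ (fun z => φ (K z)) 0) ∧
      ∀ᶠ z in 𝓝[≠] 0, r q z = z⁻¹ • casimir g + K z := by
  induction M generalizing G with
  | zero =>
    refine ⟨fun z => G z - z⁻¹ • casimir g, ?_, by filter_upwards [hrG] with z hz; simp [hz]⟩
    -- the residue vanishes, hence so does the Casimir element
    have hc : ∀ φ : Module.Dual ℂ (g ⊗[ℂ] g), φ (casimir g) = 0 := fun φ => by
      obtain ⟨c, ε, hε, hT⟩ := HasTaylor.of_analyticAt (hG φ)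
      have hres := hr.residue q hq φ
      rw [eventually_nhdsWithin_iff, Metric.eventually_nhds_iff] at hrG
      obtain ⟨ε', hε', hrG⟩ := hrG
      have hsmall : ∀ᶠ s : ℝ in 𝓝[>] 0, 0 < s ∧ s < min ε ε' := by
        filter_upwards [self_mem_nhdsWithin,
          nhdsWithin_le_nhds (Iio_mem_nhds (lt_min hε hε'))] with s h1 h2
        exact ⟨h1, h2⟩
      obtain ⟨s, h1, hs0, hs⟩ := (hres.and hsmall).exists
      rw [← h1, circleIntegral.integral_congr (g := fun z => φ (G z)) hs0.le,
        Complex.circleIntegral_eq_zero_of_differentiable_on_off_countable hs0.le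
            Set.countable_empty (hT.differentiableOn.continuousOn.mono
              (Metric.closedBall_subset_ball (hs.trans_le (min_le_left _ _))))
            (fun z hz => (hT.analyticAt (by
              have : ‖z‖ < s := by simpa using hz.1
              exact this.trans (hs.trans_le (min_le_left _ _)))).differentiableAt), mul_zero]
      intro z hz
      have hz' : ‖z‖ = s := by simpa using hz
      have := hrG (y := z) (by
        rw [dist_zero_right, hz']; exact hs.trans_le (min_le_right _ _))
        (norm_pos_iff.mp (by rw [hz']; exact hs0))
      simp [this]
    have : casimir g = 0 := eq_of_forall_dual fun φ => by rw [hc, map_zero]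
    simpa [this] using hG
  | succ M ih =>
    obtain ⟨K, hK, hGK⟩ := exists_factor_zero hG
    cases M with
    | zero =>
      have hrK : ∀ᶠ z in 𝓝[≠] 0, r q z = z⁻¹ • G 0 + K z := by
        filter_upwards [hrG, self_mem_nhdsWithin] with z hz hz0
        have hz0' : z ≠ 0 := hz0
        rw [hz, hGK z, smul_add, smul_smul, zero_add, pow_one, inv_mul_cancel₀ hz0', one_smul]
      refine ⟨K, hK, ?_⟩
      have hres : G 0 = casimir g := eq_of_forall_dual fun φ => by
        obtain ⟨c, ε, hε, hT⟩ := HasTaylor.of_analyticAt (hG φ)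
        have hres := hr.residue q hq φ
        rw [eventually_nhdsWithin_iff, Metric.eventually_nhds_iff] at hrG
        obtain ⟨ε', hε', hrG⟩ := hrG
        have hsmall : ∀ᶠ s : ℝ in 𝓝[>] 0, 0 < s ∧ s < min ε ε' := by
          filter_upwards [self_mem_nhdsWithin,
            nhdsWithin_le_nhds (Iio_mem_nhds (lt_min hε hε'))] with s h1 h2
          exact ⟨h1, h2⟩
        obtain ⟨s, h1, hs0, hs⟩ := (hres.and hsmall).exists
        rw [← h1, hT.apply_zero hε,
          hT.coeff_eq_circleIntegral hs0 (hs.trans_le (min_le_left _ _)) 0]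
        congr 1
        refine circleIntegral.integral_congr hs0.le fun z hz => ?_
        have hz' : ‖z‖ = s := by simpa using hz
        have := hrG (y := z) (by
          rw [dist_zero_right, hz']; exact hs.trans_le (min_le_right _ _))
          (norm_pos_iff.mp (by rw [hz']; exact hs0))
        simp [this, mul_comm]
      rw [hres] at hrK
      exact hrK
    | succ M =>
      have h0 := hr.leading_coeff_eq_zero hq hG hrG
      refine ih hK ?_
      filter_upwards [hrG, self_mem_nhdsWithin] with z hz hz0
      have hz0' : z ≠ 0 := hz0
      rw [hz, hGK z, h0, zero_add, smul_smul]
      congr 1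
      rw [pow_succ z (M + 1)]
      field_simp

/-- The sequence `a` consists of the Taylor coefficients of `r(q, x) - Ω / x` at `x = 0`. -/
def IsRegularPart (r : Module.Dual ℂ H → ℂ → g ⊗[ℂ] g) (q : Module.Dual ℂ H)
    (a : ℕ → g ⊗[ℂ] g) (ρ : ℝ) : Prop :=
  ∀ φ : Module.Dual ℂ (g ⊗[ℂ] g), ∃ h, HasTaylor h (fun k => φ (a k)) ρ ∧
    ∀ x, 0 < ‖x‖ → ‖x‖ < ρ → φ (r q x) = φ (casimir g) * x⁻¹ + h x

theorem IsRegularPart.unique {a b : ℕ → g ⊗[ℂ] g} {ρ ρ' : ℝ} (ha : IsRegularPart r q a ρ)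
    (hρ : 0 < ρ) (hb : IsRegularPart r q b ρ') (hρ' : 0 < ρ') : a = b := by
  ext k
  refine eq_of_forall_dual fun φ => ?_
  obtain ⟨h, h1, h2⟩ := ha φ
  obtain ⟨h', h1', h2'⟩ := hb φ
  refine congrFun (h1.unique_punctured hρ h1' hρ' ?_) k
  filter_upwards [eventually_punctured hρ, eventually_punctured hρ'] with x ⟨e1, e2⟩ ⟨_, e3⟩
  have := h2 x e1 e2
  rw [h2' x e1 e3] at this
  exact (add_left_cancel this).symm

/-- Filling in the removable singularity at 0 gives a function holomorphic in the whole pole-free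
disc, so the Taylor series converges on all of it. -/
theorem exists_isRegularPart_of_analytic {ρ : ℝ} (hq : NoPole r q ρ)
    (h : ∀ φ : Module.Dual ℂ (g ⊗[ℂ] g), ∃ K : ℂ → ℂ, AnalyticAt ℂ K 0 ∧
      ∀ᶠ z in 𝓝[≠] 0, φ (r q z) = φ (casimir g) * z⁻¹ + K z) :
    ∃ a, IsRegularPart r q a ρ := by
  have key : ∀ φ : Module.Dual ℂ (g ⊗[ℂ] g), ∃ (c : ℕ → ℂ) (h : ℂ → ℂ), HasTaylor h c ρ ∧
      ∀ x, 0 < ‖x‖ → ‖x‖ < ρ → φ (r q x) = φ (casimir g) * x⁻¹ + h x := fun φ => by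
    obtain ⟨K, hK, hrK⟩ := h φ
    set f : ℂ → ℂ := Function.update (fun x => φ (r q x) - φ (casimir g) * x⁻¹) 0 (K 0) with hf
    have hd : DifferentiableOn ℂ f (Metric.ball 0 ρ) := fun x hx => by
      refine DifferentiableAt.differentiableWithinAt ?_
      obtain rfl | hx0 := eq_or_ne x 0
      · refine hK.differentiableAt.congr_of_eventuallyEq ?_
        rw [eventually_nhdsWithin_iff] at hrK
        filter_upwards [hrK] with z hz
        obtain rfl | hz0 := eq_or_ne z 0
        · rw [hf, Function.update_self]
        · rw [hf, Function.update_of_ne hz0, hz hz0]; ring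
      · have h1 := ((hq.2 x (norm_pos_iff.mpr hx0) (by simpa using hx)).analyticAt φ
          ).differentiableAt
        have h2 : DifferentiableAt ℂ (fun x => φ (r q x) - φ (casimir g) * x⁻¹) x :=
          h1.sub ((differentiableAt_inv hx0).const_mul _)
        refine h2.congr_of_eventuallyEq ?_
        filter_upwards [isOpen_ne.mem_nhds hx0] with z hz
        rw [hf, Function.update_of_ne hz]
    obtain ⟨c, hc⟩ := HasTaylor.of_differentiableOn hd
    refine ⟨c, f, hc, fun x hx0 _ => ?_⟩
    rw [hf, Function.update_of_ne (norm_pos_iff.mp hx0)]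
    ring
  choose c f hc hf using key
  let b := Module.finBasis ℂ (g ⊗[ℂ] g)
  refine ⟨fun k => ∑ i, c (b.coord i) k • b i, fun φ =>
    ⟨fun x => ∑ i, φ (b i) * f (b.coord i) x, ?_, fun x h0 hx => ?_⟩⟩
  · have := HasTaylor.sum (s := Finset.univ) fun i _ => (hc (b.coord i)).const_mul (φ (b i))
    simp only [map_sum, map_smul, smul_eq_mul]
    simpa only [mul_comm] using this
  · rw [dual_eq_sum φ (r q x), dual_eq_sum φ (casimir g), Finset.sum_mul,
      ← Finset.sum_add_distrib]
    refine Finset.sum_congr rfl fun i _ => ?_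
    rw [hf (b.coord i) x h0 hx]
    ring

/-- For parameters with a pole of finite order, r minus Ω/x is the Cauchy integral of r over a fixed
circle. Both sides are continuous in the parameter, so the identity extends to q, which is a limit
of such parameters. -/
theorem IsDynamicalRMatrix.exists_isRegularPart (hr : IsDynamicalRMatrix r)
    (hq : q ∈ regularSet r) {ρ : ℝ} (hρ : NoPole r q ρ) : ∃ a, IsRegularPart r q a ρ := by
  obtain ⟨r₀, hev⟩ := hq
  have hr₀ : 0 < r₀ := hev.self_of_nhds.1
  have hreg : ∀ᶠ q' in 𝓝 q, q' ∈ regularSet r :=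
    hev.eventually_nhds.mono fun q' h => ⟨r₀, h⟩
  set s := r₀ / 2 with hs
  have hs0 : 0 < s := by positivity
  have hsr : s < r₀ := by rw [hs]; linarith
  have hsph : ∀ w ∈ Metric.sphere (0 : ℂ) s, ‖w‖ = s := fun w hw => by simpa using hw
  have hgood := (hr.meromorphic.frequently_pole q).and_eventually (hreg.and hev)
  set κ : ℂ := (2 * Real.pi * Complex.I)⁻¹ with hκ
  refine exists_isRegularPart_of_analytic hρ fun φ =>
    ⟨fun x => κ * ∮ w in C(0, s), φ (r q w) * (w - x)⁻¹, ?_, ?_⟩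
  · have hc : ContinuousOn (fun w => φ (r q w)) (Metric.sphere 0 s) := fun w hw =>
      ((hev.self_of_nhds.2 w (by rw [hsph w hw]; exact hs0)
        (by rw [hsph w hw]; exact hsr)).analyticAt φ).continuousAt.continuousWithinAt
    have h1 := hasFPowerSeriesOn_cauchy_integral (R := ⟨s, hs0.le⟩)
      (hc.circleIntegrable hs0.le) (by exact hs0)
    refine h1.analyticAt.congr (Filter.Eventually.of_forall fun x => ?_)
    simp only [smul_eq_mul, hκ, mul_comm]
    rfl
  · filter_upwards [eventually_punctured hs0] with x ⟨hx0, hx⟩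
    have hx0' : x ≠ 0 := norm_pos_iff.mp hx0
    have hker : ContinuousOn (fun w : ℂ => (w - x)⁻¹) (Metric.sphere 0 s) :=
      ContinuousOn.inv₀ (by fun_prop) fun w hw h => by
        have h1 := hsph w hw
        rw [sub_eq_zero.mp h] at h1
        linarith
    obtain ⟨L, hL, -⟩ := hasFDerivAt_circleIntegral (F := fun p : Module.Dual ℂ H × ℂ =>
      φ (r p.1 p.2)) (q := q) hs0.le (fun w hw => hev.self_of_nhds.2 w
        (by rw [hsph w hw]; exact hs0) (by rw [hsph w hw]; exact hsr) φ) hker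
    have hcont1 : ContinuousAt (fun p : Module.Dual ℂ H =>
        φ (casimir g) * x⁻¹ + κ * ∮ w in C(0, s), φ (r p w) * (w - x)⁻¹) q :=
      continuousAt_const.add (continuousAt_const.mul hL.continuousAt)
    have hcont2 : ContinuousAt (fun p : Module.Dual ℂ H => φ (r p x)) q :=
      (hev.self_of_nhds.2 x hx0 (hx.trans hsr) φ).continuousAt.comp
        (f := fun p : Module.Dual ℂ H => (p, x)) (by fun_prop)
    have heq : ∃ᶠ p in 𝓝 q, φ (r p x) =
        φ (casimir g) * x⁻¹ + κ * ∮ w in C(0, s), φ (r p w) * (w - x)⁻¹ := by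
      refine hgood.mono ?_
      rintro p ⟨⟨M, G, hG, hrG⟩, hpreg, hpn⟩
      obtain ⟨K, hK, hrK⟩ := hr.simple_pole_of_pole hpreg hG hrG
      obtain ⟨a, ha⟩ := exists_isRegularPart_of_analytic hpn fun φ => ⟨fun z => φ (K z), hK φ, by
        filter_upwards [hrK] with z hz
        rw [hz, map_add, map_smul, smul_eq_mul, mul_comm]⟩
      obtain ⟨h, hT, hh⟩ := ha φ
      have hd : DifferentiableOn ℂ h (Metric.closedBall 0 s) :=
        hT.differentiableOn.mono (Metric.closedBall_subset_ball hsr)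
      have h3 := (hd.mono Metric.closure_ball_subset_closedBall).diffContOnCl
        |>.two_pi_i_inv_smul_circleIntegral_sub_inv_smul (w := x) (by simpa using hx)
      have hp1 := circleIntegral.integral_sub_inv_of_mem_ball (c := (0 : ℂ)) (R := s) (w := x)
        (by simpa using hx)
      have hp2 := circleIntegral.integral_sub_inv_of_mem_ball (c := (0 : ℂ)) (R := s) (w := 0)
        (by simpa using hs0)
      have hi1 : CircleIntegrable (fun w : ℂ => (w - x)⁻¹) 0 s := hker.circleIntegrable hs0.le
      have hi2 : CircleIntegrable (fun w : ℂ => (w - 0)⁻¹) 0 s := by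
        refine ContinuousOn.circleIntegrable hs0.le (ContinuousOn.inv₀ (by fun_prop) fun w hw h => ?_)
        have h1 := hsph w hw
        rw [sub_eq_zero.mp h, norm_zero] at h1
        linarith
      have hi3 : CircleIntegrable (fun w : ℂ => (w - x)⁻¹ • h w) 0 s :=
        (hker.smul (hd.continuousOn.mono Metric.sphere_subset_closedBall)).circleIntegrable hs0.le
      -- Partial fractions: 1/(w(w - x)) = x⁻¹(1/(w - x) - 1/w), and the two integrals cancel. Hence
      -- the pole term does not contribute to the Cauchy integral.
      have hsplit : (∮ w in C(0, s), φ (r p w) * (w - x)⁻¹) =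
          ∮ w in C(0, s), (φ (casimir g) * x⁻¹ * ((w - x)⁻¹ - (w - 0)⁻¹) + (w - x)⁻¹ • h w) := by
        refine circleIntegral.integral_congr hs0.le fun w hw => ?_
        have hw0 : w ≠ 0 := by rw [← norm_pos_iff, hsph w hw]; exact hs0
        have hwx : w - x ≠ 0 := fun h => by
          have h1 := hsph w hw
          rw [sub_eq_zero.mp h] at h1
          linarith
        rw [hh w (by rw [hsph w hw]; exact hs0) (by rw [hsph w hw]; exact hsr), smul_eq_mul,
          sub_zero]
        field_simp
        ring
      have hi12 : CircleIntegrable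
          (fun w => φ (casimir g) * x⁻¹ * ((w - x)⁻¹ - (w - 0)⁻¹)) 0 s := (hi1.sub hi2).const_smul
      rw [hsplit, circleIntegral.integral_add hi12
        hi3, circleIntegral.integral_const_mul, circleIntegral.integral_sub hi1 hi2, hp1, hp2,
        sub_self, mul_zero, zero_add, ← smul_eq_mul κ, h3, hh x hx0 (hx.trans hsr)]
    -- the identity persists in the limit
    by_contra hne
    have hne' := (hcont2.sub hcont1).eventually_ne (sub_ne_zero.mpr hne)
    exact heq (hne'.mono fun p hp h => hp (sub_eq_zero.mpr h))

open Classical in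
/-- The Taylor coefficients of the regular part `r(q, x) - Ω / x`. -/
def regPart (r : Module.Dual ℂ H → ℂ → g ⊗[ℂ] g) (q : Module.Dual ℂ H) : ℕ → g ⊗[ℂ] g :=
  if h : ∃ a, ∃ ρ > 0, IsRegularPart r q a ρ then h.choose else 0

theorem IsDynamicalRMatrix.isRegularPart (hr : IsDynamicalRMatrix r)
    (hq : q ∈ regularSet r) {ρ : ℝ} (hρ : NoPole r q ρ) :
    IsRegularPart r q (regPart r q) ρ := by
  obtain ⟨a, ha⟩ := hr.exists_isRegularPart hq hρ
  have h : ∃ a, ∃ ρ > 0, IsRegularPart r q a ρ := ⟨a, ρ, hρ.1, ha⟩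
  have h2 : regPart r q = h.choose := by rw [regPart, dif_pos h]
  obtain ⟨ρ', hρ', h3⟩ := h.choose_spec
  rw [h2, h3.unique hρ' ha hρ.1]
  exact ha

/-- Derivative of the regular part along `a ∈ h*`. -/
def dRegPart (r : Module.Dual ℂ H → ℂ → g ⊗[ℂ] g) (q a : Module.Dual ℂ H) (k : ℕ) : g ⊗[ℂ] g :=
  vderiv (fun t : ℂ => regPart r (q + t • a) k) 0

omit [LieAlgebra.IsSimple ℂ g] in
theorem hasDerivAt_line {f : Module.Dual ℂ H → ℂ} {L : Module.Dual ℂ H →L[ℂ] ℂ}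
    (h : HasFDerivAt f L q) (a : Module.Dual ℂ H) :
    HasDerivAt (fun t : ℂ => f (q + t • a)) (L a) 0 := by
  have h2 : HasDerivAt (fun t : ℂ => q + t • a) a 0 := by
    simpa using ((hasDerivAt_id (0 : ℂ)).smul_const a).const_add q
  have h3 : HasFDerivAt f L ((fun t : ℂ => q + t • a) 0) := by simpa using h
  exact h3.comp_hasDerivAt (0 : ℂ) h2

theorem IsDynamicalRMatrix.analyticAt_sub_pole {x : ℂ} (hx : x ≠ 0) (h : RegularAt r q x)
    (φ : Module.Dual ℂ (g ⊗[ℂ] g)) : AnalyticAt ℂ (fun p : Module.Dual ℂ H × ℂ =>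
      φ (r p.1 p.2) - φ (casimir g) * p.2⁻¹) (q, x) :=
  (h φ).sub (analyticAt_const.mul (analyticAt_snd.inv hx))

/-- The subtracted pole Ω/x is independent of q. -/
theorem RegularAt.fderiv_sub_pole {x : ℂ} (hx : x ≠ 0) (h : RegularAt r q x)
    (φ : Module.Dual ℂ (g ⊗[ℂ] g)) (a : Module.Dual ℂ H) :
    fderiv ℂ (fun p : Module.Dual ℂ H × ℂ => φ (r p.1 p.2) - φ (casimir g) * p.2⁻¹) (q, x) (a, 0) =
      φ (partialDeriv r a q x) := by
  rw [h.dual_partialDeriv]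
  have h1 : AnalyticAt ℂ (fun p : Module.Dual ℂ H × ℂ => φ (casimir g) * p.2⁻¹) (q, x) :=
    analyticAt_const.mul (analyticAt_snd.inv hx)
  rw [fderiv_fun_sub (h φ).differentiableAt h1.differentiableAt, sub_apply]
  have h2 : fderiv ℂ (fun p : Module.Dual ℂ H × ℂ => φ (casimir g) * p.2⁻¹) (q, x) (a, 0) = 0 := by
    have h3 := h1.differentiableAt.hasFDerivAt.comp_hasDerivAt_of_eq (0 : ℂ)
      (f := fun t : ℂ => (q + t • a, x)) (f' := (a, 0)) (by
        refine HasDerivAt.prodMk ?_ (hasDerivAt_const _ _)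
        simpa using ((hasDerivAt_id (0 : ℂ)).smul_const a).const_add q) (by simp)
    exact h3.unique (hasDerivAt_const (0 : ℂ) (φ (casimir g) * x⁻¹))
  rw [h2, sub_zero]

theorem IsDynamicalRMatrix.hasFDerivAt_regPart_aux (hr : IsDynamicalRMatrix r) {r₀ : ℝ}
    (hev : ∀ᶠ q' in 𝓝 q, NoPole r q' r₀) {s : ℝ} (hs : 0 < s) (hsr : s < r₀)
    (φ : Module.Dual ℂ (g ⊗[ℂ] g)) :
    (∀ k, ∃ L : Module.Dual ℂ H →L[ℂ] ℂ, HasFDerivAt (fun p => φ (regPart r p k)) L q ∧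
      ∀ a, L a = φ (dRegPart r q a k)) ∧
    ∀ (a : Module.Dual ℂ H) (x : ℂ), 0 < ‖x‖ → ‖x‖ < s →
      HasSum (fun k => φ (dRegPart r q a k) * x ^ k) (φ (partialDeriv r a q x)) := by
  have hreg : ∀ᶠ q' in 𝓝 q, q' ∈ regularSet r :=
    hev.eventually_nhds.mono fun q' h => ⟨r₀, h⟩
  -- The point x = 0 is left out of S because the difference r - Ω/x carries no meaningful value
  -- there.
  have key := fun φ : Module.Dual ℂ (g ⊗[ℂ] g) => hasFDerivAt_taylorCoeff (F := fun p :
    Module.Dual ℂ H × ℂ => φ (r p.1 p.2) - φ (casimir g) * p.2⁻¹)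
    (a := fun p k => φ (regPart r p k)) (S := {0}ᶜ) (q := q) hs hsr
    (fun w hw h0 => by
      rw [h0, mem_sphere_zero_iff_norm, norm_zero] at hw; exact hs.ne hw)
    (fun x hx0 hx => IsDynamicalRMatrix.analyticAt_sub_pole hx0
      (hev.self_of_nhds.2 x (norm_pos_iff.mpr hx0) hx) φ)
    (by
      filter_upwards [hev, hreg] with p hp hp'
      obtain ⟨h, h1, h2⟩ := hr.isRegularPart hp' hp φ
      exact ⟨h, h1, fun x hx0 hx => by
        rw [h2 x (norm_pos_iff.mpr hx0) hx]; ring⟩)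
  choose L hL hL' using key
  have hLd : ∀ (φ : Module.Dual ℂ (g ⊗[ℂ] g)) k a, L φ k a = φ (dRegPart r q a k) := fun φ k a => by
    rw [dRegPart, dual_vderiv φ fun ψ => (hasDerivAt_line (hL ψ k) a).differentiableAt]
    exact (hasDerivAt_line (hL φ k) a).deriv.symm
  refine ⟨fun k => ⟨L φ k, hL φ k, hLd φ k⟩, fun a x h0 hx => ?_⟩
  have hx0 : x ≠ 0 := norm_pos_iff.mp h0
  have := hL' φ x hx0 hx a
  rw [RegularAt.fderiv_sub_pole hx0 (hev.self_of_nhds.2 x h0 (hx.trans hsr))] at this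
  simpa only [hLd] using this

theorem IsDynamicalRMatrix.hasFDerivAt_regPart (hr : IsDynamicalRMatrix r)
    (hq : q ∈ regularSet r) (φ : Module.Dual ℂ (g ⊗[ℂ] g)) (k : ℕ) :
    ∃ L : Module.Dual ℂ H →L[ℂ] ℂ, HasFDerivAt (fun p => φ (regPart r p k)) L q ∧
      ∀ a, L a = φ (dRegPart r q a k) := by
  obtain ⟨r₀, hev⟩ := hq
  have h0 := hev.self_of_nhds.1
  exact (hr.hasFDerivAt_regPart_aux hev (half_pos h0) (half_lt_self h0) φ).1 k

/-- The derivative of `r(q, x)` in `q` is regular at `x = 0`. -/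
theorem IsDynamicalRMatrix.hasTaylor_dRegPart (hr : IsDynamicalRMatrix r) {r₀ : ℝ}
    (hev : ∀ᶠ q' in 𝓝 q, NoPole r q' r₀) (a : Module.Dual ℂ H) (φ : Module.Dual ℂ (g ⊗[ℂ] g)) :
    ∃ h, HasTaylor h (fun k => φ (dRegPart r q a k)) r₀ ∧
      ∀ x, 0 < ‖x‖ → ‖x‖ < r₀ → φ (partialDeriv r a q x) = h x := by
  have key : ∀ x, 0 < ‖x‖ → ‖x‖ < r₀ →
      HasSum (fun k => φ (dRegPart r q a k) * x ^ k) (φ (partialDeriv r a q x)) := fun x h0 hx => by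
    -- The coefficients do not depend on the radius s of the circle, so s may be adapted to x and
    -- convergence reaches all of ‖x‖ < r₀.
    obtain ⟨s, h1, h2⟩ := exists_between hx
    exact (hr.hasFDerivAt_regPart_aux hev (h0.trans h1) h2 φ).2 a x h0 h1
  refine ⟨fun x => ∑' k, φ (dRegPart r q a k) * x ^ k, fun x hx => ?_, fun x h0 hx =>
    (key x h0 hx).tsum_eq.symm⟩
  refine Summable.hasSum ?_
  obtain rfl | hx0 := eq_or_ne x 0
  · refine summable_of_ne_finset_zero (s := {0}) fun n hn => ?_
    have : n ≠ 0 := by simpa using hn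
    simp [this]
  · exact (key x (norm_pos_iff.mpr hx0) hx).summable

/-- The shifted coefficients are the Taylor coefficients of r - Ω/x at y, so the parameter argument
is repeated around y ≠ 0. Uniqueness of Taylor coefficients identifies the derivatives with the
shifted coefficients of the derivative. -/
theorem IsDynamicalRMatrix.hasFDerivAt_shiftCoeff (hr : IsDynamicalRMatrix r) {r₀ : ℝ}
    (hev : ∀ᶠ q' in 𝓝 q, NoPole r q' r₀) {y : ℂ} (hy0 : 0 < ‖y‖) (hy : ‖y‖ < r₀)
    (φ : Module.Dual ℂ (g ⊗[ℂ] g)) (n : ℕ) :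
    ∃ L : Module.Dual ℂ H →L[ℂ] ℂ,
      HasFDerivAt (fun p => shiftCoeff (fun k => φ (regPart r p k)) y n) L q ∧
      ∀ a, L a = shiftCoeff (fun k => φ (dRegPart r q a k)) y n := by
  have hreg : ∀ᶠ q' in 𝓝 q, q' ∈ regularSet r :=
    hev.eventually_nhds.mono fun q' h => ⟨r₀, h⟩
  -- A disc of this radius around y avoids 0 and stays inside the pole-free disc.
  set s' := min ‖y‖ (r₀ - ‖y‖) with hs'
  have hs'0 : 0 < s' := lt_min hy0 (by linarith)
  have hsmall : ∀ x : ℂ, ‖x‖ < s' → 0 < ‖x + y‖ ∧ ‖x + y‖ < r₀ := fun x hx => by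
    have h1 := hx.trans_le (min_le_left _ _)
    have h2 := hx.trans_le (min_le_right _ _)
    refine ⟨norm_pos_iff.mpr fun h => ?_, (norm_add_le x y).trans_lt (by linarith)⟩
    rw [eq_neg_of_add_eq_zero_left h, norm_neg] at h1
    exact lt_irrefl _ h1
  have hline : ∀ x : ℂ, AnalyticAt ℂ (fun p : Module.Dual ℂ H × ℂ => (p.1, p.2 + y)) (q, x) :=
    fun x => analyticAt_fst.prod (analyticAt_snd.add analyticAt_const)
  obtain ⟨L, hL, hL'⟩ := hasFDerivAt_taylorCoeff (F := fun p :
    Module.Dual ℂ H × ℂ => φ (r p.1 (p.2 + y)) - φ (casimir g) * (p.2 + y)⁻¹)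
    (a := fun p k => shiftCoeff (fun k => φ (regPart r p k)) y k) (S := Set.univ) (q := q)
    (half_pos hs'0) (half_lt_self hs'0) (Set.subset_univ _)
    (fun x _ hx => by
      have h1 := IsDynamicalRMatrix.analyticAt_sub_pole (norm_pos_iff.mp (hsmall x hx).1)
        (hev.self_of_nhds.2 _ (hsmall x hx).1 (hsmall x hx).2) φ
      exact AnalyticAt.comp (f := fun p : Module.Dual ℂ H × ℂ => (p.1, p.2 + y)) (x := (q, x))
        h1 (hline x))
    (by
      filter_upwards [hev, hreg] with p hp hp'
      obtain ⟨h, h1, h2⟩ := hr.isRegularPart hp' hp φ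
      refine ⟨fun x => h (x + y), (h1.shift hy).mono (min_le_right _ _), fun x _ hx => ?_⟩
      simp only
      rw [h2 _ (hsmall x hx).1 (hsmall x hx).2]; ring)
  refine ⟨L n, hL n, fun a => ?_⟩
  obtain ⟨h, h1, h2⟩ := hr.hasTaylor_dRegPart hev a φ
  have h3 : HasTaylor (fun x => h (x + y)) (fun n => L n a) (s' / 2) := fun x hx => by
    have hx' : ‖x‖ < s' := hx.trans (half_lt_self hs'0)
    have h4 := hL' x (Set.mem_univ x) hx a
    have h5 := (hsmall x hx').1
    have h6 := (hsmall x hx').2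
    show HasSum _ (h (x + y))
    rw [← h2 _ h5 h6, ← RegularAt.fderiv_sub_pole (norm_pos_iff.mp h5)
      (hev.self_of_nhds.2 _ h5 h6)]
    convert h4 using 1
    have h7 := (IsDynamicalRMatrix.analyticAt_sub_pole (norm_pos_iff.mp h5)
      (hev.self_of_nhds.2 _ h5 h6) φ).differentiableAt.hasFDerivAt
    have h8 : HasFDerivAt (fun p : Module.Dual ℂ H × ℂ => (p.1, p.2 + y))
        (ContinuousLinearMap.id ℂ (Module.Dual ℂ H × ℂ)) (q, x) := by
      have := (hasFDerivAt_id (𝕜 := ℂ) ((q, x) : Module.Dual ℂ H × ℂ)).add_const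
        ((0, y) : Module.Dual ℂ H × ℂ)
      refine this.congr_of_eventuallyEq (Filter.Eventually.of_forall fun p => ?_)
      ext <;> simp
    have h9 := HasFDerivAt.comp (f := fun p : Module.Dual ℂ H × ℂ => (p.1, p.2 + y)) (q, x) h7 h8
    rw [ContinuousLinearMap.comp_id] at h9
    exact congrArg (fun T : (Module.Dual ℂ H × ℂ) →L[ℂ] ℂ => T (a, 0)) h9.fderiv.symm
  exact congrFun (h3.unique (half_pos hs'0) (h1.shift hy) (by linarith)
    (Filter.Eventually.of_forall fun _ => rfl)) n

end RegularPart

/-! ### Vector-valued power series and Laurent series -/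

namespace HasLaurent

variable {F G : ℂ → ℂ} {f g : ℤ → ℂ} {ρ : ℝ}

theorem add (hF : HasLaurent F f ρ) (hG : HasLaurent G g ρ) :
    HasLaurent (fun z => F z + G z) (fun n => f n + g n) ρ := by
  obtain ⟨⟨N, hN⟩, hF⟩ := hF
  obtain ⟨⟨M, hM⟩, hG⟩ := hG
  refine ⟨⟨min N M, fun n hn => ?_⟩, fun z h0 hz => ?_⟩
  · simp only [hN n (hn.trans_le (min_le_left _ _)), hM n (hn.trans_le (min_le_right _ _)), add_zero]
  · simpa only [add_mul] using (hF z h0 hz).add (hG z h0 hz)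

theorem const_mul (a : ℂ) (hF : HasLaurent F f ρ) :
    HasLaurent (fun z => a * F z) (fun n => a * f n) ρ := by
  obtain ⟨⟨N, hN⟩, hF⟩ := hF
  refine ⟨⟨N, fun n hn => by simp only [hN n hn, mul_zero]⟩, fun z h0 hz => ?_⟩
  simpa only [mul_assoc] using (hF z h0 hz).mul_left a

theorem zero : HasLaurent (fun _ => 0) (fun _ => 0) ρ :=
  ⟨⟨0, fun _ _ => rfl⟩, fun z _ _ => by simp⟩

theorem sum {ι : Type*} {s : Finset ι} {F : ι → ℂ → ℂ} {f : ι → ℤ → ℂ}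
    (h : ∀ i ∈ s, HasLaurent (F i) (f i) ρ) :
    HasLaurent (fun z => ∑ i ∈ s, F i z) (fun n => ∑ i ∈ s, f i n) ρ := by
  classical
  induction s using Finset.induction_on with
  | empty => simpa using HasLaurent.zero
  | insert a s ha ih =>
    simp only [Finset.sum_insert ha]
    exact (h a (Finset.mem_insert_self a s)).add
      (ih fun i hi => h i (Finset.mem_insert_of_mem hi))

theorem continuousOn_sphere (hF : HasLaurent F f ρ) {s : ℝ} (hs : 0 < s) (hsρ : s < ρ) :
    ContinuousOn F (Metric.sphere 0 s) := by
  obtain ⟨M, hM⟩ := exists_nat_bound hF.1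
  obtain ⟨P, hP, hPF⟩ := hF.toTaylor hM
  have hsph : ∀ w ∈ Metric.sphere (0 : ℂ) s, ‖w‖ = s := fun w hw => by simpa using hw
  have hne : ∀ w ∈ Metric.sphere (0 : ℂ) s, w ≠ 0 := fun w hw => by
    rw [← norm_pos_iff, hsph w hw]; exact hs
  have h1 : ContinuousOn (fun w => (w ^ M)⁻¹ * P w) (Metric.sphere 0 s) :=
    (ContinuousOn.inv₀ (by fun_prop) fun w hw => pow_ne_zero _ (hne w hw)).mul
      (hP.differentiableOn.continuousOn.mono (Metric.sphere_subset_closedBall.trans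
        (Metric.closedBall_subset_ball hsρ)))
  refine h1.congr fun w hw => ?_
  show F w = (w ^ M)⁻¹ * P w
  rw [← hPF w (by rw [hsph w hw]; exact hs) (by rw [hsph w hw]; exact hsρ),
    inv_mul_cancel_left₀ (pow_ne_zero _ (hne w hw))]

end HasLaurent

section VectorSeries

variable {V W U : Type*} [AddCommGroup V] [Module ℂ V] [AddCommGroup W] [Module ℂ W]
  [AddCommGroup U] [Module ℂ U]

/-- `s w = ∑ a n w ^ n` for `‖w‖ < δ`, tested against functionals. -/
def HasTaylorV (s : ℂ → W) (a : ℕ → W) (δ : ℝ) : Prop :=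
  ∀ φ : Module.Dual ℂ W, HasTaylor (fun w => φ (s w)) (fun n => φ (a n)) δ

namespace HasTaylorV

variable {s t : ℂ → W} {a b : ℕ → W} {δ : ℝ}

theorem mono {δ' : ℝ} (h : HasTaylorV s a δ) (hδ : δ' ≤ δ) : HasTaylorV s a δ' :=
  fun φ => (h φ).mono hδ

theorem add (hs : HasTaylorV s a δ) (ht : HasTaylorV t b δ) :
    HasTaylorV (fun w => s w + t w) (a + b) δ := fun φ => by
  simpa only [Pi.add_apply, map_add] using (hs φ).add (ht φ)

theorem smul (c : ℂ) (hs : HasTaylorV s a δ) : HasTaylorV (fun w => c • s w) (c • a) δ := fun φ => by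
  simpa only [Pi.smul_apply, map_smul, smul_eq_mul] using (hs φ).const_mul c

end HasTaylorV

/-- `F z = ∑ f n z ^ n` for `0 < ‖z‖ < ρ`, tested against functionals, with finitely many negative
powers. -/
def HasLaurentV (F : ℂ → V) (f : ℤ → V) (ρ : ℝ) : Prop :=
  (∃ N : ℤ, ∀ n < N, f n = 0) ∧
    ∀ φ : Module.Dual ℂ V, ∀ z : ℂ, 0 < ‖z‖ → ‖z‖ < ρ → HasSum (fun n : ℤ => φ (f n) * z ^ n) (φ (F z))

namespace HasLaurentV

variable {F G : ℂ → V} {f g : ℤ → V} {ρ : ℝ}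

theorem hasLaurent (h : HasLaurentV F f ρ) (φ : Module.Dual ℂ V) :
    HasLaurent (fun z => φ (F z)) (fun n => φ (f n)) ρ := by
  obtain ⟨N, hN⟩ := h.1
  exact ⟨⟨N, fun n hn => by simp only [hN n hn, map_zero]⟩, h.2 φ⟩

theorem mono {ρ' : ℝ} (h : HasLaurentV F f ρ) (hρ : ρ' ≤ ρ) : HasLaurentV F f ρ' :=
  ⟨h.1, fun φ z h0 hz => h.2 φ z h0 (hz.trans_le hρ)⟩

theorem congr (h : HasLaurentV F f ρ) (hFG : ∀ z, 0 < ‖z‖ → ‖z‖ < ρ → F z = G z) :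
    HasLaurentV G f ρ :=
  ⟨h.1, fun φ z h0 hz => hFG z h0 hz ▸ h.2 φ z h0 hz⟩

theorem add (hF : HasLaurentV F f ρ) (hG : HasLaurentV G g ρ) :
    HasLaurentV (fun z => F z + G z) (f + g) ρ := by
  obtain ⟨⟨N, hN⟩, hF⟩ := hF
  obtain ⟨⟨M, hM⟩, hG⟩ := hG
  refine ⟨⟨min N M, fun n hn => ?_⟩, fun φ z h0 hz => ?_⟩
  · rw [Pi.add_apply, hN n (hn.trans_le (min_le_left _ _)),
      hM n (hn.trans_le (min_le_right _ _)), add_zero]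
  · simpa only [Pi.add_apply, map_add, add_mul] using (hF φ z h0 hz).add (hG φ z h0 hz)

theorem map (T : V →ₗ[ℂ] W) (hF : HasLaurentV F f ρ) :
    HasLaurentV (fun z => T (F z)) (fun n => T (f n)) ρ := by
  obtain ⟨⟨N, hN⟩, hF⟩ := hF
  exact ⟨⟨N, fun n hn => by simp only [hN n hn, map_zero]⟩, fun φ z h0 hz => hF (φ ∘ₗ T) z h0 hz⟩

theorem neg (hF : HasLaurentV F f ρ) : HasLaurentV (fun z => -F z) (-f) ρ :=
  hF.map (-LinearMap.id)

theorem sub (hF : HasLaurentV F f ρ) (hG : HasLaurentV G g ρ) :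
    HasLaurentV (fun z => F z - G z) (f - g) ρ := by
  simpa only [sub_eq_add_neg] using hF.add hG.neg

theorem smul (c : ℂ) (hF : HasLaurentV F f ρ) : HasLaurentV (fun z => c • F z) (c • f) ρ :=
  hF.map (c • LinearMap.id)

theorem convergesOn (hF : HasLaurentV F f ρ) : ConvergesOn f ρ :=
  fun φ z h0 hz => (hF.2 φ z h0 hz).summable

theorem unique (hF : HasLaurentV F f ρ) (hG : HasLaurentV G g ρ) (hρ : 0 < ρ)
    (h : ∀ z, 0 < ‖z‖ → ‖z‖ < ρ → F z = G z) : f = g := by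
  ext n
  refine eq_of_forall_dual fun φ => ?_
  refine congrFun ((hF.hasLaurent φ).unique hρ (hG.hasLaurent φ) hρ ?_) n
  filter_upwards [eventually_punctured hρ] with z ⟨h0, hz⟩
  simp only [h z h0 hz]

variable [FiniteDimensional ℂ V] [FiniteDimensional ℂ W]

theorem val_eq (hF : HasLaurentV F f ρ) {z : ℂ} (h0 : 0 < ‖z‖) (hz : ‖z‖ < ρ) :
    val f z = F z := by
  rw [val, ← (Module.finBasis ℂ V).sum_repr (F z)]
  exact Finset.sum_congr rfl fun i _ => by
    rw [(hF.2 ((Module.finBasis ℂ V).coord i) z h0 hz).tsum_eq, Module.Basis.coord_apply]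

/-- Cauchy product with respect to a bilinear form. -/
theorem bilin {G : ℂ → W} {g : ℤ → W} (B : V →ₗ[ℂ] W →ₗ[ℂ] ℂ) (hF : HasLaurentV F f ρ)
    (hG : HasLaurentV G g ρ) :
    HasLaurent (fun z => B (F z) (G z)) (fun n => ∑ᶠ k, B (f k) (g (n - k))) ρ := by
  obtain ⟨N, hN⟩ := hF.1
  obtain ⟨M, hM⟩ := hG.1
  have hfin : ∀ (T : V → W → ℂ) (h1 : ∀ w, T 0 w = 0) (h2 : ∀ v, T v 0 = 0) (n : ℤ),
      ∑ᶠ k, T (f k) (g (n - k)) = ∑ k ∈ Finset.Icc N (n - M), T (f k) (g (n - k)) :=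
    fun T h1 h2 n => finsum_eq_sum_of_support_subset _ fun k hk => by
      rw [Finset.coe_Icc, Set.mem_Icc]
      refine ⟨not_lt.mp fun h => hk ?_, not_lt.mp fun h => hk ?_⟩
      · simp only [hN k h, h1]
      · simp only [hM (n - k) (by omega), h2]
  have key := HasLaurent.sum (s := Finset.univ) fun i _ => HasLaurent.sum (s := Finset.univ)
    fun j _ => ((hF.hasLaurent ((Module.finBasis ℂ V).coord i)).mul
      (hG.hasLaurent ((Module.finBasis ℂ W).coord j))).const_mul
        (B (Module.finBasis ℂ V i) (Module.finBasis ℂ W j))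
  have e1 : (fun z => B (F z) (G z)) = fun z => ∑ i, ∑ j, B (Module.finBasis ℂ V i)
      (Module.finBasis ℂ W j) * ((Module.finBasis ℂ V).coord i (F z) *
        (Module.finBasis ℂ W).coord j (G z)) := funext fun z => bilin_eq_sum B _ _
  have e2 : (fun n => ∑ᶠ k, B (f k) (g (n - k))) = fun n => ∑ i, ∑ j,
      B (Module.finBasis ℂ V i) (Module.finBasis ℂ W j) * ∑ᶠ k, ((Module.finBasis ℂ V).coord i (f k) *
        (Module.finBasis ℂ W).coord j (g (n - k))) := by
    ext n
    rw [hfin (fun v w => B v w) (fun w => by simp) (fun v => by simp)]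
    simp only [fun i j => hfin (fun v w => (Module.finBasis ℂ V).coord i v *
      (Module.finBasis ℂ W).coord j w) (fun w => by simp) (fun v => by simp) n, bilin_eq_sum B (f _)]
    simp only [Finset.mul_sum]
    rw [Finset.sum_comm]
    exact Finset.sum_congr rfl fun i _ => Finset.sum_comm
  rw [e1, e2]
  exact key

end HasLaurentV

variable [FiniteDimensional ℂ V] [FiniteDimensional ℂ W]

theorem Loop.hasLaurentV (X : Loop V) {ρ : ℝ} (h : ConvergesOn X.1 ρ) :
    HasLaurentV (val X.1) X.1 ρ := by
  refine ⟨X.2.1, fun φ z h0 hz => ?_⟩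
  have h1 := hasSum_sum (s := Finset.univ) fun i (_ : i ∈ Finset.univ) =>
    (h ((Module.finBasis ℂ V).coord i) z h0 hz).hasSum.mul_left (φ (Module.finBasis ℂ V i))
  have h2 : φ (val X.1 z) = ∑ i, φ (Module.finBasis ℂ V i) *
      ∑' n : ℤ, (Module.finBasis ℂ V).coord i (X.1 n) * z ^ n := by
    simp only [val, map_sum, map_smul, smul_eq_mul, mul_comm]
  rw [h2]
  refine (hasSum_congr fun n => ?_).mp h1
  rw [dual_eq_sum φ (X.1 n), Finset.sum_mul]
  simp only [mul_assoc]

/-- The element of `V` whose coordinates are the `n`-th Taylor coefficients at `y` of the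
coordinates of the power series with coefficients `a`. -/
def shiftVec (a : ℕ → W) (y : ℂ) (n : ℕ) : W :=
  ∑ i, shiftCoeff (fun k => (Module.finBasis ℂ W).coord i (a k)) y n • Module.finBasis ℂ W i

namespace HasTaylorV

variable {s : ℂ → W} {a : ℕ → W} {δ : ℝ}

theorem of_forall (h : ∀ φ : Module.Dual ℂ W, ∃ f, HasTaylor f (fun n => φ (a n)) δ) :
    ∃ s, HasTaylorV s a δ := by
  choose f hf using h
  refine ⟨fun w => ∑ i, f ((Module.finBasis ℂ W).coord i) w • Module.finBasis ℂ W i, fun φ => ?_⟩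
  have h1 := HasTaylor.sum (s := Finset.univ) fun i _ =>
    (hf ((Module.finBasis ℂ W).coord i)).const_mul (φ (Module.finBasis ℂ W i))
  simp only [map_sum, map_smul, smul_eq_mul]
  simp only [fun n => dual_eq_sum φ (a n), mul_comm _ (φ (Module.finBasis ℂ W _))]
  exact h1

theorem dual_shiftVec (hs : HasTaylorV s a δ) {y : ℂ} (hy : ‖y‖ < δ) (φ : Module.Dual ℂ W) (n : ℕ) :
    φ (shiftVec a y n) = shiftCoeff (fun k => φ (a k)) y n := by
  have h1 := hasSum_sum (s := Finset.univ) fun i (_ : i ∈ Finset.univ) =>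
    ((hs ((Module.finBasis ℂ W).coord i)).hasSum_shiftCoeff hy n).mul_left
      (φ (Module.finBasis ℂ W i))
  have h2 : φ (shiftVec a y n) = ∑ i, φ (Module.finBasis ℂ W i) *
      shiftCoeff (fun k => (Module.finBasis ℂ W).coord i (a k)) y n := by
    simp only [shiftVec, map_sum, map_smul, smul_eq_mul, mul_comm]
  rw [h2]
  refine h1.unique ((hasSum_congr fun l => ?_).mp ((hs φ).hasSum_shiftCoeff hy n))
  rw [dual_eq_sum φ (a (n + l)), Finset.sum_mul, Finset.sum_mul]
  simp only [mul_assoc]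

theorem shift (hs : HasTaylorV s a δ) {y : ℂ} (hy : ‖y‖ < δ) :
    HasTaylorV (fun w => s (w + y)) (shiftVec a y) (δ - ‖y‖) := fun φ => by
  simpa only [hs.dual_shiftVec hy] using (hs φ).shift hy

omit [FiniteDimensional ℂ W] in
/-- A power series, as a Laurent series. -/
theorem hasLaurentV (hs : HasTaylorV s a δ) :
    HasLaurentV s (fun n : ℤ => if n < 0 then 0 else a n.toNat) δ := by
  refine ⟨⟨0, fun n hn => if_pos hn⟩, fun φ => ?_⟩
  refine (HasLaurent.of_taylor (F := fun z => φ (s z)) (P := fun z => φ (s z)) (M := 0)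
    (fun n hn => ?_) ?_ fun z _ _ => by rw [pow_zero, one_mul]).2
  · simp only [if_pos (show n < 0 by simpa using hn), map_zero]
  · simpa [not_lt.mpr (Int.natCast_nonneg _)] using hs φ

end HasTaylorV

variable (W) in
/-- Coefficient sequences of convergent power series. -/
def TaylorCoeff : Submodule ℂ (ℕ → W) where
  carrier := {a | ∃ s, ∃ δ > 0, HasTaylorV s a δ}
  zero_mem' := ⟨0, 1, one_pos, fun φ => by simpa using HasTaylor.zero⟩
  add_mem' := by
    rintro a b ⟨s, δ, hδ, hs⟩ ⟨t, δ', hδ', ht⟩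
    exact ⟨_, min δ δ', lt_min hδ hδ', (hs.mono (min_le_left _ _)).add (ht.mono (min_le_right _ _))⟩
  smul_mem' := by
    rintro c a ⟨s, δ, hδ, hs⟩
    exact ⟨_, δ, hδ, hs.smul c⟩

end VectorSeries

/-! ### Loops -/

namespace Loop

variable {V W : Type*} [AddCommGroup V] [Module ℂ V] [AddCommGroup W] [Module ℂ W]

/-- The Laurent polynomial `v z ^ n`. -/
def monomial (n : ℤ) (v : V) : Loop V :=
  ⟨Pi.single n v, ⟨n, fun m hm => by simp [hm.ne]⟩, 1, one_pos, fun φ z _ _ => by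
    refine summable_of_ne_finset_zero (s := {n}) fun m hm => ?_
    have : m ≠ n := by simpa using hm
    simp [this]⟩

theorem monomial_apply (n m : ℤ) (v : V) : (monomial n v).1 m = if m = n then v else 0 := by
  simp [monomial, Pi.single_apply]

/-- Every Laurent series is the sum of a power series and of finitely many monomials. -/
theorem induction_on {P : Loop V → Prop} (ξ : Loop V)
    (hpos : ∀ ξ : Loop V, (∀ n < 0, ξ.1 n = 0) → P ξ)
    (hmono : ∀ (m : ℕ) (v : V), P (monomial (-1 - m) v))
    (hadd : ∀ ξ η, P ξ → P η → P (ξ + η)) : P ξ := by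
  obtain ⟨M, hM⟩ := exists_nat_bound ξ.2.1
  induction M generalizing ξ with
  | zero => exact hpos ξ (by simpa using hM)
  | succ M ih =>
    have h := hadd (ξ - monomial (-1 - M) (ξ.1 (-1 - M))) (monomial (-1 - M) (ξ.1 (-1 - M)))
      (ih _ fun n hn => ?_) (hmono _ _)
    · simpa using h
    · rw [Submodule.coe_sub, Pi.sub_apply, monomial_apply]
      split_ifs with h
      · rw [h, sub_self]
      · rw [hM n (by push_cast; omega), sub_zero]

/-- The principal part of a Laurent series. -/
def negPart : Loop V →ₗ[ℂ] Loop V where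
  toFun ξ := ⟨fun n => if n < 0 then ξ.1 n else 0, by
    obtain ⟨N, hN⟩ := ξ.2.1
    refine ⟨⟨N, fun n hn => by simp [hN n hn]⟩, 1, one_pos, fun φ z _ _ => ?_⟩
    refine summable_of_ne_finset_zero (s := Finset.Ico N 0) fun n hn => ?_
    rw [Finset.mem_Ico, not_and_or] at hn
    rcases hn with hn | hn
    · simp [hN n (not_le.mp hn)]
    · simp [hn]⟩
  map_add' ξ η := by
    ext n
    by_cases h : n < 0 <;> simp [h]
  map_smul' c ξ := by
    ext n
    by_cases h : n < 0 <;> simp [h]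

theorem negPart_apply (ξ : Loop V) (n : ℤ) : (negPart ξ).1 n = if n < 0 then ξ.1 n else 0 := rfl

theorem map_apply (T : V →ₗ[ℂ] W) (ξ : Loop V) (n : ℤ) : (map T ξ).1 n = T (ξ.1 n) := rfl

theorem add_apply (ξ η : Loop V) (n : ℤ) : (ξ + η).1 n = ξ.1 n + η.1 n := rfl

theorem ext_of_val [FiniteDimensional ℂ V] {X Y : Loop V} {ρ : ℝ} (hρ : 0 < ρ)
    (hX : ConvergesOn X.1 ρ) (hY : ConvergesOn Y.1 ρ)
    (h : ∀ z, 0 < ‖z‖ → ‖z‖ < ρ → val X.1 z = val Y.1 z) : X = Y :=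
  Subtype.ext ((hasLaurentV X hX).unique (hasLaurentV Y hY) hρ h)

theorem hasLaurentV_negPart {ξ : Loop V} {M : ℕ} (hM : ∀ n < -(M : ℤ), ξ.1 n = 0) (ρ : ℝ) :
    HasLaurentV (fun z => ∑ m ∈ Finset.range M, z ^ (-1 - (m : ℤ)) • ξ.1 (-1 - m))
      (negPart ξ).1 ρ := by
  refine ⟨(negPart ξ).2.1, fun φ z _ _ => ?_⟩
  have h1 : Function.Injective fun m : ℕ => -1 - (m : ℤ) := fun a b h => by
    have : -1 - (a : ℤ) = -1 - b := h
    omega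
  rw [← h1.hasSum_iff]
  · simp only [map_sum, map_smul, smul_eq_mul]
    refine (hasSum_congr fun m => ?_).mp (hasSum_sum_of_ne_finset_zero
      (f := fun m : ℕ => z ^ (-1 - (m : ℤ)) * φ (ξ.1 (-1 - m))) (s := Finset.range M)
      fun m hm => ?_)
    · simp only [Function.comp, negPart_apply]
      rw [if_pos (by omega), mul_comm]
    · rw [hM _ (by have := Finset.mem_range.not.mp hm; omega), map_zero, mul_zero]
  · intro n hn
    rw [negPart_apply, if_neg, map_zero, zero_mul]
    intro h
    exact hn ⟨(-1 - n).toNat, by show -1 - ((-1 - n).toNat : ℤ) = n; omega⟩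

theorem hasLaurentV_const (x : V) (ρ : ℝ) : HasLaurentV (fun _ => x) (const x).1 ρ := by
  refine ⟨(const x).2.1, fun φ z _ _ => ?_⟩
  have h := hasSum_single (f := fun n : ℤ => φ ((const x).1 n) * z ^ n) 0 fun n hn => by
    simp [const, hn]
  simpa [const] using h

variable {g : Type*} [LieRing g] [LieAlgebra ℂ g]

theorem finite_support_bracket (X Y : Loop g) (n : ℤ) :
    (Function.support fun k : ℤ => ⁅X.1 k, Y.1 (n - k)⁆).Finite := by
  obtain ⟨N, hN⟩ := X.2.1
  obtain ⟨M, hM⟩ := Y.2.1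
  refine (Set.finite_Icc N (n - M)).subset fun k hk => ⟨not_lt.mp fun h => hk ?_,
    not_lt.mp fun h => hk ?_⟩
  · simp only [hN k h, zero_lie]
  · simp only [hM (n - k) (by omega), lie_zero]

variable [FiniteDimensional ℂ g]

theorem bracket_apply (X Y : Loop g) (n : ℤ) :
    (bracket X Y).1 n = ∑ᶠ k : ℤ, ⁅X.1 k, Y.1 (n - k)⁆ := rfl

theorem bracket_add_left (X X' Y : Loop g) :
    bracket (X + X') Y = bracket X Y + bracket X' Y := by
  ext n
  rw [add_apply, bracket_apply, bracket_apply, bracket_apply,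
    ← finsum_add_distrib (finite_support_bracket X Y n) (finite_support_bracket X' Y n)]
  simp only [add_apply, add_lie]

theorem bracket_add_right (X Y Y' : Loop g) :
    bracket X (Y + Y') = bracket X Y + bracket X Y' := by
  ext n
  rw [add_apply, bracket_apply, bracket_apply, bracket_apply,
    ← finsum_add_distrib (finite_support_bracket X Y n) (finite_support_bracket X Y' n)]
  simp only [add_apply, lie_add]

theorem bracket_smul_left (c : ℂ) (X Y : Loop g) : bracket (c • X) Y = c • bracket X Y := by
  ext n
  show ∑ᶠ k : ℤ, ⁅c • X.1 k, Y.1 (n - k)⁆ = c • ∑ᶠ k : ℤ, ⁅X.1 k, Y.1 (n - k)⁆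
  rw [smul_finsum]
  simp only [smul_lie]

theorem bracket_smul_right (c : ℂ) (X Y : Loop g) : bracket X (c • Y) = c • bracket X Y := by
  ext n
  show ∑ᶠ k : ℤ, ⁅X.1 k, c • Y.1 (n - k)⁆ = c • ∑ᶠ k : ℤ, ⁅X.1 k, Y.1 (n - k)⁆
  rw [smul_finsum]
  simp only [lie_smul]

/-- The bracket of `Lg` is pointwise. -/
theorem hasLaurentV_bracket {X Y : Loop g} {F G : ℂ → g} {ρ : ℝ} (hX : HasLaurentV F X.1 ρ)
    (hY : HasLaurentV G Y.1 ρ) : HasLaurentV (fun z => ⁅F z, G z⁆) (bracket X Y).1 ρ := by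
  refine ⟨(bracket X Y).2.1, fun φ z h0 hz => ?_⟩
  have h := (hX.bilin ((LieModule.toEnd ℂ g g : g →ₗ[ℂ] Module.End ℂ g).compr₂ φ) hY).2 z h0 hz
  refine (hasSum_congr fun n => ?_).mp h
  congr 1
  rw [bracket_apply]
  exact ((φ : g →+ ℂ).map_finsum (finite_support_bracket X Y n)).symm

theorem bracket_apply_eq_zero {X Y : Loop g} (hX : ∀ n < 0, X.1 n = 0) (hY : ∀ n < 0, Y.1 n = 0)
    {n : ℤ} (hn : n < 0) : (bracket X Y).1 n = 0 := by
  rw [bracket_apply]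
  refine finsum_eq_zero_of_forall_eq_zero fun k => ?_
  by_cases hk : k < 0
  · rw [hX k hk, zero_lie]
  · rw [hY _ (by omega), lie_zero]

theorem bracket_monomial_right (X : Loop g) (j : ℤ) (y : g) (n : ℤ) :
    (bracket X (monomial j y)).1 n = ⁅X.1 (n - j), y⁆ := by
  rw [bracket_apply, finsum_eq_single _ (n - j), monomial_apply, if_pos (by ring)]
  intro k hk
  rw [monomial_apply, if_neg (by omega), lie_zero]

theorem bracket_monomial_left (Y : Loop g) (j : ℤ) (x : g) (n : ℤ) :
    (bracket (monomial j x) Y).1 n = ⁅x, Y.1 (n - j)⁆ := by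
  rw [bracket_apply, finsum_eq_single _ j, monomial_apply, if_pos rfl]
  intro k hk
  rw [monomial_apply, if_neg hk, zero_lie]

end Loop

/-! ### The operator of a simple pole plus a power series -/

section Operator

variable {g : Type*} [LieRing g] [LieAlgebra ℂ g]

/-- Coefficients of the series `z ↦ Res_{w = 0} (h(w - z), ξ(w) ⊗ 1) dw`, where `h` is the power
series with coefficients `a`. -/
def residueCoeff (a : ℕ → g ⊗[ℂ] g) (ξ : ℤ → Module.Dual ℂ g) (j : ℤ) : g :=
  if j < 0 then 0 else ∑ᶠ n : ℕ,
    (((j.toNat + n).choose n : ℂ) * (-1) ^ j.toNat) • contract (ξ (-1 - n)) (a (j.toNat + n))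

theorem residueCoeff_natCast {a : ℕ → g ⊗[ℂ] g} {ξ : ℤ → Module.Dual ℂ g} {M : ℕ}
    (hM : ∀ n < -(M : ℤ), ξ n = 0) (l : ℕ) :
    residueCoeff a ξ l = ∑ n ∈ Finset.range M,
      (((l + n).choose n : ℂ) * (-1) ^ l) • contract (ξ (-1 - n)) (a (l + n)) := by
  rw [residueCoeff, if_neg (by omega), Int.toNat_natCast]
  refine finsum_eq_sum_of_support_subset _ fun n hn => ?_
  rw [Finset.mem_coe, Finset.mem_range]
  by_contra h
  refine hn ?_
  simp only [hM (-1 - n) (by omega), contract_zero_left, smul_zero]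

theorem residueCoeff_neg (a : ℕ → g ⊗[ℂ] g) (ξ : ℤ → Module.Dual ℂ g) {n : ℤ} (hn : n < 0) :
    residueCoeff a ξ n = 0 := if_pos hn

variable [FiniteDimensional ℂ g]

/-- The residue at w = 0 pairs the n-th Taylor coefficient of h at -z with the coefficient of
w^(-1-n) in ξ. Expanding that Taylor coefficient in powers of -z produces the binomials and signs.
-/
theorem hasLaurentV_residueCoeff {s : ℂ → g ⊗[ℂ] g} {a : ℕ → g ⊗[ℂ] g} {δ : ℝ}
    (hs : HasTaylorV s a δ) {ξ : ℤ → Module.Dual ℂ g} {M : ℕ} (hM : ∀ n < -(M : ℤ), ξ n = 0) :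
    HasLaurentV (fun z => ∑ n ∈ Finset.range M, contract (ξ (-1 - n)) (shiftVec a (-z) n))
      (residueCoeff a ξ) δ := by
  refine ⟨⟨0, fun n hn => residueCoeff_neg a ξ hn⟩, fun φ z h0 hz => ?_⟩
  have hz' : ‖-z‖ < δ := by rwa [norm_neg]
  have h1 : HasSum (fun l : ℕ => φ (residueCoeff a ξ l) * z ^ l)
      (φ (∑ n ∈ Finset.range M, contract (ξ (-1 - n)) (shiftVec a (-z) n))) := by
    rw [map_sum]
    simp only [residueCoeff_natCast hM, map_sum, Finset.sum_mul]
    refine hasSum_sum fun n _ => ?_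
    rw [← LinearMap.comp_apply, hs.dual_shiftVec hz']
    refine (hasSum_congr fun l => ?_).mp ((hs (φ ∘ₗ contract (ξ (-1 - n)))).hasSum_shiftCoeff hz' n)
    rw [map_smul, smul_eq_mul, neg_pow z, add_comm n l, LinearMap.comp_apply]
    ring
  rw [← Nat.cast_injective (R := ℤ).hasSum_iff]
  · simpa [Function.comp_def] using h1
  · intro n hn
    rw [residueCoeff_neg, map_zero, zero_mul]
    by_contra h
    exact hn ⟨n.toNat, by simpa using h⟩

/-- The operator `ξ ↦ Res_{w = 0} (h(w - z), ξ(w) ⊗ 1) dw` of a power series `h`. -/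
def residueOp : TaylorCoeff (g ⊗[ℂ] g) →ₗ[ℂ] Loop (Module.Dual ℂ g) →ₗ[ℂ] Loop g :=
  LinearMap.mk₂ ℂ (fun a ξ => ⟨residueCoeff a.1 ξ.1, by
      obtain ⟨s, δ, hδ, hs⟩ := a.2
      obtain ⟨M, hM⟩ := exists_nat_bound ξ.2.1
      have := hasLaurentV_residueCoeff hs hM
      exact ⟨this.1, δ, hδ, this.convergesOn⟩⟩)
    (fun a b ξ => by
      ext n
      obtain ⟨M, hM⟩ := exists_nat_bound ξ.2.1
      rw [Loop.add_apply]
      rcases lt_or_ge n 0 with hn | hn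
      · simp only [residueCoeff_neg _ _ hn, add_zero]
      · lift n to ℕ using hn
        simp only [residueCoeff_natCast hM, ← Finset.sum_add_distrib, ← smul_add, ← map_add]
        rfl)
    (fun c a ξ => by
      ext n
      obtain ⟨M, hM⟩ := exists_nat_bound ξ.2.1
      show residueCoeff (c • a.1) ξ.1 n = c • residueCoeff a.1 ξ.1 n
      rcases lt_or_ge n 0 with hn | hn
      · simp only [residueCoeff_neg _ _ hn, smul_zero]
      · lift n to ℕ using hn
        simp only [residueCoeff_natCast hM, Finset.smul_sum, Pi.smul_apply,
          map_smul, smul_comm c])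
    (fun a ξ η => by
      ext n
      obtain ⟨M₁, hM₁⟩ := exists_nat_bound ξ.2.1
      obtain ⟨M₂, hM₂⟩ := exists_nat_bound η.2.1
      have h1 : ∀ n < -((max M₁ M₂ : ℕ) : ℤ), ξ.1 n = 0 := fun n hn => hM₁ n (by omega)
      have h2 : ∀ n < -((max M₁ M₂ : ℕ) : ℤ), η.1 n = 0 := fun n hn => hM₂ n (by omega)
      have h3 : ∀ n < -((max M₁ M₂ : ℕ) : ℤ), (ξ + η).1 n = 0 := fun n hn => by
        rw [Loop.add_apply, h1 n hn, h2 n hn, add_zero]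
      rw [Loop.add_apply]
      rcases lt_or_ge n 0 with hn | hn
      · simp only [residueCoeff_neg _ _ hn, add_zero]
      · lift n to ℕ using hn
        simp only [residueCoeff_natCast h1, residueCoeff_natCast h2, residueCoeff_natCast h3,
          ← Finset.sum_add_distrib, ← smul_add, ← contract_add_left]
        rfl)
    (fun c a ξ => by
      ext n
      obtain ⟨M, hM⟩ := exists_nat_bound ξ.2.1
      have h3 : ∀ n < -(M : ℤ), (c • ξ).1 n = 0 := fun n hn => by
        rw [Submodule.coe_smul, Pi.smul_apply, hM n hn, smul_zero]
      show residueCoeff a.1 (c • ξ).1 n = c • residueCoeff a.1 ξ.1 n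
      rcases lt_or_ge n 0 with hn | hn
      · simp only [residueCoeff_neg _ _ hn, smul_zero]
      · lift n to ℕ using hn
        rw [residueCoeff_natCast hM, residueCoeff_natCast h3]
        simp only [Finset.smul_sum, Submodule.coe_smul, Pi.smul_apply, contract_smul_left, smul_comm c])

theorem residueOp_apply (a : TaylorCoeff (g ⊗[ℂ] g)) (ξ : Loop (Module.Dual ℂ g)) :
    (residueOp a ξ).1 = residueCoeff a.1 ξ.1 := rfl

theorem residueOp_eq_zero (a : TaylorCoeff (g ⊗[ℂ] g)) {ξ : Loop (Module.Dual ℂ g)}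
    (hξ : ∀ n < 0, ξ.1 n = 0) : residueOp a ξ = 0 := by
  ext n
  rw [residueOp_apply]
  rcases lt_or_ge n 0 with hn | hn
  · exact residueCoeff_neg _ _ hn
  · lift n to ℕ using hn
    rw [residueCoeff_natCast (M := 0) (by simpa using hξ), Finset.sum_range_zero]
    rfl

theorem residueOp_monomial (a : TaylorCoeff (g ⊗[ℂ] g)) (m : ℕ) (α : Module.Dual ℂ g) (l : ℕ) :
    (residueOp a (Loop.monomial (-1 - m) α)).1 l =
      (((l + m).choose m : ℂ) * (-1) ^ l) • contract α (a.1 (l + m)) := by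
  rw [residueOp_apply, residueCoeff_natCast (M := m + 1), Finset.sum_eq_single m]
  · rw [Loop.monomial_apply, if_pos rfl]
  · intro n _ hn
    rw [Loop.monomial_apply, if_neg (by omega), contract_zero_left, smul_zero]
  · intro h
    exact absurd (Finset.self_mem_range_succ m) h
  · intro n hn
    rw [Loop.monomial_apply, if_neg (by push_cast at hn; omega)]

theorem residueOp_apply_neg (a : TaylorCoeff (g ⊗[ℂ] g)) (ξ : Loop (Module.Dual ℂ g)) {n : ℤ}
    (hn : n < 0) : (residueOp a ξ).1 n = 0 := residueCoeff_neg _ _ hn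

variable [LieAlgebra.IsSimple ℂ g]

variable (g) in
/-- The map `Lg* → Lg` induced by the Killing form. -/
abbrev loopIso : Loop (Module.Dual ℂ g) →ₗ[ℂ] Loop g := Loop.map (killingIso g).toLinearMap

variable (g) in
/-- The inverse of `loopIso`. -/
abbrev loopIsoInv : Loop g →ₗ[ℂ] Loop (Module.Dual ℂ g) := Loop.map (killingIso g).symm.toLinearMap

/-- The operator `ξ ↦ Res_{w = 0} (r(w - z), ξ(w) ⊗ 1) dw` of `r(x) = Ω / x + h(x)`, where
`1 / (w - z)` is expanded in `|w| < |z|`. -/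
def innerOp (a : TaylorCoeff (g ⊗[ℂ] g)) : Loop (Module.Dual ℂ g) →ₗ[ℂ] Loop g :=
  residueOp a - loopIso g ∘ₗ Loop.negPart

/-- The operator `ξ ↦ p.v. (1 / 2πi) ∮ (r(w - z), ξ(w) ⊗ 1) dw` of `r(x) = Ω / x + h(x)`. -/
def pvOp (a : TaylorCoeff (g ⊗[ℂ] g)) : Loop (Module.Dual ℂ g) →ₗ[ℂ] Loop g :=
  innerOp a + (1 / 2 : ℂ) • loopIso g

/-- The Taylor coefficients of `w ↦ r(w - z)` at `w = 0`, where `r(x) = Ω / x + h(x)`. -/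
def kernelCoeff (a : ℕ → g ⊗[ℂ] g) (z : ℂ) (n : ℕ) : g ⊗[ℂ] g :=
  shiftVec a (-z) n - z ^ (-1 - (n : ℤ)) • casimir g

theorem innerOp_apply (a : TaylorCoeff (g ⊗[ℂ] g)) (ξ : Loop (Module.Dual ℂ g)) (n : ℤ) :
    (innerOp a ξ).1 n = (residueOp a ξ).1 n - if n < 0 then killingIso g (ξ.1 n) else 0 := by
  show _ - killingIso g ((Loop.negPart ξ).1 n) = _
  rw [Loop.negPart_apply]
  split_ifs
  · rfl
  · rw [map_zero]

theorem innerOp_eq_zero (a : TaylorCoeff (g ⊗[ℂ] g)) {ξ : Loop (Module.Dual ℂ g)}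
    (hξ : ∀ n < 0, ξ.1 n = 0) : innerOp a ξ = 0 := by
  ext n
  rw [innerOp_apply, residueOp_eq_zero a hξ]
  split_ifs with hn
  · rw [hξ n hn, map_zero, sub_zero]
  · rw [sub_zero]

/-- The same residue for the whole kernel r(w - z): the principal part of ξ, mapped by -I, is the
residue against the expansion of Ω/(w - z) in |w| < |z|. -/
theorem hasLaurentV_innerOp {s : ℂ → g ⊗[ℂ] g} {a : TaylorCoeff (g ⊗[ℂ] g)} {δ : ℝ}
    (hs : HasTaylorV s a.1 δ) {ξ : Loop (Module.Dual ℂ g)} {M : ℕ}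
    (hM : ∀ n < -(M : ℤ), ξ.1 n = 0) :
    HasLaurentV (fun z => ∑ n ∈ Finset.range M, contract (ξ.1 (-1 - n)) (kernelCoeff a.1 z n))
      (innerOp a ξ).1 δ := by
  refine ((hasLaurentV_residueCoeff hs hM).sub
    ((Loop.hasLaurentV_negPart hM δ).map (killingIso g).toLinearMap)).congr fun z h0 hz => ?_
  rw [map_sum, ← Finset.sum_sub_distrib]
  refine Finset.sum_congr rfl fun n _ => ?_
  rw [kernelCoeff, map_sub, map_smul, map_smul, contract_casimir]
  rfl

theorem hasLaurentV_pvOp {s : ℂ → g ⊗[ℂ] g} {a : TaylorCoeff (g ⊗[ℂ] g)} {δ ρ : ℝ}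
    (hs : HasTaylorV s a.1 δ) (hρδ : ρ ≤ δ) {ξ : Loop (Module.Dual ℂ g)} (hξ : ConvergesOn ξ.1 ρ)
    {M : ℕ} (hM : ∀ n < -(M : ℤ), ξ.1 n = 0) :
    HasLaurentV (fun z => ∑ n ∈ Finset.range M, contract (ξ.1 (-1 - n)) (kernelCoeff a.1 z n) +
      (1 / 2 : ℂ) • killingIso g (val ξ.1 z)) (pvOp a ξ).1 ρ :=
  ((hasLaurentV_innerOp hs hM).mono hρδ).add
    (((Loop.hasLaurentV ξ hξ).map (killingIso g).toLinearMap).smul (1 / 2))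

/-- The Cauchy kernel part is the Plemelj formula for Iξ. The part with h(w - z) is continuous on
the circle and reduces to a residue at w = 0. -/
theorem isScalarPV_pvOp {s : ℂ → g ⊗[ℂ] g} {a : TaylorCoeff (g ⊗[ℂ] g)} {r₀ ρ : ℝ}
    (hs : HasTaylorV s a.1 r₀) {ξ : Loop (Module.Dual ℂ g)} (hξ : ConvergesOn ξ.1 ρ) {z : ℂ}
    (h0 : 0 < ‖z‖) (hz : ‖z‖ < min (r₀ / 2) ρ) (φ : Module.Dual ℂ g) :
    IsScalarPV (fun w => φ (contract (val ξ.1 w) ((w - z)⁻¹ • casimir g + s (w - z)))) z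
      (φ (val (pvOp a ξ).1 z)) := by
  obtain ⟨M, hM⟩ := exists_nat_bound ξ.2.1
  have hzr : ‖z‖ < r₀ / 2 := hz.trans_le (min_le_left _ _)
  have hzρ : ‖z‖ < ρ := hz.trans_le (min_le_right _ _)
  have hz0 : z ≠ 0 := norm_pos_iff.mp h0
  have hz' : ‖-z‖ < r₀ := by rw [norm_neg]; linarith
  have hL := Loop.hasLaurentV ξ hξ
  have h1 := IsScalarPV.of_laurent ((hL.map (killingIso g).toLinearMap).hasLaurent φ) (M := M)
    (fun n hn => by rw [hM n hn, map_zero, map_zero]) h0 hzρ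
  -- the regular part
  have hρ' : ‖z‖ < min ρ (r₀ - ‖-z‖) := lt_min hzρ (by rw [norm_neg]; linarith)
  have h2 := (hL.mono (min_le_left ρ (r₀ - ‖-z‖))).bilin (contractHom.compr₂ φ)
    ((hs.shift hz').hasLaurentV.mono (min_le_right ρ _))
  have h3 := IsScalarPV.of_continuousOn hz0 (h2.continuousOn_sphere h0 hρ')
  rw [h2.circleIntegral_eq h0 hρ', inv_mul_cancel_left₀ Complex.two_pi_I_ne_zero] at h3
  have h4 : (∑ᶠ k : ℤ, (contractHom.compr₂ φ) (ξ.1 k)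
      (if -1 - k < 0 then 0 else shiftVec a.1 (-z) (-1 - k).toNat)) =
      ∑ n ∈ Finset.range M, φ (contract (ξ.1 (-1 - n)) (shiftVec a.1 (-z) n)) := by
    rw [finsum_eq_sum_of_support_subset (s := (Finset.range M).image fun n : ℕ => -1 - (n : ℤ)),
      Finset.sum_image (fun a _ b _ hab => by simpa using hab)]
    · refine Finset.sum_congr rfl fun n _ => ?_
      rw [if_neg (by omega), show (-1 - (-1 - (n : ℤ))).toNat = n by omega]
      rfl
    · intro k hk
      rw [Finset.mem_coe, Finset.mem_image]
      have hk0 : ¬ -1 - k < 0 := fun h => hk (by simp only [if_pos h, map_zero])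
      refine ⟨(-1 - k).toNat, Finset.mem_range.mpr ?_, by omega⟩
      by_contra h
      refine hk ?_
      simp only [hM k (by omega), map_zero, LinearMap.zero_apply]
  rw [h4] at h3
  have h5 : φ (val (pvOp a ξ).1 z) = (1 / 2 * φ (killingIso g (val ξ.1 z)) -
      ∑ m ∈ Finset.range M, φ (killingIso g (ξ.1 (-(m : ℤ) - 1))) * z ^ (-(m : ℤ) - 1)) +
      ∑ n ∈ Finset.range M, φ (contract (ξ.1 (-1 - n)) (shiftVec a.1 (-z) n)) := by
    rw [(hasLaurentV_pvOp (hs.mono (min_le_right ρ r₀)) le_rfl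
      (fun φ z h0 hz => hξ φ z h0 (hz.trans_le (min_le_left _ _))) hM).val_eq h0
      (lt_min hzρ (by linarith))]
    have h6 : ∑ m ∈ Finset.range M, φ (killingIso g (ξ.1 (-(m : ℤ) - 1))) * z ^ (-(m : ℤ) - 1) =
        ∑ m ∈ Finset.range M, z ^ (-1 - (m : ℤ)) * φ (killingIso g (ξ.1 (-1 - m))) :=
      Finset.sum_congr rfl fun m _ => by rw [neg_sub_comm, mul_comm]
    rw [h6]
    simp only [kernelCoeff, map_add, map_sub, map_sum, map_smul, contract_casimir, smul_eq_mul,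
      Finset.sum_sub_distrib]
    ring
  rw [h5]
  refine (h1.add h3).congr fun w hw hwz => ?_
  rw [map_add, map_add, map_smul, map_smul, contract_casimir, sub_eq_add_neg w z]
  rfl

theorem residueOp_equivariant {a : TaylorCoeff (g ⊗[ℂ] g)} {x : g} (hx : ∀ k, ⁅x, a.1 k⁆ = 0)
    (ξ : Loop (Module.Dual ℂ g)) :
    pvOp a (Loop.map (coAd x) ξ) = Loop.map (Ad x) (pvOp a ξ) := by
  have h1 : residueOp a (Loop.map (coAd x) ξ) = Loop.map (Ad x) (residueOp a ξ) := by
    ext n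
    rw [Loop.map_apply, residueOp_apply, residueOp_apply]
    rcases lt_or_ge n 0 with hn | hn
    · rw [residueCoeff_neg _ _ hn, residueCoeff_neg _ _ hn, map_zero]
    · lift n to ℕ using hn
      obtain ⟨M, hM⟩ := exists_nat_bound ξ.2.1
      rw [residueCoeff_natCast hM, residueCoeff_natCast (M := M) fun n hn => by
        rw [Loop.map_apply, hM n hn, map_zero], map_sum]
      refine Finset.sum_congr rfl fun k _ => ?_
      rw [map_smul, Loop.map_apply, contract_coAd (hx _)]
  ext n
  show (residueOp a (Loop.map (coAd x) ξ)).1 n - killingIso g (if n < 0 then coAd x (ξ.1 n) else 0) +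
    (1 / 2 : ℂ) • killingIso g (coAd x (ξ.1 n)) = Ad x ((residueOp a ξ).1 n -
      killingIso g (if n < 0 then ξ.1 n else 0) + (1 / 2 : ℂ) • killingIso g (ξ.1 n))
  rw [h1, Loop.map_apply, map_add, map_sub, map_smul, killingIso_coAd]
  split_ifs
  · rw [killingIso_coAd]
  · simp only [map_zero]

end Operator

/-! ### The operator R of a dynamical r-matrix -/

section DynamicalOperator

variable {g : Type*} [LieRing g] [LieAlgebra ℂ g] [FiniteDimensional ℂ g]
  {H : LieSubalgebra ℂ g} {r : Module.Dual ℂ H → ℂ → g ⊗[ℂ] g} {q : Module.Dual ℂ H}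

theorem eventually_mem_regularSet (hq : q ∈ regularSet r) : ∀ᶠ p in 𝓝 q, p ∈ regularSet r := by
  obtain ⟨r₀, h⟩ := hq
  exact h.eventually_nhds.mono fun p hp => ⟨r₀, hp⟩

/-- Principal values are limits, hence unique, and a Laurent series is determined by its values on a
punctured disc. -/
theorem IsROperator.eq_of_mem {R R' : Module.Dual ℂ H → Loop (Module.Dual ℂ g) →ₗ[ℂ] Loop g}
    (hR : IsROperator r R) (hR' : IsROperator r R') (hq : q ∈ regularSet r) : R q = R' q := by
  obtain ⟨r₀, hn⟩ := exists_noPole hq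
  refine LinearMap.ext fun ξ => ?_
  obtain ⟨ρ, hρ, hξ⟩ := ξ.2.2
  obtain ⟨h1, h2⟩ := hR q hq r₀ ρ hn ξ hξ
  obtain ⟨h1', h2'⟩ := hR' q hq r₀ ρ hn ξ hξ
  exact Loop.ext_of_val (lt_min (half_pos hn.1) hρ) h1 h1' fun z h0 hz => eq_of_forall_dual fun φ =>
    tendsto_nhds_unique (h2 z h0 hz φ).2 (h2' z h0 hz φ).2

variable [LieAlgebra.IsSimple ℂ g]

theorem IsDynamicalRMatrix.exists_hasTaylorV (hr : IsDynamicalRMatrix r) (hq : q ∈ regularSet r)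
    {ρ : ℝ} (hρ : NoPole r q ρ) : ∃ s, HasTaylorV s (regPart r q) ρ ∧
      ∀ x, 0 < ‖x‖ → ‖x‖ < ρ → r q x = x⁻¹ • casimir g + s x := by
  have h := hr.isRegularPart hq hρ
  obtain ⟨s, hs⟩ := HasTaylorV.of_forall fun φ => (h φ).imp fun f hf => hf.1
  refine ⟨s, hs, fun x h0 hx => eq_of_forall_dual fun φ => ?_⟩
  obtain ⟨f, hf, hrf⟩ := h φ
  rw [hrf x h0 hx, map_add, map_smul, smul_eq_mul, mul_comm, (hf x hx).unique (hs φ x hx)]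

/-- The default value 0 of `regPart` is also a convergent series, so the operator is defined for
every q and not only on the regular set. -/
theorem regPart_mem (r : Module.Dual ℂ H → ℂ → g ⊗[ℂ] g) (q : Module.Dual ℂ H) :
    regPart r q ∈ TaylorCoeff (g ⊗[ℂ] g) := by
  unfold regPart
  split_ifs with h
  · obtain ⟨ρ, hρ, h2⟩ := h.choose_spec
    obtain ⟨s, hs⟩ := HasTaylorV.of_forall fun φ => (h2 φ).imp fun f hf => hf.1
    exact ⟨s, ρ, hρ, hs⟩
  · exact Submodule.zero_mem _

/-- `regPart r q`, as an element of the space of convergent power series. -/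
def regSeries (r : Module.Dual ℂ H → ℂ → g ⊗[ℂ] g) (q : Module.Dual ℂ H) :
    TaylorCoeff (g ⊗[ℂ] g) := ⟨regPart r q, regPart_mem r q⟩

theorem IsDynamicalRMatrix.isROperator_pvOp (hr : IsDynamicalRMatrix r) :
    IsROperator r fun q => pvOp (regSeries r q) := by
  intro q hq r₀ ρ hn ξ hξ
  obtain ⟨s, hs, hrs⟩ := hr.exists_hasTaylorV hq hn
  obtain ⟨M, hM⟩ := exists_nat_bound ξ.2.1
  have hr₀ := hn.1
  refine ⟨(hasLaurentV_pvOp (a := regSeries r q) (hs.mono (δ' := min (r₀ / 2) ρ)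
    ((min_le_left _ _).trans (half_le_self hr₀.le))) le_rfl (fun φ z h0 hz => hξ φ z h0
      (hz.trans_le (min_le_right _ _))) hM).convergesOn, fun z h0 hz φ => ?_⟩
  refine (isScalarPV_pvOp (a := regSeries r q) hs hξ h0 hz φ).congr fun w hw hwz => ?_
  have h1 := hz.trans_le (min_le_left _ _)
  show _ = φ (contract (val ξ.1 w) (r q (w - z)))
  rw [hrs (w - z) (norm_pos_iff.mpr (sub_ne_zero.mpr hwz)) ((norm_sub_le w z).trans_lt (by linarith))]

/-- Ω is invariant, so the zero weight condition passes from r to its regular part and to each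
Taylor coefficient. -/
theorem IsDynamicalRMatrix.lie_regPart (hr : IsDynamicalRMatrix r) (hq : q ∈ regularSet r) {x : g}
    (hx : x ∈ H) (k : ℕ) : ⁅x, regPart r q k⁆ = 0 := by
  obtain ⟨r₀, hn⟩ := exists_noPole hq
  obtain ⟨s, hs, hrs⟩ := hr.exists_hasTaylorV hq hn
  refine eq_of_forall_dual fun φ => ?_
  have h := hs (φ ∘ₗ (LieModule.toEnd ℂ g (g ⊗[ℂ] g) x : Module.End ℂ (g ⊗[ℂ] g)))
  rw [map_zero]
  refine congrFun (h.unique_punctured hn.1 HasTaylor.zero one_pos ?_) k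
  filter_upwards [eventually_punctured hn.1] with w ⟨h0, hw⟩
  have h1 := hr.zero_weight q w (hn.2 w h0 hw) x hx
  rw [hrs w h0 hw, lie_add, lie_smul, lie_casimir, smul_zero, zero_add] at h1
  show φ ⁅x, s w⁆ = 0
  rw [h1, map_zero]

/-- Unitarity read off coefficientwise: Ω is symmetric and 1/x is odd, so the poles cancel. -/
theorem IsDynamicalRMatrix.comm_regPart (hr : IsDynamicalRMatrix r) (hq : q ∈ regularSet r)
    (k : ℕ) : TensorProduct.comm ℂ g g (regPart r q k) = -((-1 : ℂ) ^ k • regPart r q k) := by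
  obtain ⟨r₀, hn⟩ := exists_noPole hq
  obtain ⟨s, hs, hrs⟩ := hr.exists_hasTaylorV hq hn
  refine eq_of_forall_dual fun φ => ?_
  have h := hs (φ ∘ₗ (TensorProduct.comm ℂ g g).toLinearMap)
  have h2 : HasTaylor (fun w => φ (s w) + φ (TensorProduct.comm ℂ g g (s (-w))))
      (fun k => φ (regPart r q k) + (-1) ^ k * φ (TensorProduct.comm ℂ g g (regPart r q k))) r₀ :=
    (hs φ).add fun w hw => (hasSum_congr fun k => by
      rw [neg_pow w]
      simp only [LinearMap.comp_apply, LinearEquiv.coe_coe]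
      ring).mp (h (-w) (by rwa [norm_neg]))
  have h3 := congrFun (h2.unique_punctured hn.1 HasTaylor.zero one_pos (by
    filter_upwards [eventually_punctured hn.1] with w ⟨h0, hw⟩
    have h0' : 0 < ‖-w‖ := by rwa [norm_neg]
    have hw' : ‖-w‖ < r₀ := by rwa [norm_neg]
    have h1 := hr.unitarity q w (hn.2 w h0 hw) (hn.2 _ h0' hw')
    rw [hrs w h0 hw, hrs _ h0' hw', map_add, map_smul, comm_casimir, inv_neg, neg_smul] at h1
    rw [← map_add, ← map_zero φ, ← h1]
    congr 1
    abel)) k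
  have h4 : ((-1 : ℂ) ^ k) * (-1) ^ k = 1 := by rw [← mul_pow]; norm_num
  rw [map_neg, map_smul, smul_eq_mul]
  linear_combination (-1 : ℂ) ^ k * h3 - φ (TensorProduct.comm ℂ g g (regPart r q k)) * h4

/-- The relation for the regular part holds in a neighbourhood of q and can be differentiated. -/
theorem IsDynamicalRMatrix.comm_dRegPart (hr : IsDynamicalRMatrix r) (hq : q ∈ regularSet r)
    (a : Module.Dual ℂ H) (k : ℕ) :
    TensorProduct.comm ℂ g g (dRegPart r q a k) = -((-1 : ℂ) ^ k • dRegPart r q a k) := by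
  refine eq_of_forall_dual fun φ => ?_
  obtain ⟨L, hL, hL'⟩ := hr.hasFDerivAt_regPart hq φ k
  obtain ⟨M, hM, hM'⟩ := hr.hasFDerivAt_regPart hq (φ ∘ₗ (TensorProduct.comm ℂ g g).toLinearMap) k
  have h1 : HasFDerivAt (fun p => -((-1 : ℂ) ^ k * φ (regPart r p k))) (-((-1 : ℂ) ^ k • L)) q :=
    (hL.const_mul _).neg
  have h2 := h1.congr_of_eventuallyEq (f₁ := fun p => (φ ∘ₗ (TensorProduct.comm ℂ g g).toLinearMap)
    (regPart r p k)) (by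
      filter_upwards [eventually_mem_regularSet hq] with p hp
      show φ (TensorProduct.comm ℂ g g (regPart r p k)) = _
      rw [hr.comm_regPart hp, map_neg, map_smul, smul_eq_mul])
  have h3 := congrArg (fun T : Module.Dual ℂ H →L[ℂ] ℂ => T a) (hM.unique h2)
  simp only [hM', neg_apply, smul_apply, hL'] at h3
  rw [map_neg, map_smul]
  exact h3

theorem IsDynamicalRMatrix.exists_hasTaylorV_dRegPart (hr : IsDynamicalRMatrix r) {r₀ : ℝ}
    (hev : ∀ᶠ q' in 𝓝 q, NoPole r q' r₀) (a : Module.Dual ℂ H) :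
    ∃ s, HasTaylorV s (dRegPart r q a) r₀ ∧
      ∀ x, 0 < ‖x‖ → ‖x‖ < r₀ → partialDeriv r a q x = s x := by
  have h := hr.hasTaylor_dRegPart hev a
  obtain ⟨s, hs⟩ := HasTaylorV.of_forall fun φ => (h φ).imp fun f hf => hf.1
  refine ⟨s, hs, fun x h0 hx => eq_of_forall_dual fun φ => ?_⟩
  obtain ⟨f, hf, hrf⟩ := h φ
  rw [hrf x h0 hx, (hf x hx).unique (hs φ x hx)]

/-- The derivative of `regSeries r` at a regular point. -/
def dRegSeries (hr : IsDynamicalRMatrix r) (hq : q ∈ regularSet r) :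
    Module.Dual ℂ H →ₗ[ℂ] TaylorCoeff (g ⊗[ℂ] g) where
  toFun a := ⟨dRegPart r q a, by
    obtain ⟨r₀, hev⟩ := hq
    obtain ⟨s, hs, -⟩ := hr.exists_hasTaylorV_dRegPart hev a
    exact ⟨s, r₀, hev.self_of_nhds.1, hs⟩⟩
  map_add' a b := by
    refine Subtype.ext (funext fun k => eq_of_forall_dual fun φ => ?_)
    obtain ⟨L, -, hL⟩ := hr.hasFDerivAt_regPart hq φ k
    show φ (dRegPart r q (a + b) k) = φ (dRegPart r q a k + dRegPart r q b k)
    rw [map_add, ← hL, ← hL, ← hL, map_add]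
  map_smul' c a := by
    refine Subtype.ext (funext fun k => eq_of_forall_dual fun φ => ?_)
    obtain ⟨L, -, hL⟩ := hr.hasFDerivAt_regPart hq φ k
    show φ (dRegPart r q (c • a) k) = φ (c • dRegPart r q a k)
    rw [map_smul, ← hL, ← hL, map_smul]

theorem IsDynamicalRMatrix.isHEquivariant_pvOp (hr : IsDynamicalRMatrix r)
    (hq : q ∈ regularSet r) : IsHEquivariant H (pvOp (regSeries r q)) :=
  fun _ hx ξ => residueOp_equivariant (fun k => hr.lie_regPart hq hx k) ξ

end DynamicalOperator

/-! ### The residue pairing -/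

namespace Loop

variable {V : Type*} [AddCommGroup V] [Module ℂ V]

theorem finite_support_pairing (η : Loop (Module.Dual ℂ V)) (X : Loop V) :
    (Function.support fun k : ℤ => η.1 k (X.1 (-1 - k))).Finite := by
  obtain ⟨N, hN⟩ := η.2.1
  obtain ⟨M, hM⟩ := X.2.1
  refine (Set.finite_Icc N (-1 - M)).subset fun k hk => ⟨not_lt.mp fun h => hk ?_,
    not_lt.mp fun h => hk ?_⟩
  · simp only [hN k h, LinearMap.zero_apply]
  · simp only [hM (-1 - k) (by omega), map_zero]

variable (V) in
/-- The residue pairing as a bilinear map. -/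
def pairingHom : Loop (Module.Dual ℂ V) →ₗ[ℂ] Loop V →ₗ[ℂ] ℂ :=
  LinearMap.mk₂ ℂ pairing
    (fun η η' X => (finsum_congr fun _ => rfl).trans
      (finsum_add_distrib (finite_support_pairing η X) (finite_support_pairing η' X)))
    (fun c η X => by
      unfold pairing
      rw [smul_finsum]
      rfl)
    (fun η X Y => by
      refine Eq.trans ?_
        (finsum_add_distrib (finite_support_pairing η X) (finite_support_pairing η Y))
      exact finsum_congr fun k => map_add (η.1 k) _ _)
    (fun c η X => by
      unfold pairing
      rw [smul_finsum]
      exact finsum_congr fun k => map_smul (η.1 k) _ _)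

theorem pairingHom_apply (η : Loop (Module.Dual ℂ V)) (X : Loop V) :
    pairingHom V η X = pairing η X := rfl

theorem pairing_eq_sum {η : Loop (Module.Dual ℂ V)} {X : Loop V} {M : ℕ}
    (hM : ∀ n < -(M : ℤ), η.1 n = 0) (hX : ∀ n < 0, X.1 n = 0) :
    pairing η X = ∑ n ∈ Finset.range M, η.1 (-1 - n) (X.1 n) := by
  unfold pairing
  rw [finsum_eq_sum_of_support_subset (s := (Finset.range M).image fun n : ℕ => -1 - (n : ℤ)),
    Finset.sum_image (fun a _ b _ hab => by simpa using hab)]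
  · refine Finset.sum_congr rfl fun n _ => ?_
    rw [show -1 - (-1 - (n : ℤ)) = n by ring]
  · intro k hk
    rw [Finset.mem_coe, Finset.mem_image]
    have hk0 : ¬ -1 - k < 0 := fun h => hk (by simp only [hX _ h, map_zero])
    refine ⟨(-1 - k).toNat, Finset.mem_range.mpr ?_, by omega⟩
    by_contra h
    refine hk ?_
    simp only [hM k (by omega), LinearMap.zero_apply]

theorem const_add (x y : V) : const (x + y) = const x + const y :=
  Subtype.ext (Pi.single_add (f := fun _ : ℤ => V) 0 x y)

theorem const_zero : const (0 : V) = 0 := Subtype.ext (Pi.single_zero (M := fun _ : ℤ => V) 0)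

end Loop

/-! ### Derivatives of R in q -/

section Derivatives

variable {g : Type*} [LieRing g] [LieAlgebra ℂ g] {H : LieSubalgebra ℂ g}

theorem iStar_add (ξ η : Loop (Module.Dual ℂ g)) : iStar H (ξ + η) = iStar H ξ + iStar H η := rfl

theorem iStar_eq_zero {ξ : Loop (Module.Dual ℂ g)} (hξ : ∀ n < 0, ξ.1 n = 0) : iStar H ξ = 0 := by
  rw [iStar, hξ (-1) (by norm_num), LinearMap.zero_comp]

variable [FiniteDimensional ℂ g] {q : Module.Dual ℂ H}

theorem eventually_line {p : Module.Dual ℂ H → Prop} (h : ∀ᶠ q' in 𝓝 q, p q')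
    (a : Module.Dual ℂ H) : ∀ᶠ t : ℂ in 𝓝 0, p (q + t • a) := by
  have : Filter.Tendsto (fun t : ℂ => q + t • a) (𝓝 0) (𝓝 q) := by
    have h2 : ContinuousAt (fun t : ℂ => q + t • a) 0 := by fun_prop
    simpa [ContinuousAt] using h2
  exact this.eventually h

theorem HasLoopDeriv.congr {F G : Module.Dual ℂ H → Loop g} {a : Module.Dual ℂ H} {D : Loop g}
    (h : HasLoopDeriv F a q D) (hFG : ∀ᶠ p in 𝓝 q, F p = G p) : HasLoopDeriv G a q D := by
  obtain ⟨ρ, hρ, h1, h2, h3⟩ := h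
  have hFG' := eventually_line hFG a
  refine ⟨ρ, hρ, ?_, h2, fun z h0 hz φ => (h3 z h0 hz φ).congr_of_eventuallyEq ?_⟩
  · filter_upwards [h1, hFG'] with t ht ht'
    rwa [← ht']
  · filter_upwards [hFG'] with t ht
    rw [ht]

/-- The functional `a ↦ (∂_a R ξ, η)` on `h*`, as an element of `h`. -/
def dPairing (dA : Module.Dual ℂ H →ₗ[ℂ] TaylorCoeff (g ⊗[ℂ] g)) :
    Loop (Module.Dual ℂ g) →ₗ[ℂ] Loop (Module.Dual ℂ g) →ₗ[ℂ] H :=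
  LinearMap.mk₂ ℂ (fun ξ η => (Module.evalEquiv ℂ H).symm
      (Loop.pairingHom g η ∘ₗ residueOp.flip ξ ∘ₗ dA))
    (fun ξ ξ' η => by rw [map_add, LinearMap.add_comp, LinearMap.comp_add, map_add])
    (fun c ξ η => by rw [map_smul, LinearMap.smul_comp, LinearMap.comp_smul, map_smul])
    (fun ξ η η' => by rw [map_add, LinearMap.add_comp, map_add])
    (fun c ξ η => by rw [map_smul, LinearMap.smul_comp, map_smul])

theorem apply_dPairing (dA : Module.Dual ℂ H →ₗ[ℂ] TaylorCoeff (g ⊗[ℂ] g))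
    (ξ η : Loop (Module.Dual ℂ g)) (a : Module.Dual ℂ H) :
    a (dPairing dA ξ η) = Loop.pairing η (residueOp (dA a) ξ) :=
  Module.apply_evalEquiv_symm_apply ℂ H a _

variable [LieAlgebra.IsSimple ℂ g]

/-- The equation at q involves only the germ of R at q, which allows passing from one operator to
any other agreeing with it nearby. -/
theorem SatisfiesMDYBE.congr {R R' : Module.Dual ℂ H → Loop (Module.Dual ℂ g) →ₗ[ℂ] Loop g} {c : ℂ}
    (h : SatisfiesMDYBE R c q) (hR : ∀ᶠ p in 𝓝 q, R p = R' p) : SatisfiesMDYBE R' c q := by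
  intro ξ η
  obtain ⟨D₁, D₂, v, h1, h2, h3, h4⟩ := h ξ η
  refine ⟨D₁, D₂, v, h1.congr (hR.mono fun p hp => by rw [hp]),
    h2.congr (hR.mono fun p hp => by rw [hp]), h3.congr_of_eventuallyEq
      (hR.mono fun p hp => by simp only [hp]), ?_⟩
  rw [← hR.self_of_nhds]
  exact h4

variable {r : Module.Dual ℂ H → ℂ → g ⊗[ℂ] g}

/-- At a fixed z, the value is a finite sum of shifted Taylor coefficients of the regular part plus
terms constant in q. -/
theorem IsDynamicalRMatrix.hasLoopDeriv_pvOp (hr : IsDynamicalRMatrix r) (hq : q ∈ regularSet r)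
    (a : Module.Dual ℂ H) (η : Loop (Module.Dual ℂ g)) :
    HasLoopDeriv (fun p => pvOp (regSeries r p) η) a q (residueOp (dRegSeries hr hq a) η) := by
  obtain ⟨r₀, hev⟩ := id hq
  obtain ⟨ρ, hρ, hη⟩ := η.2.2
  obtain ⟨M, hM⟩ := exists_nat_bound η.2.1
  obtain ⟨s, hs, -⟩ := hr.exists_hasTaylorV_dRegPart hev a
  have hr₀ : 0 < r₀ := hev.self_of_nhds.1
  have hη' : ConvergesOn η.1 (min r₀ ρ) := fun φ z h0 hz => hη φ z h0 (hz.trans_le (min_le_right _ _))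
  have hp : ∀ p, p ∈ regularSet r → NoPole r p r₀ → ∃ s, HasTaylorV s (regPart r p) r₀ ∧
      HasLaurentV (fun z => ∑ n ∈ Finset.range M,
        contract (η.1 (-1 - n)) (kernelCoeff (regPart r p) z n) +
        (1 / 2 : ℂ) • killingIso g (val η.1 z)) (pvOp (regSeries r p) η).1 (min r₀ ρ) :=
    fun p hp hn => by
      obtain ⟨s, hs, -⟩ := hr.exists_hasTaylorV hp hn
      exact ⟨s, hs, hasLaurentV_pvOp (a := regSeries r p) hs (min_le_left _ _) hη' hM⟩
  have hD : HasLaurentV _ (residueOp (dRegSeries hr hq a) η).1 r₀ :=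
    hasLaurentV_residueCoeff (ξ := η.1) hs hM
  have hline := eventually_line ((eventually_mem_regularSet hq).and hev) a
  refine ⟨min r₀ ρ, lt_min hr₀ hρ, ?_, (hD.mono (min_le_left _ _)).convergesOn,
    fun z h0 hz φ => ?_⟩
  · filter_upwards [hline] with t ht
    exact (hp _ ht.1 ht.2).choose_spec.2.convergesOn
  · have hzr : ‖z‖ < r₀ := hz.trans_le (min_le_left _ _)
    have hzr' : ‖-z‖ < r₀ := by rwa [norm_neg]
    rw [hD.val_eq h0 hzr, map_sum]
    have h1 : HasDerivAt (fun t : ℂ => ∑ n ∈ Finset.range M,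
        (shiftCoeff (fun k => (φ ∘ₗ contract (η.1 (-1 - n))) (regPart r (q + t • a) k)) (-z) n -
          φ (contract (η.1 (-1 - n)) (z ^ (-1 - (n : ℤ)) • casimir g))) +
        φ ((1 / 2 : ℂ) • killingIso g (val η.1 z)))
        (∑ n ∈ Finset.range M,
          φ (contract (η.1 (-1 - n)) (shiftVec (dRegPart r q a) (-z) n))) 0 := by
      refine (HasDerivAt.fun_sum fun n _ => ?_).add_const _
      refine HasDerivAt.sub_const _ ?_
      obtain ⟨L, hL, hL'⟩ := hr.hasFDerivAt_shiftCoeff hev (y := -z) (by rwa [norm_neg]) hzr'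
        (φ ∘ₗ contract (η.1 (-1 - n))) n
      rw [← LinearMap.comp_apply, hs.dual_shiftVec hzr', ← hL']
      exact hasDerivAt_line hL a
    refine h1.congr_of_eventuallyEq ?_
    filter_upwards [hline] with t ht
    obtain ⟨s', hs', hF⟩ := hp _ ht.1 ht.2
    rw [hF.val_eq h0 hz, map_add, map_sum]
    simp only [kernelCoeff, map_sub]
    simp only [← LinearMap.comp_apply φ, hs'.dual_shiftVec hzr']

/-- Only finitely many Taylor coefficients of the regular part meet the principal parts of ξ and η,
and each is differentiable in q. The contributions of the pole and of I/2 are constant. -/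
theorem IsDynamicalRMatrix.hasFDerivAt_pairing (hr : IsDynamicalRMatrix r)
    (hq : q ∈ regularSet r) (ξ η : Loop (Module.Dual ℂ g)) :
    HasFDerivAt (fun p => Loop.pairing η (pvOp (regSeries r p) ξ))
      (LinearMap.toContinuousLinearMap
        (Module.Dual.eval ℂ H (dPairing (dRegSeries hr hq) ξ η))) q := by
  obtain ⟨M₁, hM₁⟩ := exists_nat_bound ξ.2.1
  obtain ⟨M₂, hM₂⟩ := exists_nat_bound η.2.1
  have hsum : ∀ a : TaylorCoeff (g ⊗[ℂ] g), Loop.pairing η (residueOp a ξ) =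
      ∑ n ∈ Finset.range M₂, ∑ m ∈ Finset.range M₁, (((n + m).choose m : ℂ) * (-1) ^ n) *
        (η.1 (-1 - n) ∘ₗ contract (ξ.1 (-1 - m))) (a.1 (n + m)) := fun a => by
    rw [Loop.pairing_eq_sum hM₂ fun n hn => residueOp_apply_neg a ξ hn]
    refine Finset.sum_congr rfl fun n _ => ?_
    rw [residueOp_apply, residueCoeff_natCast hM₁, map_sum]
    exact Finset.sum_congr rfl fun m _ => map_smul _ _ _
  choose L hL hL' using fun (φ : Module.Dual ℂ (g ⊗[ℂ] g)) k => hr.hasFDerivAt_regPart hq φ k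
  have h1 : HasFDerivAt (fun p => Loop.pairing η (residueOp (regSeries r p) ξ) +
      Loop.pairingHom g η (-loopIso g (Loop.negPart ξ) + (1 / 2 : ℂ) • loopIso g ξ))
      (∑ n ∈ Finset.range M₂, ∑ m ∈ Finset.range M₁, (((n + m).choose m : ℂ) * (-1) ^ n) •
        L (η.1 (-1 - n) ∘ₗ contract (ξ.1 (-1 - m))) (n + m)) q := by
    simp only [hsum]
    exact (HasFDerivAt.fun_sum fun n _ => HasFDerivAt.fun_sum fun m _ =>
      (hL _ _).const_mul _).add_const _
  refine (h1.congr_of_eventuallyEq (Filter.Eventually.of_forall fun p => ?_)).congr_fderiv ?_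
  · show Loop.pairingHom g η (residueOp (regSeries r p) ξ - loopIso g (Loop.negPart ξ) +
      (1 / 2 : ℂ) • loopIso g ξ) = Loop.pairingHom g η (residueOp (regSeries r p) ξ) + _
    rw [← map_add]
    congr 1
    abel
  · ext a
    show _ = a (dPairing (dRegSeries hr hq) ξ η)
    rw [apply_dPairing, hsum]
    simp only [sum_apply, smul_apply, hL', smul_eq_mul]
    rfl

end Derivatives

/-! ### Reduction of the modified equation to monomials -/

section Defect

variable {g : Type*} [LieRing g] [LieAlgebra ℂ g] {H : LieSubalgebra ℂ g}

theorem eq_zero_of_forall_dual_apply {v : H} (h : ∀ a : Module.Dual ℂ H, a v = 0) : v = 0 :=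
  eq_of_forall_dual fun a => by rw [h, map_zero]

variable [FiniteDimensional ℂ g]

theorem Loop.bracket_zero_left (X : Loop g) : Loop.bracket 0 X = 0 := by
  simpa using Loop.bracket_smul_left 0 0 X

theorem Loop.bracket_zero_right (X : Loop g) : Loop.bracket X 0 = 0 := by
  simpa using Loop.bracket_smul_right 0 X 0

theorem pairing_residueOp_eq_zero (a : TaylorCoeff (g ⊗[ℂ] g)) (ξ : Loop (Module.Dual ℂ g))
    {η : Loop (Module.Dual ℂ g)} (hη : ∀ n < 0, η.1 n = 0) :
    Loop.pairing η (residueOp a ξ) = 0 := by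
  rw [Loop.pairing_eq_sum (M := 0) (by simpa using hη) fun n hn => residueOp_apply_neg a ξ hn,
    Finset.sum_range_zero]

variable [LieAlgebra.IsSimple ℂ g]

/-- The difference of the two sides of the modified dynamical Yang–Baxter equation for
`innerOp A + I / 2`, where `dA` is the derivative of `A`. -/
def mdybeDefect (A : TaylorCoeff (g ⊗[ℂ] g)) (dA : Module.Dual ℂ H →ₗ[ℂ] TaylorCoeff (g ⊗[ℂ] g))
    (ξ η : Loop (Module.Dual ℂ g)) : Loop g :=
  Loop.bracket (innerOp A ξ) (innerOp A η)
    - innerOp A (loopIsoInv g (Loop.bracket (innerOp A ξ) (loopIso g η) +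
        Loop.bracket (loopIso g ξ) (innerOp A η) + Loop.bracket (loopIso g ξ) (loopIso g η)))
    + residueOp (dA (iStar H ξ)) η - residueOp (dA (iStar H η)) ξ
    + Loop.const (dPairing dA ξ η : g)

variable {A : TaylorCoeff (g ⊗[ℂ] g)} {dA : Module.Dual ℂ H →ₗ[ℂ] TaylorCoeff (g ⊗[ℂ] g)}

theorem mdybeDefect_add_left (ξ ξ' η : Loop (Module.Dual ℂ g)) :
    mdybeDefect A dA (ξ + ξ') η = mdybeDefect A dA ξ η + mdybeDefect A dA ξ' η := by
  simp only [mdybeDefect, map_add, LinearMap.add_apply, Loop.bracket_add_left, iStar_add,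
    AddMemClass.coe_add, Loop.const_add]
  abel

theorem mdybeDefect_add_right (ξ η η' : Loop (Module.Dual ℂ g)) :
    mdybeDefect A dA ξ (η + η') = mdybeDefect A dA ξ η + mdybeDefect A dA ξ η' := by
  simp only [mdybeDefect, map_add, LinearMap.add_apply, Loop.bracket_add_right, iStar_add,
    AddMemClass.coe_add, Loop.const_add]
  abel

/-- S cancels the principal part of Iξ exactly; S + I corresponds to expanding the kernel in |w| >
|z|. -/
theorem innerOp_add_loopIso_apply_neg (ξ : Loop (Module.Dual ℂ g)) {n : ℤ} (hn : n < 0) :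
    (innerOp A ξ + loopIso g ξ).1 n = 0 := by
  rw [Loop.add_apply, innerOp_apply, residueOp_apply_neg _ _ hn, if_pos hn, zero_sub]
  exact neg_add_cancel _

/-- If ξ is a power series, Sξ and the derivative terms vanish, and the remaining argument of S is
I⁻¹[Iξ, (S + I)η]. This is again a power series and so is killed by S. -/
theorem mdybeDefect_of_pos_left {ξ : Loop (Module.Dual ℂ g)} (hξ : ∀ n < 0, ξ.1 n = 0)
    (η : Loop (Module.Dual ℂ g)) : mdybeDefect A dA ξ η = 0 := by
  have h1 : dPairing dA ξ η = 0 := eq_zero_of_forall_dual_apply fun a => by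
    rw [apply_dPairing, residueOp_eq_zero _ hξ, ← Loop.pairingHom_apply, map_zero]
  rw [mdybeDefect, innerOp_eq_zero A hξ, residueOp_eq_zero _ hξ, iStar_eq_zero hξ, h1,
    Loop.bracket_zero_left, Loop.bracket_zero_left, zero_add, ← Loop.bracket_add_right, map_zero dA,
    map_zero residueOp, LinearMap.zero_apply, ZeroMemClass.coe_zero, Loop.const_zero, innerOp_eq_zero]
  · abel
  · intro n hn
    rw [Loop.map_apply, Loop.bracket_apply_eq_zero (fun k hk => by
      rw [Loop.map_apply, hξ k hk, map_zero]) (fun k hk => innerOp_add_loopIso_apply_neg η hk) hn,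
      map_zero]

theorem mdybeDefect_of_pos_right (ξ : Loop (Module.Dual ℂ g)) {η : Loop (Module.Dual ℂ g)}
    (hη : ∀ n < 0, η.1 n = 0) : mdybeDefect A dA ξ η = 0 := by
  have h1 : dPairing dA ξ η = 0 := eq_zero_of_forall_dual_apply fun a => by
    rw [apply_dPairing, pairing_residueOp_eq_zero _ _ hη]
  rw [mdybeDefect, innerOp_eq_zero A hη, residueOp_eq_zero _ hη, iStar_eq_zero hη, h1,
    Loop.bracket_zero_right, Loop.bracket_zero_right,
    add_zero (Loop.bracket _ _), ← Loop.bracket_add_left, map_zero dA,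
    map_zero residueOp, LinearMap.zero_apply, ZeroMemClass.coe_zero, Loop.const_zero, innerOp_eq_zero]
  · abel
  · intro n hn
    rw [Loop.map_apply, Loop.bracket_apply_eq_zero (fun k hk => innerOp_add_loopIso_apply_neg ξ hk)
      (fun k hk => by rw [Loop.map_apply, hη k hk, map_zero]) hn, map_zero]

/-- By biadditivity and the two vanishing statements, only the finitely many negative powers of ξ
and η matter. -/
theorem mdybeDefect_eq_zero (h : ∀ (m n : ℕ) (α β : Module.Dual ℂ g),
    mdybeDefect A dA (Loop.monomial (-1 - m) α) (Loop.monomial (-1 - n) β) = 0)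
    (ξ η : Loop (Module.Dual ℂ g)) : mdybeDefect A dA ξ η = 0 := by
  refine Loop.induction_on ξ (fun ξ hξ => mdybeDefect_of_pos_left hξ η) (fun m α => ?_)
    fun ξ ξ' h1 h2 => by rw [mdybeDefect_add_left, h1, h2, add_zero]
  exact Loop.induction_on η (fun η hη => mdybeDefect_of_pos_right _ hη) (fun n β => h m n α β)
    fun η η' h1 h2 => by rw [mdybeDefect_add_right, h1, h2, add_zero]

/-- Put R = S + I/2. The mixed terms [Sξ, Iη] and [Iξ, Sη] outside S cancel, and [Iξ, Iη] is left
with coefficient 1/4 - 1/2 = -1/4. -/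
theorem mdybe_of_defect_eq_zero {ξ η : Loop (Module.Dual ℂ g)} (h : mdybeDefect A dA ξ η = 0) :
    Loop.bracket (pvOp A ξ) (pvOp A η)
        - pvOp A (loopIsoInv g (Loop.bracket (pvOp A ξ) (loopIso g η)) +
            loopIsoInv g (Loop.bracket (loopIso g ξ) (pvOp A η)))
        + residueOp (dA (iStar H ξ)) η - residueOp (dA (iStar H η)) ξ
        + Loop.const (dPairing dA ξ η : g) =
      (-1 / 4 : ℂ) • Loop.bracket (loopIso g ξ) (loopIso g η) := by
  have h1 : ∀ X : Loop g, loopIso g (loopIsoInv g X) = X := fun X =>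
    Subtype.ext (funext fun n => (killingIso g).apply_symm_apply (X.1 n))
  have h2 : ∀ X, pvOp A X = innerOp A X + (1 / 2 : ℂ) • loopIso g X := fun X => rfl
  rw [← sub_eq_zero, ← h, mdybeDefect]
  simp only [h2, Loop.bracket_add_left, Loop.bracket_add_right, Loop.bracket_smul_left,
    Loop.bracket_smul_right, map_add, map_smul, h1]
  module

end Defect

/-! ### Two-variable expansions of the terms of the Yang–Baxter equation -/

section BilinearTaylor

variable {V W : Type*} [AddCommGroup V] [Module ℂ V] [FiniteDimensional ℂ V]
  [AddCommGroup W] [Module ℂ W] [FiniteDimensional ℂ W]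

namespace HasTaylorV

variable {s : ℂ → V} {t : ℂ → W} {a : ℕ → V} {b : ℕ → W} {δ δ' : ℝ} (B : V →ₗ[ℂ] W →ₗ[ℂ] ℂ)

theorem bilin (hs : HasTaylorV s a δ) (ht : HasTaylorV t b δ) :
    HasTaylor₂ (fun x y => B (s x) (t y)) (fun m n => B (a m) (b n)) δ := by
  have h := HasTaylor₂.sum (s := Finset.univ) fun i _ => HasTaylor₂.sum (s := Finset.univ)
    fun j _ => HasTaylor₂.const_mul (B (Module.finBasis ℂ V i) (Module.finBasis ℂ W j))
      (HasTaylor₂.fst_mul_snd (hs ((Module.finBasis ℂ V).coord i))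
        (ht ((Module.finBasis ℂ W).coord j)))
  have e : (fun m n => B (a m) (b n)) = fun m n => ∑ i, ∑ j,
      B (Module.finBasis ℂ V i) (Module.finBasis ℂ W j) *
        ((Module.finBasis ℂ V).coord i (a m) * (Module.finBasis ℂ W).coord j (b n)) :=
    funext fun m => funext fun n => bilin_eq_sum B _ _
  rw [e]
  exact h.congr fun x y _ _ => (bilin_eq_sum B _ _).symm

/-- Made for [r¹²(x - y), r¹³(x - z)], with `s` the regular part of r¹² and `t` the expansion of r¹³
at x = 0; `bilin_sub_snd` serves [r¹²(x - y), r²³(y - z)]. -/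
theorem bilin_sub_fst (hs : HasTaylorV s a δ') (ht : HasTaylorV t b δ) (hδ : 2 * δ ≤ δ') :
    HasTaylor₂ (fun x y => B (s (x - y)) (t x))
      (fun m n => ∑ p ∈ Finset.HasAntidiagonal.antidiagonal m,
        B (a (p.2 + n)) (b p.1) * (((p.2 + n).choose n : ℂ) * (-1) ^ n)) δ := by
  have h := HasTaylor₂.sum (s := Finset.univ) fun i _ => HasTaylor₂.sum (s := Finset.univ)
    fun j _ => HasTaylor₂.const_mul (B (Module.finBasis ℂ V i) (Module.finBasis ℂ W j))
      ((HasTaylor₂.sub_arg (hs ((Module.finBasis ℂ V).coord i)) hδ).fst_mul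
        (ht ((Module.finBasis ℂ W).coord j)))
  have e : (fun m n => ∑ p ∈ Finset.HasAntidiagonal.antidiagonal m,
      B (a (p.2 + n)) (b p.1) * (((p.2 + n).choose n : ℂ) * (-1) ^ n)) = fun m n => ∑ i, ∑ j,
      B (Module.finBasis ℂ V i) (Module.finBasis ℂ W j) *
        ∑ p ∈ Finset.HasAntidiagonal.antidiagonal m, (Module.finBasis ℂ W).coord j (b p.1) *
          ((Module.finBasis ℂ V).coord i (a (p.2 + n)) * ((p.2 + n).choose n : ℂ) * (-1) ^ n) := by
    funext m n
    simp only [Finset.mul_sum, bilin_eq_sum B (a _), Finset.sum_mul]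
    rw [Finset.sum_comm]
    refine Finset.sum_congr rfl fun i _ => Finset.sum_comm.trans ?_
    refine Finset.sum_congr rfl fun j _ => Finset.sum_congr rfl fun p _ => ?_
    ring
  rw [e]
  refine h.congr fun x y _ _ => ?_
  rw [bilin_eq_sum B]
  simp only [mul_comm ((Module.finBasis ℂ W).coord _ _)]

theorem bilin_sub_snd (hs : HasTaylorV s a δ') (ht : HasTaylorV t b δ) (hδ : 2 * δ ≤ δ') :
    HasTaylor₂ (fun x y => B (s (x - y)) (t y))
      (fun m n => ∑ p ∈ Finset.HasAntidiagonal.antidiagonal n,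
        B (a (m + p.2)) (b p.1) * (((m + p.2).choose p.2 : ℂ) * (-1) ^ p.2)) δ := by
  have h := HasTaylor₂.sum (s := Finset.univ) fun i _ => HasTaylor₂.sum (s := Finset.univ)
    fun j _ => HasTaylor₂.const_mul (B (Module.finBasis ℂ V i) (Module.finBasis ℂ W j))
      ((HasTaylor₂.sub_arg (hs ((Module.finBasis ℂ V).coord i)) hδ).snd_mul
        (ht ((Module.finBasis ℂ W).coord j)))
  have e : (fun m n => ∑ p ∈ Finset.HasAntidiagonal.antidiagonal n,
      B (a (m + p.2)) (b p.1) * (((m + p.2).choose p.2 : ℂ) * (-1) ^ p.2)) = fun m n => ∑ i, ∑ j,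
      B (Module.finBasis ℂ V i) (Module.finBasis ℂ W j) *
        ∑ p ∈ Finset.HasAntidiagonal.antidiagonal n, (Module.finBasis ℂ W).coord j (b p.1) *
          ((Module.finBasis ℂ V).coord i (a (m + p.2)) * ((m + p.2).choose p.2 : ℂ) *
            (-1) ^ p.2) := by
    funext m n
    simp only [Finset.mul_sum, bilin_eq_sum B (a _), Finset.sum_mul]
    rw [Finset.sum_comm]
    refine Finset.sum_congr rfl fun i _ => Finset.sum_comm.trans ?_
    refine Finset.sum_congr rfl fun j _ => Finset.sum_congr rfl fun p _ => ?_
    ring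
  rw [e]
  refine h.congr fun x y _ _ => ?_
  rw [bilin_eq_sum B]
  simp only [mul_comm ((Module.finBasis ℂ W).coord _ _)]

end HasTaylorV

theorem HasTaylorV.comm_neg {g : Type*} [AddCommGroup g] [Module ℂ g] {s : ℂ → g ⊗[ℂ] g}
    {a : ℕ → g ⊗[ℂ] g} {δ : ℝ} (hs : HasTaylorV s a δ)
    (ha : ∀ k, TensorProduct.comm ℂ g g (a k) = -((-1 : ℂ) ^ k • a k)) {w : ℂ} (hw : ‖w‖ < δ) :
    TensorProduct.comm ℂ g g (s (-w)) = -s w := by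
  refine eq_of_forall_dual fun φ => ?_
  have h1 := hs (φ ∘ₗ (TensorProduct.comm ℂ g g).toLinearMap) (-w) (by rwa [norm_neg])
  have h2 := hs (-φ) w hw
  have h3 : φ (-s w) = (-φ) (s w) := by rw [map_neg, LinearMap.neg_apply]
  rw [h3]
  refine h1.unique ((hasSum_congr fun k => ?_).mp h2)
  simp only []
  rw [LinearMap.comp_apply, LinearEquiv.coe_coe, ha, map_neg, map_smul, smul_eq_mul, neg_pow w,
    LinearMap.neg_apply]
  have h4 : ((-1 : ℂ) ^ k) * (-1) ^ k = 1 := by rw [← mul_pow]; norm_num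
  linear_combination φ (a k) * w ^ k * h4

theorem hasTaylor_inv_sub {z : ℂ} (hz : z ≠ 0) :
    HasTaylor (fun w => (w - z)⁻¹) (fun n => -z ^ (-1 - (n : ℤ))) ‖z‖ := fun w hw => by
  have h1 : ‖w / z‖ < 1 := by
    rw [norm_div, div_lt_one (norm_pos_iff.mpr hz)]
    exact hw
  have h2 := (hasSum_geometric_of_norm_lt_one h1).mul_left (-z⁻¹)
  have h3 : w - z ≠ 0 := fun h => by
    rw [sub_eq_zero.mp h] at hw
    exact lt_irrefl _ hw
  have h4 : -z⁻¹ * (1 - w / z)⁻¹ = (w - z)⁻¹ := by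
    rw [neg_mul, ← mul_inv, ← inv_neg]
    congr 1
    field_simp
    ring
  rw [h4] at h2
  refine (hasSum_congr fun n => ?_).mp h2
  show _ = -z ^ (-1 - (n : ℤ)) * w ^ n
  rw [zpow_sub₀ hz, zpow_neg_one, zpow_natCast, div_pow]
  ring

end BilinearTaylor

/-! ### Operators on monomials, and the Yang–Baxter terms in functional form -/

section Monomials

variable {g : Type*} [LieRing g] [LieAlgebra ℂ g] {H : LieSubalgebra ℂ g}

theorem iStar_monomial (m : ℕ) (α : Module.Dual ℂ g) :
    iStar H (Loop.monomial (-1 - m) α) = if m = 0 then α.comp H.subtype else 0 := by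
  rw [iStar, Loop.monomial_apply]
  split_ifs with h1 h2 h2
  · rfl
  · omega
  · omega
  · exact LinearMap.zero_comp _

theorem Loop.pairing_monomial (n : ℕ) (β : Module.Dual ℂ g) {X : Loop g}
    (hX : ∀ n < 0, X.1 n = 0) : Loop.pairing (Loop.monomial (-1 - n) β) X = β (X.1 n) := by
  rw [Loop.pairing_eq_sum (M := n + 1) (fun k hk => by
    rw [Loop.monomial_apply, if_neg (by push_cast at hk; omega)]) hX, Finset.sum_eq_single n]
  · rw [Loop.monomial_apply, if_pos rfl]
  · intro k _ hk
    rw [Loop.monomial_apply, if_neg (by omega), LinearMap.zero_apply]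
  · exact fun h => absurd (Finset.self_mem_range_succ n) h

theorem Loop.map_monomial {V W : Type*} [AddCommGroup V] [Module ℂ V] [AddCommGroup W]
    [Module ℂ W] (T : V →ₗ[ℂ] W) (n : ℤ) (v : V) :
    Loop.map T (Loop.monomial n v) = Loop.monomial n (T v) := by
  ext k
  rw [Loop.map_apply, Loop.monomial_apply, Loop.monomial_apply]
  split_ifs
  · rfl
  · exact map_zero T

theorem sum_monomial {f : Module.Dual ℂ g → ℕ → g} (hf : ∀ n, f 0 n = 0) (m : ℕ)
    (α : Module.Dual ℂ g) : ∑ n ∈ Finset.range (m + 1),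
      f ((Loop.monomial (-1 - m) α).1 (-1 - n)) n = f α m := by
  rw [Finset.sum_eq_single m]
  · rw [Loop.monomial_apply, if_pos rfl]
  · intro n _ hn
    rw [Loop.monomial_apply, if_neg (by omega), hf]
  · exact fun h => absurd (Finset.self_mem_range_succ m) h

theorem monomial_bound (m : ℕ) (α : Module.Dual ℂ g) :
    ∀ n < -((m + 1 : ℕ) : ℤ), (Loop.monomial (-1 - m) α).1 n = 0 := fun n hn => by
  rw [Loop.monomial_apply, if_neg (by push_cast at hn; omega)]

variable [FiniteDimensional ℂ g] {r : Module.Dual ℂ H → ℂ → g ⊗[ℂ] g} {q : Module.Dual ℂ H}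

theorem shiftVec_zero (y : ℂ) (n : ℕ) : shiftVec (0 : ℕ → g ⊗[ℂ] g) y n = 0 := by
  simp [shiftVec, shiftCoeff]

theorem Loop.bracket_monomial_monomial (i j : ℤ) (x y : g) :
    Loop.bracket (Loop.monomial i x) (Loop.monomial j y) = Loop.monomial (i + j) ⁅x, y⁆ := by
  ext k
  rw [Loop.bracket_monomial_left, Loop.monomial_apply, Loop.monomial_apply]
  by_cases h : k = i + j
  · rw [if_pos h, if_pos (by omega)]
  · rw [if_neg h, if_neg (by omega), lie_zero]

theorem hasLaurentV_residueOp_monomial {s : ℂ → g ⊗[ℂ] g} {a : TaylorCoeff (g ⊗[ℂ] g)} {δ : ℝ}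
    (hs : HasTaylorV s a.1 δ) (m : ℕ) (α : Module.Dual ℂ g) :
    HasLaurentV (fun z => contract α (shiftVec a.1 (-z) m))
      (residueOp a (Loop.monomial (-1 - m) α)).1 δ := by
  exact (hasLaurentV_residueCoeff hs (monomial_bound m α)).congr fun z _ _ =>
    sum_monomial (f := fun α n => contract α (shiftVec a.1 (-z) n))
      (fun n => contract_zero_left _) m α

/-- Linearity of the partial derivative in the direction. -/
theorem RegularAt.sum_partialDeriv {x : ℂ} (h : RegularAt r q x) (a : Module.Dual ℂ H)
    (φ : Module.Dual ℂ (g ⊗[ℂ] g)) :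
    ∑ i, a (Module.finBasis ℂ H i) *
      φ (partialDeriv r ((Module.finBasis ℂ H).coord i) q x) = φ (partialDeriv r a q x) := by
  simp only [h.dual_partialDeriv]
  set L := (fderiv ℂ (fun p : Module.Dual ℂ H × ℂ => φ (r p.1 p.2)) (q, x)).comp
    (ContinuousLinearMap.inl ℂ (Module.Dual ℂ H) ℂ) with hL
  show ∑ i, a (Module.finBasis ℂ H i) * L ((Module.finBasis ℂ H).coord i) = L a
  conv_rhs => rw [← (Module.finBasis ℂ H).sum_dual_apply_smul_coord a]
  simp only [map_sum, map_smul, smul_eq_mul]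

/-- Summing over dual bases of h and h* assembles the partial derivatives into derivatives along the
restrictions of α, β, γ to h, which are the directions i*ξ and i*η of the modified equation. -/
theorem tripleDual_altD_eq {z₁ z₂ z₃ : ℂ} (h12 : RegularAt r q (z₁ - z₂))
    (h23 : RegularAt r q (z₂ - z₃)) (h31 : RegularAt r q (z₃ - z₁)) (α β γ : Module.Dual ℂ g) :
    tripleDual α β γ (altD r q z₁ z₂ z₃) =
      γ (contract β (partialDeriv r (α.comp H.subtype) q (z₂ - z₃))) +
      γ (contract α (TensorProduct.comm ℂ g g
        (partialDeriv r (β.comp H.subtype) q (z₃ - z₁)))) +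
      β (contract α (partialDeriv r (γ.comp H.subtype) q (z₁ - z₂))) := by
  have h1 := h23.sum_partialDeriv (α.comp H.subtype) (γ ∘ₗ contract β)
  have h2 := h31.sum_partialDeriv (β.comp H.subtype)
    (γ ∘ₗ contract α ∘ₗ (TensorProduct.comm ℂ g g).toLinearMap)
  have h3 := h12.sum_partialDeriv (γ.comp H.subtype) (β ∘ₗ contract α)
  rw [tripleDual_altD, Finset.sum_add_distrib, Finset.sum_add_distrib]
  exact congrArg₂ _ (congrArg₂ _ h1 h2) h3

variable [LieAlgebra.IsSimple ℂ g]

theorem hasLaurentV_innerOp_monomial {s : ℂ → g ⊗[ℂ] g} {a : TaylorCoeff (g ⊗[ℂ] g)} {δ : ℝ}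
    (hs : HasTaylorV s a.1 δ) (m : ℕ) (α : Module.Dual ℂ g) :
    HasLaurentV (fun z => contract α (kernelCoeff a.1 z m))
      (innerOp a (Loop.monomial (-1 - m) α)).1 δ := by
  exact (hasLaurentV_innerOp hs (monomial_bound m α)).congr fun z _ _ =>
    sum_monomial (f := fun α n => contract α (kernelCoeff a.1 z n))
      (fun n => contract_zero_left _) m α

theorem innerOp_monomial (a : TaylorCoeff (g ⊗[ℂ] g)) (m : ℕ) (α : Module.Dual ℂ g) :
    innerOp a (Loop.monomial (-1 - m) α) = residueOp a (Loop.monomial (-1 - m) α) -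
      loopIso g (Loop.monomial (-1 - m) α) := by
  ext n
  show _ - killingIso g (if n < 0 then (Loop.monomial (-1 - m) α).1 n else 0) =
    _ - killingIso g ((Loop.monomial (-1 - m) α).1 n)
  split_ifs with h
  · rfl
  · rw [Loop.monomial_apply, if_neg (by omega)]

/-- Invariance of Ω makes this term and the one of `bilin1223_casimir` the same functional up to
sign. Thus Ω¹²/(x - y) contributes a divided difference between r(x - z) and r(y - z). -/
theorem bilin1213_casimir (α β γ : Module.Dual ℂ g) (t : g ⊗[ℂ] g) :
    bilin1213 α β γ (casimir g) t =
      γ (contract ((killingIso g).symm ⁅killingIso g α, killingIso g β⁆) t) := by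
  rw [bilin1213_apply, tripleDual_br1213, comm_casimir, contract_casimir, comp_ad_eq,
    ← lie_skew (killingIso g α), map_neg]

theorem bilin1223_casimir (α β γ : Module.Dual ℂ g) (t : g ⊗[ℂ] g) :
    bilin1223 α β γ (casimir g) t =
      -γ (contract ((killingIso g).symm ⁅killingIso g α, killingIso g β⁆) t) := by
  rw [bilin1223_apply, tripleDual_br1223, contract_casimir, comp_ad_eq, contract_neg_left, map_neg]

/-- The radius ‖z‖ is forced by the pole at w = z; the regular part converges for ‖w‖ < r₀ - ‖z‖,
which is larger since ‖z‖ < r₀/2. -/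
theorem HasTaylorV.kernel {s : ℂ → g ⊗[ℂ] g} {a : ℕ → g ⊗[ℂ] g} {r₀ : ℝ} (hs : HasTaylorV s a r₀)
    {z : ℂ} (h0 : 0 < ‖z‖) (hz : ‖z‖ < r₀ / 2) :
    HasTaylorV (fun w => (w - z)⁻¹ • casimir g + s (w - z)) (kernelCoeff a z) ‖z‖ := fun φ => by
  have h1 := (hs.shift (y := -z) (by rw [norm_neg]; linarith [norm_nonneg z])).mono
    (δ' := ‖z‖) (by rw [norm_neg]; linarith) φ
  have h2 := ((hasTaylor_inv_sub (norm_pos_iff.mp h0)).const_mul (φ (casimir g))).add h1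
  intro w hw
  have h3 : φ ((w - z)⁻¹ • casimir g + s (w - z)) =
      φ (casimir g) * (w - z)⁻¹ + φ (s (w + -z)) := by
    rw [map_add, map_smul, smul_eq_mul, mul_comm, sub_eq_add_neg w z]
  show HasSum _ (φ ((w - z)⁻¹ • casimir g + s (w - z)))
  rw [h3]
  refine (hasSum_congr fun n => ?_).mp (h2 w hw)
  simp only [kernelCoeff]
  rw [ map_sub, map_smul, smul_eq_mul]
  ring

end Monomials

/-! ### From the classical to the modified dynamical Yang–Baxter equation -/

section YangBaxter

variable {g : Type*} [LieRing g] [LieAlgebra ℂ g] [FiniteDimensional ℂ g]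
  [LieAlgebra.IsSimple ℂ g] {H : LieSubalgebra ℂ g} {r : Module.Dual ℂ H → ℂ → g ⊗[ℂ] g}
  {q : Module.Dual ℂ H}

/-- The classical dynamical Yang–Baxter equation at `(x, y, z)`, Taylor expanded at
`x = y = 0`. -/
theorem IsDynamicalRMatrix.taylorCoeff_cdybe (hr : IsDynamicalRMatrix r) {r₀ : ℝ}
    (hev : ∀ᶠ q' in 𝓝 q, NoPole r q' r₀) {z : ℂ} (h0 : 0 < ‖z‖) (hz : ‖z‖ < r₀ / 2)
    (α β γ : Module.Dual ℂ g) (m n : ℕ) :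
    (if m = 0 then γ (contract β (shiftVec (dRegPart r q (α.comp H.subtype)) (-z) n)) else 0) -
    (if n = 0 then γ (contract α (shiftVec (dRegPart r q (β.comp H.subtype)) (-z) m)) else 0) +
    β (contract α (dRegPart r q (γ.comp H.subtype) (m + n))) * ((m + n).choose n : ℂ) * (-1) ^ n +
    (∑ p ∈ Finset.HasAntidiagonal.antidiagonal m, bilin1213 α β γ (regPart r q (p.2 + n))
      (kernelCoeff (regPart r q) z p.1) * (((p.2 + n).choose n : ℂ) * (-1) ^ n)) +
    (∑ p ∈ Finset.HasAntidiagonal.antidiagonal n, bilin1223 α β γ (regPart r q (m + p.2))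
      (kernelCoeff (regPart r q) z p.1) * (((m + p.2).choose p.2 : ℂ) * (-1) ^ p.2)) +
    bilin1323 α β γ (kernelCoeff (regPart r q) z m) (kernelCoeff (regPart r q) z n) +
    γ (contract ((killingIso g).symm ⁅killingIso g α, killingIso g β⁆)
      (kernelCoeff (regPart r q) z (m + n + 1))) = 0 := by
  have hq : q ∈ regularSet r := ⟨r₀, hev⟩
  have hn := hev.self_of_nhds
  obtain ⟨s, hs, hrs⟩ := hr.exists_hasTaylorV hq hn
  choose d hd hrd using hr.exists_hasTaylorV_dRegPart hev
  have hzr : ‖-z‖ < r₀ := by rw [norm_neg]; linarith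
  have hδ : 2 * ‖z‖ ≤ r₀ := by linarith
  have ht := hs.kernel h0 hz
  set t : ℂ → g ⊗[ℂ] g := fun w => (w - z)⁻¹ • casimir g + s (w - z) with ht_def
  have hdz : ∀ a, HasTaylorV (fun w => d a (w + -z)) (shiftVec (dRegPart r q a) (-z)) ‖z‖ :=
    fun a => ((hd a).shift hzr).mono (by rw [norm_neg]; linarith)
  set ι := (killingIso g).symm ⁅killingIso g α, killingIso g β⁆ with hι
  have h1 := HasTaylor₂.snd (hdz (α.comp H.subtype) (γ ∘ₗ contract β))
  have h2 := (HasTaylor₂.fst (hdz (β.comp H.subtype) (γ ∘ₗ contract α))).const_mul (-1)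
  have h3 := HasTaylor₂.sub_arg (hd (γ.comp H.subtype) (β ∘ₗ contract α)) hδ
  have h4 := HasTaylorV.bilin_sub_fst (bilin1213 α β γ) hs ht hδ
  have h5 := HasTaylorV.bilin_sub_snd (bilin1223 α β γ) hs ht hδ
  have h6 := HasTaylorV.bilin (bilin1323 α β γ) ht ht
  -- All terms regular at x = y go into T, and the pole Ω/(x - y) leaves f(x) - f(y) with f(w) =
  -- γ(contract ι (r(w - z))). Multiplying by x - y also covers the diagonal, where the Yang–Baxter
  -- equation is not available.
  have key := (((((h1.add h2).add h3).add h4).add h5).add h6).coeff_of_divided_difference h0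
    (ht (γ ∘ₗ contract ι)) (fun x y hx hy => ?_) m n
  · simp only [LinearMap.comp_apply] at key
    rw [neg_one_mul, ← sub_eq_add_neg] at key
    exact key
  -- the Yang–Baxter equation
  obtain rfl | hxy := eq_or_ne x y
  · rw [sub_self, zero_mul, sub_self, add_zero]
  have hne : ∀ w : ℂ, ‖w‖ < ‖z‖ → 0 < ‖w - z‖ ∧ ‖w - z‖ < r₀ := fun w hw =>
    ⟨norm_pos_iff.mpr fun h => by
      rw [sub_eq_zero.mp h] at hw
      exact lt_irrefl _ hw, (norm_sub_le w z).trans_lt (by linarith)⟩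
  have hxy0 : x - y ≠ 0 := sub_ne_zero.mpr hxy
  have hxy1 : 0 < ‖x - y‖ := norm_pos_iff.mpr hxy0
  have hxy2 : ‖x - y‖ < r₀ := (norm_sub_le x y).trans_lt (by linarith)
  obtain ⟨hx1, hx2⟩ := hne x hx
  obtain ⟨hy1, hy2⟩ := hne y hy
  have hzx1 : 0 < ‖z - x‖ := by rwa [norm_sub_rev]
  have hzx2 : ‖z - x‖ < r₀ := by rwa [norm_sub_rev]
  have e1 : r q (x - z) = t x := hrs _ hx1 hx2
  have e2 : r q (y - z) = t y := hrs _ hy1 hy2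
  have e3 := hrs _ hxy1 hxy2
  -- Unitarity, differentiated in q, rewrites the r³¹ term at z - x as minus the derivative of r at
  -- x - z, which can be expanded in x.
  have e4 : TensorProduct.comm ℂ g g (partialDeriv r (β.comp H.subtype) q (z - x)) =
      -d (β.comp H.subtype) (x + -z) := by
    rw [hrd _ _ hzx1 hzx2, ← sub_eq_add_neg, ← neg_sub x z]
    exact (hd _).comm_neg (hr.comm_dRegPart hq _) hx2
  clear_value t
  have hB : bilin1213 α β γ ((x - y)⁻¹ • casimir g + s (x - y)) (t x) =
      (x - y)⁻¹ * γ (contract ι (t x)) + bilin1213 α β γ (s (x - y)) (t x) := by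
    rw [map_add, LinearMap.add_apply, map_smul, LinearMap.smul_apply, bilin1213_casimir,
      smul_eq_mul]
  have hC : bilin1223 α β γ ((x - y)⁻¹ • casimir g + s (x - y)) (t y) =
      (x - y)⁻¹ * -γ (contract ι (t y)) + bilin1223 α β γ (s (x - y)) (t y) := by
    rw [map_add, LinearMap.add_apply, map_smul, LinearMap.smul_apply, bilin1223_casimir,
      smul_eq_mul]
  have hY := congrArg (tripleDual α β γ) (hr.cdybe q x y z (hn.2 _ hxy1 hxy2) (hn.2 _ hx1 hx2)
    (hn.2 _ hy1 hy2) (hn.2 _ hzx1 hzx2))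
  rw [map_add, map_add, map_add, map_zero, tripleDual_altD_eq (hn.2 _ hxy1 hxy2)
    (hn.2 _ hy1 hy2) (hn.2 _ hzx1 hzx2), ← bilin1213_apply, ← bilin1223_apply, ← bilin1323_apply,
    e1, e2, e3, e4, hrd _ _ hy1 hy2, hrd _ _ hxy1 hxy2, hB, hC, map_neg, map_neg,
    sub_eq_add_neg y z] at hY
  simp only [LinearMap.comp_apply]
  have hc : (x - y) * (x - y)⁻¹ = 1 := mul_inv_cancel₀ hxy0
  linear_combination (x - y) * hY - (γ (contract ι (t x)) - γ (contract ι (t y))) * hc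

/-- Both sides are Laurent series in z, so it suffices to compare values at small z against a
functional γ. There the defect is the x^m y^n coefficient of the Yang–Baxter equation at (x, y, z),
term by term. -/
theorem IsDynamicalRMatrix.mdybeDefect_monomial (hr : IsDynamicalRMatrix r)
    (hq : q ∈ regularSet r) (m n : ℕ) (α β : Module.Dual ℂ g) :
    mdybeDefect (regSeries r q) (dRegSeries hr hq) (Loop.monomial (-1 - m) α)
      (Loop.monomial (-1 - n) β) = 0 := by
  obtain ⟨r₀, hev⟩ := id hq
  have hn := hev.self_of_nhds
  obtain ⟨s, hs, -⟩ := hr.exists_hasTaylorV hq hn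
  set A := regSeries r q with hA
  set dA := dRegSeries hr hq with hdA
  set ξ : Loop (Module.Dual ℂ g) := Loop.monomial (-1 - m) α with hξ
  set η : Loop (Module.Dual ℂ g) := Loop.monomial (-1 - n) β with hη
  have hsA : HasTaylorV s A.1 r₀ := hs
  have hd : ∀ a, ∃ s, HasTaylorV s (dA a).1 r₀ := fun a =>
    (hr.exists_hasTaylorV_dRegPart hev a).imp fun _ h => h.1
  have hIξ : loopIso g ξ = Loop.monomial (-1 - m) (killingIso g α) := Loop.map_monomial _ _ _
  have hIη : loopIso g η = Loop.monomial (-1 - n) (killingIso g β) := Loop.map_monomial _ _ _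
  have hK := fun (a : TaylorCoeff (g ⊗[ℂ] g)) ζ {k : ℤ} (hk : k < 0) => residueOp_apply_neg a ζ hk
  -- the argument of the second term
  have hX : Loop.bracket (innerOp A ξ) (loopIso g η) + Loop.bracket (loopIso g ξ) (innerOp A η) +
      Loop.bracket (loopIso g ξ) (loopIso g η) =
      Loop.bracket (residueOp A ξ) (loopIso g η) + Loop.bracket (loopIso g ξ) (residueOp A η) +
      (-1 : ℂ) • Loop.bracket (loopIso g ξ) (loopIso g η) := by
    have hS : ∀ (k : ℕ) (δ : Module.Dual ℂ g), innerOp A (Loop.monomial (-1 - k) δ) =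
        residueOp A (Loop.monomial (-1 - k) δ) +
          (-1 : ℂ) • loopIso g (Loop.monomial (-1 - k) δ) := fun k δ => by
      rw [innerOp_monomial]
      exact (sub_eq_add_neg _ _).trans (congrArg _ (neg_one_smul ℂ _).symm)
    rw [hξ, hη, hS, hS, Loop.bracket_add_left, Loop.bracket_add_right, Loop.bracket_smul_left,
      Loop.bracket_smul_right]
    module
  have hX3 : loopIsoInv g (Loop.bracket (loopIso g ξ) (loopIso g η)) =
      Loop.monomial (-1 - ((m + n + 1 : ℕ) : ℤ))
        ((killingIso g).symm ⁅killingIso g α, killingIso g β⁆) := by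
    rw [hIξ, hIη, Loop.bracket_monomial_monomial]
    refine (Loop.map_monomial _ _ _).trans ?_
    congr 1
    push_cast
    ring
  -- Bracketing a power series with a multiple of z^(-1-n) gives a pole of order at most n + 1. This
  -- bounds the sum over kernel coefficients by the range of the antidiagonal of n.
  have b1 : ∀ k < -((n + 1 : ℕ) : ℤ),
      (loopIsoInv g (Loop.bracket (residueOp A ξ) (loopIso g η))).1 k = 0 := fun k hk => by
    rw [Loop.map_apply, hIη, Loop.bracket_monomial_right, hK _ _ (by push_cast at hk; omega),
      zero_lie, map_zero]
  have b2 : ∀ k < -((m + 1 : ℕ) : ℤ),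
      (loopIsoInv g (Loop.bracket (loopIso g ξ) (residueOp A η))).1 k = 0 := fun k hk => by
    rw [Loop.map_apply, hIξ, Loop.bracket_monomial_left, hK _ _ (by push_cast at hk; omega),
      lie_zero, map_zero]
  have hL1 := Loop.hasLaurentV_bracket (hasLaurentV_innerOp_monomial hsA m α)
    (hasLaurentV_innerOp_monomial hsA n β)
  have hL2 := (hasLaurentV_innerOp hsA b1).add ((hasLaurentV_innerOp hsA b2).add
    ((hasLaurentV_innerOp_monomial hsA (m + n + 1)
      ((killingIso g).symm ⁅killingIso g α, killingIso g β⁆)).smul (-1)))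
  obtain ⟨s₁, hs₁⟩ := hd (iStar H ξ)
  obtain ⟨s₂, hs₂⟩ := hd (iStar H η)
  have hL3 := hasLaurentV_residueOp_monomial hs₁ n β
  have hL4 := hasLaurentV_residueOp_monomial hs₂ m α
  have hL := ((((hL1.sub hL2).add hL3).sub hL4).add
    (Loop.hasLaurentV_const (dPairing dA ξ η : g) r₀)).mono (half_le_self hn.1.le)
  have hzero : HasLaurentV (fun _ => (0 : g)) (0 : Loop g).1 (r₀ / 2) :=
    ⟨⟨0, fun _ _ => rfl⟩, fun φ z _ _ => by simp⟩
  have hdef : mdybeDefect A dA ξ η = Loop.bracket (innerOp A ξ) (innerOp A η)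
      - (innerOp A (loopIsoInv g (Loop.bracket (residueOp A ξ) (loopIso g η))) +
        (innerOp A (loopIsoInv g (Loop.bracket (loopIso g ξ) (residueOp A η))) +
        (-1 : ℂ) • innerOp A (Loop.monomial (-1 - ((m + n + 1 : ℕ) : ℤ))
          ((killingIso g).symm ⁅killingIso g α, killingIso g β⁆))))
      + residueOp (dA (iStar H ξ)) η - residueOp (dA (iStar H η)) ξ
      + Loop.const (dPairing dA ξ η : g) := by
    rw [mdybeDefect, hX, map_add, map_add, map_smul, map_add, map_add, map_smul, hX3, add_assoc]
  rw [hdef]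
  refine Subtype.ext (hL.unique hzero (half_pos hn.1) fun z h0 hz => ?_)
  refine eq_of_forall_dual fun γ => ?_
  have hc := hr.taylorCoeff_cdybe hev h0 hz α β γ m n
  -- Pairing an element of h with γ differentiates along γ restricted to h; on monomials the residue
  -- pairing then selects a single Taylor coefficient, that of the r¹² derivative term.
  have hv : γ (dPairing dA ξ η : g) = β (contract α (dRegPart r q (γ.comp H.subtype) (m + n))) *
      ((m + n).choose n : ℂ) * (-1) ^ n := by
    have h1 := apply_dPairing dA ξ η (γ.comp H.subtype)
    rw [hη, Loop.pairing_monomial n β fun k hk => hK _ _ hk, residueOp_monomial, map_smul,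
      smul_eq_mul, ← Nat.choose_symm_add, add_comm n m] at h1
    refine Eq.trans h1 ?_
    show _ * β (contract α (dRegPart r q (γ.comp H.subtype) (m + n))) = _
    ring
  -- i* takes a residue, so it sees the monomial only for m = 0. This matches the r²³ derivative
  -- term, which is independent of x.
  have hd1 : γ (contract β (shiftVec (dA (iStar H ξ)).1 (-z) n)) =
      if m = 0 then γ (contract β (shiftVec (dRegPart r q (α.comp H.subtype)) (-z) n)) else 0 := by
    rw [hξ, iStar_monomial]
    split_ifs
    · rfl
    · rw [map_zero, Submodule.coe_zero, shiftVec_zero, map_zero, map_zero]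
  have hd2 : γ (contract α (shiftVec (dA (iStar H η)).1 (-z) m)) =
      if n = 0 then γ (contract α (shiftVec (dRegPart r q (β.comp H.subtype)) (-z) m)) else 0 := by
    rw [hη, iStar_monomial]
    split_ifs
    · rfl
    · rw [map_zero, Submodule.coe_zero, shiftVec_zero, map_zero, map_zero]
  -- The term S I⁻¹[Sξ, Iη], without the pole part of Sξ, is the bracket [r¹², r²³] with r¹²
  -- replaced by its regular part.
  have hs1 : ∑ k ∈ Finset.range (n + 1), γ (contract
      ((loopIsoInv g (Loop.bracket (residueOp A ξ) (loopIso g η))).1 (-1 - k))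
      (kernelCoeff A.1 z k)) = -∑ p ∈ Finset.HasAntidiagonal.antidiagonal n,
        bilin1223 α β γ (regPart r q (m + p.2)) (kernelCoeff (regPart r q) z p.1) *
          (((m + p.2).choose p.2 : ℂ) * (-1) ^ p.2) := by
    rw [Finset.Nat.sum_antidiagonal_eq_sum_range_succ (fun i j =>
      bilin1223 α β γ (regPart r q (m + j)) (kernelCoeff (regPart r q) z i) *
          (((m + j).choose j : ℂ) * (-1) ^ j)), ← Finset.sum_neg_distrib]
    refine Finset.sum_congr rfl fun k hk => ?_
    have hkn : k ≤ n := Nat.lt_succ_iff.mp (Finset.mem_range.mp hk)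
    rw [Loop.map_apply, hIη, Loop.bracket_monomial_right,
      show -1 - (k : ℤ) - (-1 - n) = ((n - k : ℕ) : ℤ) by push_cast [Nat.cast_sub hkn]; ring, hξ,
      residueOp_monomial, bilin1223_apply, tripleDual_br1223, comp_ad_eq, contract_neg_left,
      map_neg, smul_lie]
    show γ (contract ((killingIso g).symm (_ • _)) _) = _
    rw [map_smul, contract_smul_left, map_smul, smul_eq_mul, ← Nat.choose_symm_add,
      add_comm (n - k) m]
    show _ * γ (contract ((killingIso g).symm ⁅contract α (regPart r q (m + (n - k))),
      killingIso g β⁆) (kernelCoeff (regPart r q) z k)) = _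
    ring
  -- Likewise for [r¹², r¹³]. Here β contracts the second leg of r¹², so unitarity is needed to flip
  -- it; it brings the sign (-1)^(m - k + n).
  have hs2 : ∑ k ∈ Finset.range (m + 1), γ (contract
      ((loopIsoInv g (Loop.bracket (loopIso g ξ) (residueOp A η))).1 (-1 - k))
      (kernelCoeff A.1 z k)) = -∑ p ∈ Finset.HasAntidiagonal.antidiagonal m,
        bilin1213 α β γ (regPart r q (p.2 + n)) (kernelCoeff (regPart r q) z p.1) *
          (((p.2 + n).choose n : ℂ) * (-1) ^ n) := by
    rw [Finset.Nat.sum_antidiagonal_eq_sum_range_succ (fun i j =>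
      bilin1213 α β γ (regPart r q (j + n)) (kernelCoeff (regPart r q) z i) *
          (((j + n).choose n : ℂ) * (-1) ^ n)), ← Finset.sum_neg_distrib]
    refine Finset.sum_congr rfl fun k hk => ?_
    have hkm : k ≤ m := Nat.lt_succ_iff.mp (Finset.mem_range.mp hk)
    rw [Loop.map_apply, hIξ, Loop.bracket_monomial_left,
      show -1 - (k : ℤ) - (-1 - m) = ((m - k : ℕ) : ℤ) by push_cast [Nat.cast_sub hkm]; ring, hη,
      residueOp_monomial, bilin1213_apply, tripleDual_br1213, hr.comm_regPart hq, comp_ad_eq]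
    show γ (contract ((killingIso g).symm ⁅killingIso g α, (_ * _ : ℂ) •
      contract β (regPart r q (m - k + n))⁆) (kernelCoeff (regPart r q) z k)) = _
    rw [map_neg, map_smul, ← neg_smul, smul_lie, ← lie_skew (killingIso g α), smul_lie]
    simp only [map_smul, map_neg, contract_smul_left, contract_neg_left, smul_eq_mul]
    have hn2 : (-1 : ℂ) ^ n * (-1) ^ n = 1 := by rw [← mul_pow]; norm_num
    rw [pow_add]
    generalize γ _ = T
    linear_combination (T * ((m - k + n).choose n : ℂ) * (-1) ^ (m - k)) * hn2
  show γ _ = γ 0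
  simp only [map_add, map_sub, map_sum, map_smul, smul_eq_mul]
  rw [hs1, hs2, hd1, hd2, hv, map_zero γ, show A.1 = regPart r q from rfl]
  rw [bilin1323_apply, tripleDual_br1323] at hc
  linear_combination hc

theorem IsDynamicalRMatrix.satisfiesMDYBE_pvOp (hr : IsDynamicalRMatrix r)
    (hq : q ∈ regularSet r) : SatisfiesMDYBE (fun p => pvOp (regSeries r p)) (-1 / 4) q :=
  fun ξ η => ⟨residueOp (dRegSeries hr hq (iStar H ξ)) η, residueOp (dRegSeries hr hq (iStar H η)) ξ,
    dPairing (dRegSeries hr hq) ξ η, hr.hasLoopDeriv_pvOp hq _ η, hr.hasLoopDeriv_pvOp hq _ ξ,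
    hr.hasFDerivAt_pairing hq ξ η,
    mdybe_of_defect_eq_zero (mdybeDefect_eq_zero (hr.mdybeDefect_monomial hq) ξ η)⟩

end YangBaxter

end SpinCM

end

theorem mainTheorem4 {g : Type*} [LieRing g] [LieAlgebra ℂ g] [FiniteDimensional ℂ g]
    [LieAlgebra.IsSimple ℂ g] (H : LieSubalgebra ℂ g) [H.IsCartanSubalgebra]
    (r : Module.Dual ℂ H → ℂ → TensorProduct ℂ g g) (hr : SpinCM.IsDynamicalRMatrix r) :
    (∃ R : Module.Dual ℂ H → SpinCM.Loop (Module.Dual ℂ g) →ₗ[ℂ] SpinCM.Loop g,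
      SpinCM.IsROperator r R) ∧
    ∀ R : Module.Dual ℂ H → SpinCM.Loop (Module.Dual ℂ g) →ₗ[ℂ] SpinCM.Loop g,
      SpinCM.IsROperator r R →
        ∀ q ∈ SpinCM.regularSet r,
          SpinCM.IsHEquivariant H (R q) ∧ SpinCM.SatisfiesMDYBE R (-1 / 4) q := by
  -- Any operator of r agrees with the constructed one on the regular set. This set is open, so the
  -- derivatives at q agree too.
  refine ⟨⟨_, hr.isROperator_pvOp⟩, fun R hR q hq => ⟨?_, ?_⟩⟩
  · rw [hR.eq_of_mem hr.isROperator_pvOp hq]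
    exact hr.isHEquivariant_pvOp hq
  · refine (hr.satisfiesMDYBE_pvOp hq).congr ?_
    filter_upwards [SpinCM.eventually_mem_regularSet hq] with p hp
    exact (hR.eq_of_mem hr.isROperator_pvOp hp).symm
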